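/- **Setting.** Let $f:\{\pm1\}^r\to\{0,1\}$ have Fourier expansion $f(x)=\sum_{S\subseteq[r]}\hat f(S)\prod_{\kappa\in S}x_\kappa$, and put $\|f^{=j}\|^2=\sum_{|S|=j}\hat f(S)^2$. Assume $f$ has no linear terms, $\|f^{=1}\|^2=0$. Let $\xi(s)=\sum_{j=1}^r\|f^{=j}\|^2s^j$, let $\delta>0$, $L=\lfloor 1/\delta\rfloor$, and $\nu_\ell=\frac{\xi'(\ell\delta)-\xi'((\ell-1)\delta)}{r}$ for $\ell\ge1$. Consider finite $r$-uniform CSP instances with variable set $V$ and clause set $E$. Each clause $e$ has an ordered list $\partial e=[v_{e,1},\dots,v_{e,r}]$ of variables and signs $\epsilon_{e,1},\dots,\epsilon_{e,r}\in\{\pm1\}$ (for instance all $+1$), and its clause function is $f_e(x)=f(\epsilon_{e,1}x_1,\dots,\epsilon_{e,r}x_r)$, extended multilinearly to $\mathbb R^r$. Let $\partial i$ be the set of clauses containing $i$. The instance is *$d$-index-regular* ($d\ge1$) if each variable lies in exactly $d$ clauses and, for each $\kappa\in[r]$, is the $\kappa$-th variable of exactly $d/r$ of them. Assume that its hypergraph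 has girth at least $2L+2$. For $i\in\partial b$, $\mathsf D_{i;b}f_b$ is the partial derivative of $f_b$ in the coordinate of $\partial b$ occupied by $i$. The distance between two variables is the least number of clauses in a path joining them, and $\mathsf B_i(\ell)$ is the set of variables at distance at most $\ell$ from $i$. Let $z_i^0$, $i\in V$, be independent $\mathcal N(0,\delta)$ random variables, and let $\mathcal G_i^\ell=\sigma(z_j^0: j\in\mathsf B_i(\ell))$. Let $F^{i\to a}_\ell, F^i_\ell:\mathbb R^\ell\to[-K,K]$ $(0\le\ell<L)$ be Borel functions. With $z_{i\to a}^0=z_i^0$ and $w_i^0=w_{i\to a}^0=0$, define for $0\le\ell<L$ $$w_{i\to a}^{\ell+1}=\frac1{\sqrt{d-1}}\sum_{b\in\partial i\setminus a}\mathsf D_{i;b}f_b\big((z^\ell_{j\to b})_{j\in\partial b}\big),\qquad w_i^{\ell+1}=\frac1{\sqrt d}\sum_{b\in\partial i}\mathsf D_{i;b}f_b\big((z^\ell_{j\to b})_{j\in\partial b}\big),$$ $$u_{i\to a}^{\ell+1}=w_{i\to a}^{\ell+1}-w_{i\to a}^\ell,\quad u_i^{\ell+1}=w_i^{\ell+1}-w_i^\ell,\quad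 A_{i\to a}^\ell=F_\ell^{i\to a}(u^1_{i\to a},\dots,u^\ell_{i\to a}),\quad A_i^\ell=F_\ell^i(u_i^1,\dots,u_i^\ell),$$ $$z_{i\to a}^{\ell+1}=z_i^0+\sum_{s=1}^{\ell+1}A_{i\to a}^{s-1}u_{i\to a}^s .$$ Assume the second-moment normalization $\mathbb E[(A_i^\ell)^2]=\mathbb E[(A_{i\to a}^\ell)^2]=\delta/\nu_{\ell+1}$ for all $0\le\ell<L$, $i\in V$, $a\in\partial i$. (If $f$ is constant then all $\nu_\ell$ vanish, and $\delta/0$ is read as $0$.) **Theorem.** Fix $f,\delta,K$ and an integer $1\le\ell\le L$. Take any sequence of such instances, with probability spaces, initializations and nonlinearities as above, whose degrees $d$ tend to infinity, and a variable $i$ in each of them. Then there are random variables $U\sim\mathcal N(0,\nu_\ell)$, one for each instance of the sequence and defined on its probability space, independent of $\mathcal G_i^{\ell-1}$, such that for every choice of clauses $a\in\partial i$ and every real $p>0$, $|u_{i\to a}^\ell-U|^p$ is integrable and $$\mathbb E\big[\,|u_{i\to a}^\ell-U|^p\,\big|\,\mathcal G_i^{\ell-1}\big]\longrightarrow0\quad\text{in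 probability as } d\to\infty .$$ -/

import Mathlib

open MeasureTheory ProbabilityTheory Filter Topology

noncomputable section

namespace MsgCSP

/-! ### Predicates on the Boolean cube and their Fourier expansion -/

/-- Fourier coefficient `f̂(S) = 2^{-r} ∑_x f(x) ∏_{κ ∈ S} x_κ` of `f : {±1}^r → ℝ`. -/
def fourierCoeff {r : ℕ} (f : (Fin r → ℤˣ) → ℝ) (S : Finset (Fin r)) : ℝ :=
  (∑ x : Fin r → ℤˣ, f x * ∏ κ ∈ S, ((x κ : ℤ) : ℝ)) / 2 ^ r

/-- The multilinear polynomial `∑_S f̂(S) ∏_{κ ∈ S} X_κ` representing `f`. -/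
def multilinearPoly {r : ℕ} (f : (Fin r → ℤˣ) → ℝ) : MvPolynomial (Fin r) ℝ :=
  ∑ S : Finset (Fin r), MvPolynomial.C (fourierCoeff f S) * ∏ κ ∈ S, MvPolynomial.X κ

/-- The Fourier weight `‖f^{=j}‖²` of `f` at degree `j`. -/
def fourierWeight {r : ℕ} (f : (Fin r → ℤˣ) → ℝ) (j : ℕ) : ℝ :=
  ∑ S ∈ Finset.powersetCard j (Finset.univ : Finset (Fin r)), fourierCoeff f S ^ 2

/-- The mixture polynomial `ξ(s) = ∑_{j=1}^r ‖f^{=j}‖² s^j`. -/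
def xi {r : ℕ} (f : (Fin r → ℤˣ) → ℝ) : Polynomial ℝ :=
  ∑ j ∈ Finset.Icc 1 r, Polynomial.C (fourierWeight f j) * Polynomial.X ^ j

/-- `ν_ℓ = (ξ'(ℓδ) - ξ'((ℓ-1)δ)) / r`, used for `ℓ ≥ 1`. -/
def nu {r : ℕ} (f : (Fin r → ℤˣ) → ℝ) (δ : ℝ) (ℓ : ℕ) : ℝ :=
  ((xi f).derivative.eval ((ℓ : ℝ) * δ) - (xi f).derivative.eval (((ℓ : ℝ) - 1) * δ)) / r

/-! ### CSP instances and their hypergraphs -/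

/-- An `r`-uniform CSP instance with variables `V` and clauses `E`: the ordered list
`∂e = [∂e 0, …, ∂e (r-1)]` of variables of each clause, and the sign pattern of each clause. -/
structure Instance (r : ℕ) (V E : Type*) where
  bdry : E → Fin r → V
  sign : E → Fin r → ℤˣ

namespace Instance

variable {r : ℕ} {V E : Type*} (I : Instance r V E)

/-- The clause function `f_e(x) = f(ε_{e,1} x_1, …, ε_{e,r} x_r)`. -/
def clauseFun (f : (Fin r → ℤˣ) → ℝ) (e : E) : (Fin r → ℤˣ) → ℝ :=
  fun x => f (fun κ => I.sign e κ * x κ)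

/-- `i ∈ ∂e`. -/
def Inc (i : V) (e : E) : Prop := ∃ κ, I.bdry e κ = i

open Classical in
/-- The set `∂i` of clauses in which variable `i` takes part. -/
def star [Fintype E] (i : V) : Finset E := Finset.univ.filter (fun e => I.Inc i e)

open Classical in
/-- The set `∂i \ a` of clauses other than `a` in which variable `i` takes part. -/
def starErase [Fintype E] (i : V) (a : E) : Finset E := (I.star i).erase a

/-- The bipartite factor graph: variable `i` and clause `e` are joined iff `i ∈ ∂e`. -/
def factorGraph : SimpleGraph (V ⊕ E) :=
  SimpleGraph.fromRel (fun p q => ∃ i e, p = Sum.inl i ∧ q = Sum.inr e ∧ I.Inc i e)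

/-- The graph on the variables in which two distinct variables are adjacent iff they share a
clause; its distance is the distance of the hypergraph. -/
def primalGraph : SimpleGraph V :=
  SimpleGraph.fromRel (fun i j => ∃ e, I.Inc i e ∧ I.Inc j e)

/-- The ball `B_i(ℓ)` of variables at hypergraph distance at most `ℓ` from `i`. -/
def ball (i : V) (ℓ : ℕ) : Set V := {j | I.primalGraph.edist i j ≤ (ℓ : ℕ∞)}

/-- The hypergraph has girth at least `g` (for `g ≥ 2`): no clause repeats a variable (a cycle of
length one), and there is no cycle of length `k` with `2 ≤ k < g`; cycles of length `k` of the
hypergraph are the cycles of length `2k` of the factor graph. -/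
def GirthAtLeast (g : ℕ) : Prop :=
  (∀ e, Function.Injective (I.bdry e)) ∧ ((2 * g : ℕ) : ℕ∞) ≤ I.factorGraph.egirth

open Classical in
/-- `d`-index-regularity: every variable takes part in `d` clauses, and is the `κ`-th variable of
exactly `d / r` clauses, for each index `κ`. -/
def IndexRegular [Fintype E] (d : ℕ) : Prop :=
  ∀ i : V, (I.star i).card = d ∧
    ∀ κ : Fin r, r * (Finset.univ.filter (fun e => I.bdry e κ = i)).card = d

open Classical in
/-- `D_{i;b} f_b (x)`: the partial derivative of the multilinear extension of the clause function
of `b`, at the coordinate of `∂b` occupied by `i`. (When the entries of `∂b` are distinct and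
`i ∈ ∂b` the sum has exactly one term.) -/
def partialD (f : (Fin r → ℤˣ) → ℝ) (i : V) (b : E) (x : Fin r → ℝ) : ℝ :=
  ∑ κ ∈ Finset.univ.filter (fun κ => I.bdry b κ = i),
    MvPolynomial.eval x (MvPolynomial.pderiv κ (multilinearPoly (I.clauseFun f b)))

/-! ### The message-passing algorithm

`d` is the degree, `F i a ℓ` is the nonlinearity `F_{→,ℓ}` used by the message from `i` to `a`, and
`z₀` is the initialization. -/

section Algorithm

variable [Fintype E] (f : (Fin r → ℤˣ) → ℝ) (d : ℕ)
  (F : V → E → (ℓ : ℕ) → (Fin ℓ → ℝ) → ℝ) (z₀ : V → ℝ)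

mutual

/-- `w_{i→a}^ℓ`. -/
def wMsg : ℕ → V → E → ℝ
  | 0, _, _ => 0
  | ℓ + 1, i, a => (1 / √((d : ℝ) - 1)) *
      ∑ b ∈ I.starErase i a, I.partialD f i b (fun κ => zMsg ℓ (I.bdry b κ) b)
  termination_by ℓ => 2 * ℓ

/-- `z_{i→a}^ℓ = z_i^0 + ∑_{s=1}^ℓ A_{i→a}^{s-1} u_{i→a}^s`, where
`A_{i→a}^s = F_{→,s}(u_{i→a}^1, …, u_{i→a}^s)` and `u_{i→a}^{s+1} = w_{i→a}^{s+1} - w_{i→a}^s`. -/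
def zMsg : ℕ → V → E → ℝ
  | ℓ, i, a => z₀ i + ∑ s : Fin ℓ,
      F i a s (fun t : Fin s => wMsg (t + 1) i a - wMsg t i a) *
        (wMsg (s + 1) i a - wMsg s i a)
  termination_by ℓ => 2 * ℓ + 1

end

/-- The message `u_{i→a}^ℓ = w_{i→a}^ℓ - w_{i→a}^{ℓ-1}`, used for `ℓ ≥ 1`. -/
def uMsg (ℓ : ℕ) (i : V) (a : E) : ℝ :=
  I.wMsg f d F z₀ ℓ i a - I.wMsg f d F z₀ (ℓ - 1) i a

/-- `A_{i→a}^ℓ = F_{→,ℓ}(u_{i→a}^1, …, u_{i→a}^ℓ)`. -/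
def AMsg (ℓ : ℕ) (i : V) (a : E) : ℝ :=
  F i a ℓ (fun t : Fin ℓ => I.uMsg f d F z₀ (t + 1) i a)

/-- `w_i^ℓ`. -/
def wNode : ℕ → V → ℝ
  | 0, _ => 0
  | ℓ + 1, i => (1 / √(d : ℝ)) *
      ∑ b ∈ I.star i, I.partialD f i b (fun κ => I.zMsg f d F z₀ ℓ (I.bdry b κ) b)

/-- `u_i^ℓ = w_i^ℓ - w_i^{ℓ-1}`, used for `ℓ ≥ 1`. -/
def uNode (ℓ : ℕ) (i : V) : ℝ :=
  I.wNode f d F z₀ ℓ i - I.wNode f d F z₀ (ℓ - 1) i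

/-- `A_i^ℓ = F_ℓ(u_i^1, …, u_i^ℓ)`, where `Fnode i ℓ` is the nonlinearity used at the node `i`. -/
def ANode (Fnode : V → (ℓ : ℕ) → (Fin ℓ → ℝ) → ℝ) (ℓ : ℕ) (i : V) : ℝ :=
  Fnode i ℓ (fun t : Fin ℓ => I.uNode f d F z₀ (t + 1) i)

/-- The nonlinearities of the iterations `ℓ < L` are Borel functions `ℝ^ℓ → [-K, K]`. -/
def BoundedNonlinearities (F : V → E → (ℓ : ℕ) → (Fin ℓ → ℝ) → ℝ)
    (Fnode : V → (ℓ : ℕ) → (Fin ℓ → ℝ) → ℝ) (L : ℕ) (K : ℝ) : Prop :=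
  ∀ ℓ < L, ∀ i : V,
    (Measurable (Fnode i ℓ) ∧ ∀ x, Fnode i ℓ x ∈ Set.Icc (-K) K) ∧
    ∀ a : E, Measurable (F i a ℓ) ∧ ∀ x, F i a ℓ x ∈ Set.Icc (-K) K

/-- Normalization of the second moment: `E[(A_i^ℓ)²] = E[(A_{i→a}^ℓ)²] = δ / ν_{ℓ+1}` for all
iterations `ℓ < L`, variables `i`, and clauses `a ∈ ∂i`. Here `z v` is the random variable `z_v^0`. -/
def SecondMomentNormalized {Ω : Type*} [MeasurableSpace Ω] (μ : Measure Ω) (z : V → Ω → ℝ)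
    (Fnode : V → (ℓ : ℕ) → (Fin ℓ → ℝ) → ℝ) (δ : ℝ) (L : ℕ) : Prop :=
  ∀ ℓ < L, ∀ i : V, ∀ a ∈ I.star i,
    ∫ ω, (I.ANode f d F (fun v => z v ω) Fnode ℓ i) ^ 2 ∂μ = δ / nu f δ (ℓ + 1) ∧
    ∫ ω, (I.AMsg f d F (fun v => z v ω) ℓ i a) ^ 2 ∂μ = δ / nu f δ (ℓ + 1)

end Algorithm

/-- The σ-algebra `𝒢_i^ℓ` generated by the initial values `z_j^0`, `j ∈ B_i(ℓ)`. -/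
@[reducible]
def sigmaBall {Ω : Type*} (z : V → Ω → ℝ) (i : V) (ℓ : ℕ) : MeasurableSpace Ω :=
  ⨆ j ∈ I.ball i ℓ, MeasurableSpace.comap (z j) inferInstance

end Instance

end MsgCSP

end

/-!
Since `f` has no linear terms, the increment `u^{m+1}` of the message out of a variable `i` is a
normalized sum, over the clauses of `i`, of increments of clause derivatives (`clauseStep`,
`clauseVar`), for `m = 0` too. Because the girth is large, the contributions of different clauses
are functions of the initial values on disjoint branches of a tree (`eq_of_mem_msgSphere_of_root`,
`eq_of_mem_msgSphere_of_clause`), hence independent (`iIndepFun_clauseVar`), and each contribution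
has mean zero given all initial values except those at distance exactly `m + 1` from `i` in its
branch (`condZero_clauseStep`). The latter fresh values lie outside the ball of radius `m` around `i`
(`not_mem_ball_of_mem_msgSphere`). All moments are bounded uniformly over the instances
(`exists_messageBound`).

*Variance.* The increments of `z` are martingale differences, and the normalization of the
nonlinearities gives them second moment about `δ`, because weighting `u²` by a function of the past
asymptotically multiplies expectations (`exists_integral_AMsg_sq_mul_uMsg_sq`). So `E z² ≈ mδ` after
`m` steps (`exists_zPrev_sq_close`), and the second moment of a contribution is a difference of
polynomials in `mδ` and `(m+1)δ` that depends on the position of `i` in the clause;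
index-regularity averages over the positions, and `E u² → ν_{m+1}` (`exists_uMsg_sq_sub_nu_le`).

*Conditional central limit theorem.* Let `H` be the message increment plus a vanishing multiple of
one fresh initial value (`noisyMsg`), and let `H'` be its version with all fresh initial values
resampled (`merge`, `resampleIndex`). A clause's contributions to `H` and to `H'` are orthogonal, so
the joint characteristic function of `H` and `H'` tends to that of two independent `N(0, ν)`
variables (`exists_charFun_resample_bound`, `tendsto_integral_noisyMsg_merge`). This says that the
conditional law of `H`, given the values that are not fresh, becomes `N(0, ν)`.

*Coupling.* The added fresh value makes the conditional law of `H` atomless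
(`nullSingletonClass_noisyMsg`). Therefore `U`, the quantile of `N(0, ν)` at the conditional
distribution function of `H` evaluated at `H` (`couple`), has law `N(0, ν)` and is independent of
the values that are not fresh (`measure_couple_inter`). With `Φ` the distribution function of
`N(0, ν)`, the correlation of `Φ(U)` with `Φ(H)` is `E[1{H' ≤ H} Φ(H)]`, which tends to `E Φ(U)²`;
so `E (Φ(U) - Φ(H))² → 0` (`tendsto_integral_cdf_couple_sub_sq`), and with the moment bounds
`E |U - H|^q → 0` (`tendsto_integral_abs_sub_pow`). The messages from `i` into different clauses
differ by two contributions out of `d` (`uMsg_sub_noisyMsg`), so the same `U` serves for all of them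
(`tendsto_integral_uMsg_sub_couple`). Convergence in mean gives the convergence in probability of
the conditional expectations (`tendsto_measure_condExp`).

For a constant predicate the messages and `ν` vanish, and `U = 0`.
-/

set_option linter.unusedSectionVars false

noncomputable section

/-! ### Paths in graphs of large girth -/

namespace SimpleGraph

/-- Two paths with the same endpoints whose total length is below the girth coincide: the graph
formed by their edges has too few edges to contain a cycle, so it is a forest. -/
lemma path_unique_of_lt_egirth {α : Type*} {G : SimpleGraph α} {u v : α} {p q : G.Walk u v}
    (hp : p.IsPath) (hq : q.IsPath) (h : ((p.length + q.length : ℕ) : ℕ∞) < G.egirth) :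
    p = q := by
  classical
  set s : Finset (Sym2 α) := p.edges.toFinset ∪ q.edges.toFinset with hs
  have hsG : ∀ e ∈ s, e ∈ G.edgeSet := by
    intro e he
    simp only [hs, Finset.mem_union, List.mem_toFinset] at he
    rcases he with he | he
    · exact p.edges_subset_edgeSet he
    · exact q.edges_subset_edgeSet he
  set H : SimpleGraph α := fromEdgeSet (s : Set (Sym2 α)) with hH
  have hHG : H ≤ G := by
    intro a b hab
    rw [hH, fromEdgeSet_adj] at hab
    exact hsG _ (by exact_mod_cast hab.1)
  have hmem : ∀ e, e ∈ s → e ∈ H.edgeSet := by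
    intro e he
    rw [hH, edgeSet_fromEdgeSet]
    exact ⟨by exact_mod_cast he, G.not_isDiag_of_mem_edgeSet (hsG e he)⟩
  have hac : H.IsAcyclic := by
    intro a c hc
    have hlen : c.length ≤ p.length + q.length := by
      rw [← c.length_edges, ← List.toFinset_card_of_nodup hc.edges_nodup]
      refine (Finset.card_le_card (t := s) ?_).trans ((Finset.card_union_le _ _).trans ?_)
      · intro e he
        have := c.edges_subset_edgeSet (List.mem_toFinset.1 he)
        rw [hH, edgeSet_fromEdgeSet] at this
        exact_mod_cast this.1
      · refine add_le_add ?_ ?_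
        · exact (List.toFinset_card_le _).trans p.length_edges.le
        · exact (List.toFinset_card_le _).trans q.length_edges.le
    have h1 := egirth_le_length (hc.mapLe hHG)
    rw [Walk.length_mapLe] at h1
    exact absurd (h.trans_le h1) (not_lt.2 (by exact_mod_cast hlen))
  have hp' : ∀ e ∈ p.edges, e ∈ H.edgeSet := fun e he => hmem e (by simp [hs, he])
  have hq' : ∀ e ∈ q.edges, e ∈ H.edgeSet := fun e he => hmem e (by simp [hs, he])
  have := (hac.subsingleton_path u v).elim ⟨p.transfer H hp', hp.transfer hp'⟩
    ⟨q.transfer H hq', hq.transfer hq'⟩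
  have h2 := congrArg Walk.support (congrArg Subtype.val this)
  simp only [Walk.support_transfer] at h2
  exact Walk.ext_support h2

/-- Below the girth, a path can be extended backwards by any edge other than its first one. -/
lemma cons_isPath_of_lt_egirth {α : Type*} {G : SimpleGraph α} {a u v : α} {p : G.Walk u v}
    (hp : p.IsPath) (hau : G.Adj a u) (hne : p.snd ≠ a)
    (h : ((p.length + 1 : ℕ) : ℕ∞) < G.egirth) : (Walk.cons hau p).IsPath := by
  classical
  rw [Walk.cons_isPath_iff]
  refine ⟨hp, fun hmem => ?_⟩
  have h1 : (p.takeUntil a hmem).IsPath := hp.takeUntil hmem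
  have h2 : (Walk.cons hau.symm Walk.nil : G.Walk u a).IsPath := by
    simp [Walk.cons_isPath_iff, hau.ne.symm]
  have h3 : p.takeUntil a hmem = Walk.cons hau.symm Walk.nil := by
    refine path_unique_of_lt_egirth h1 h2 (lt_of_le_of_lt ?_ h)
    have := p.length_takeUntil_le_length hmem
    simp only [Walk.length_cons, Walk.length_nil]
    exact_mod_cast (by omega)
  have h4 := p.snd_takeUntil (w := a) hau.ne hmem
  rw [h3] at h4
  exact hne (by rw [← h4]; simp)

end SimpleGraph

/-! ### Spheres of variables around a message -/

namespace MsgCSP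

namespace Instance

variable {r : ℕ} {V E : Type*} (I : Instance r V E)

/-- The variables reached from the clause `b` through its variable `j` by a non-backtracking path
with `m` further clauses: the initial values that the message from `j` to `b` sees for the first
time at iteration `m`. -/
def msgSphere : ℕ → V → E → Set V
  | 0, j, _ => {j}
  | m + 1, j, b => {v | ∃ c, I.Inc j c ∧ c ≠ b ∧ ∃ k, I.Inc k c ∧ k ≠ j ∧ v ∈ msgSphere m k c}

/-- The union of the spheres of radius less than `m` around the directed edge from `j` to `b`. -/
def msgBranch (m : ℕ) (j : V) (b : E) : Set V := {v | ∃ k < m, v ∈ I.msgSphere k j b}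

variable {I}

lemma factorGraph_adj_inl_inr {i : V} {e : E} :
    I.factorGraph.Adj (Sum.inl i) (Sum.inr e) ↔ I.Inc i e := by
  simp [factorGraph]

lemma factorGraph_adj_inr_inl {i : V} {e : E} :
    I.factorGraph.Adj (Sum.inr e) (Sum.inl i) ↔ I.Inc i e := by
  rw [SimpleGraph.adj_comm, factorGraph_adj_inl_inr]

lemma GirthAtLeast.lt_egirth {g n : ℕ} (hg : I.GirthAtLeast g) (h : n < 2 * g) :
    ((n : ℕ) : ℕ∞) < I.factorGraph.egirth :=
  lt_of_lt_of_le (by exact_mod_cast h) hg.2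

/-- The elements of a sphere are the endpoints of honest paths of the factor graph. -/
lemma exists_path_of_mem_msgSphere {g : ℕ} (hg : I.GirthAtLeast g) {m : ℕ} {j : V} {b : E} {v : V}
    (hm : 2 * m + 1 < 2 * g) (hj : I.Inc j b) (hv : v ∈ I.msgSphere m j b) :
    ∃ p : I.factorGraph.Walk (Sum.inr b) (Sum.inl v),
      p.IsPath ∧ p.length = 2 * m + 1 ∧ p.snd = Sum.inl j := by
  induction m generalizing j b with
  | zero =>
    obtain rfl : v = j := hv
    have hadj : I.factorGraph.Adj (Sum.inr b) (Sum.inl v) := factorGraph_adj_inr_inl.2 hj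
    exact ⟨SimpleGraph.Walk.cons hadj SimpleGraph.Walk.nil,
      by simp [SimpleGraph.Walk.cons_isPath_iff], by simp, by simp⟩
  | succ m ih =>
    obtain ⟨c, hjc, hcb, k, hkc, hkj, hv⟩ := hv
    obtain ⟨p, hp, hpl, hps⟩ := ih (by omega) hkc hv
    have hadj : I.factorGraph.Adj (Sum.inl j) (Sum.inr c) := factorGraph_adj_inl_inr.2 hjc
    have hp1 := SimpleGraph.cons_isPath_of_lt_egirth hp hadj (by rw [hps]; simpa using hkj)
      (hg.lt_egirth (by omega))
    have hadj2 : I.factorGraph.Adj (Sum.inr b) (Sum.inl j) := factorGraph_adj_inr_inl.2 hj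
    have hp2 := SimpleGraph.cons_isPath_of_lt_egirth hp1 hadj2 (by simpa using hcb)
      (hg.lt_egirth (by simp only [SimpleGraph.Walk.length_cons]; omega))
    exact ⟨_, hp2, by simp [hpl]; ring, by simp⟩

lemma exists_path_from_root {g : ℕ} (hg : I.GirthAtLeast g) {m : ℕ} {i j : V} {b : E} {v : V}
    (hm : 2 * m + 2 < 2 * g) (hi : I.Inc i b) (hj : I.Inc j b) (hji : j ≠ i)
    (hv : v ∈ I.msgSphere m j b) :
    ∃ p : I.factorGraph.Walk (Sum.inl i) (Sum.inl v),
      p.IsPath ∧ p.length = 2 * m + 2 ∧ p.getVert 1 = Sum.inr b ∧ p.getVert 2 = Sum.inl j := by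
  obtain ⟨p, hp, hpl, hps⟩ := exists_path_of_mem_msgSphere hg (by omega) hj hv
  have hadj : I.factorGraph.Adj (Sum.inl i) (Sum.inr b) := factorGraph_adj_inl_inr.2 hi
  have hp1 := SimpleGraph.cons_isPath_of_lt_egirth hp hadj (by rw [hps]; simpa using hji)
      (hg.lt_egirth (by omega))
  exact ⟨_, hp1, by simp [hpl], by simp, by simpa using hps⟩

/-- The branches hanging off a variable are disjoint. -/
lemma eq_of_mem_msgSphere_of_root {g : ℕ} (hg : I.GirthAtLeast g) {m m' : ℕ} {i j j' : V}
    {b b' : E} {v : V} (hm : m + m' + 2 < g) (hi : I.Inc i b) (hj : I.Inc j b) (hji : j ≠ i)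
    (hi' : I.Inc i b') (hj' : I.Inc j' b') (hji' : j' ≠ i)
    (hv : v ∈ I.msgSphere m j b) (hv' : v ∈ I.msgSphere m' j' b') :
    m = m' ∧ b = b' ∧ j = j' := by
  obtain ⟨p, hp, hpl, hp1, hp2⟩ := exists_path_from_root hg (by omega) hi hj hji hv
  obtain ⟨q, hq, hql, hq1, hq2⟩ := exists_path_from_root hg (by omega) hi' hj' hji' hv'
  obtain rfl : p = q :=
    SimpleGraph.path_unique_of_lt_egirth hp hq (hg.lt_egirth (by omega))
  refine ⟨by omega, ?_, ?_⟩
  · simpa using hp1.symm.trans hq1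
  · simpa using hp2.symm.trans hq2

/-- The branches leaving a clause through its variables are disjoint. -/
lemma eq_of_mem_msgSphere_of_clause {g : ℕ} (hg : I.GirthAtLeast g) {m m' : ℕ} {j j' : V}
    {b : E} {v : V} (hm : m + m' + 1 < g) (hj : I.Inc j b) (hj' : I.Inc j' b)
    (hv : v ∈ I.msgSphere m j b) (hv' : v ∈ I.msgSphere m' j' b) : m = m' ∧ j = j' := by
  obtain ⟨p, hp, hpl, hps⟩ := exists_path_of_mem_msgSphere hg (by omega) hj hv
  obtain ⟨q, hq, hql, hqs⟩ := exists_path_of_mem_msgSphere hg (by omega) hj' hv'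
  obtain rfl : p = q :=
    SimpleGraph.path_unique_of_lt_egirth hp hq (hg.lt_egirth (by omega))
  exact ⟨by omega, by simpa using hps.symm.trans hqs⟩

lemma exists_factor_walk_of_primal_walk {i v : V} (p : I.primalGraph.Walk i v) :
    ∃ q : I.factorGraph.Walk (Sum.inl i) (Sum.inl v), q.length = 2 * p.length := by
  induction p with
  | nil => exact ⟨SimpleGraph.Walk.nil, by simp⟩
  | @cons a b c h p ih =>
    obtain ⟨q, hq⟩ := ih
    have : ∃ e, I.Inc a e ∧ I.Inc b e := by
      simp only [primalGraph, SimpleGraph.fromRel_adj] at h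
      rcases h.2 with ⟨e, h1, h2⟩ | ⟨e, h1, h2⟩
      · exact ⟨e, h1, h2⟩
      · exact ⟨e, h2, h1⟩
    obtain ⟨e, ha, hb⟩ := this
    exact ⟨SimpleGraph.Walk.cons (factorGraph_adj_inl_inr.2 ha)
      (SimpleGraph.Walk.cons (factorGraph_adj_inr_inl.2 hb) q), by simp [hq]; ring⟩

/-- The sphere of radius `m` in a branch hanging off `i` lies at distance more than `m` from `i`. -/
lemma not_mem_ball_of_mem_msgSphere {g : ℕ} (hg : I.GirthAtLeast g) {m : ℕ} {i j : V}
    {b : E} {v : V} (hm : 2 * m + 1 < g) (hi : I.Inc i b) (hj : I.Inc j b) (hji : j ≠ i)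
    (hv : v ∈ I.msgSphere m j b) : v ∉ I.ball i m := by
  classical
  intro hball
  obtain ⟨p, hp, hpl, -⟩ := exists_path_from_root hg (by omega) hi hj hji hv
  have hfin : I.primalGraph.edist i v ≠ ⊤ := ne_top_of_le_ne_top (by simp) hball
  obtain ⟨w, hw⟩ := SimpleGraph.exists_walk_of_edist_ne_top hfin
  have hwl : w.length ≤ m := by
    have : ((w.length : ℕ) : ℕ∞) ≤ (m : ℕ∞) := by rw [hw]; exact hball
    exact_mod_cast this
  obtain ⟨q, hq⟩ := exists_factor_walk_of_primal_walk w
  have hql : q.bypass.length ≤ 2 * m := q.length_bypass_le_length.trans (by omega)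
  have := SimpleGraph.path_unique_of_lt_egirth hp q.bypass_isPath (hg.lt_egirth (by omega))
  rw [← this] at hql
  omega

lemma msgBranch_zero {j : V} {b : E} : I.msgBranch 0 j b = ∅ := by
  ext v; simp [msgBranch]

lemma msgBranch_mono {m m' : ℕ} (h : m ≤ m') {j : V} {b : E} :
    I.msgBranch m j b ⊆ I.msgBranch m' j b :=
  fun _ ⟨k, hk, hv⟩ => ⟨k, hk.trans_le h, hv⟩

lemma msgSphere_subset_msgBranch {m m' : ℕ} (h : m < m') {j : V} {b : E} :
    I.msgSphere m j b ⊆ I.msgBranch m' j b :=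
  fun _ hv => ⟨m, h, hv⟩

/-- The branches below `j`, away from `b`, are contained in the branch of `j` and `b`. -/
lemma msgBranch_subset_msgBranch_succ {m : ℕ} {j k : V} {b c : E} (hjc : I.Inc j c) (hcb : c ≠ b)
    (hkc : I.Inc k c) (hkj : k ≠ j) : I.msgBranch m k c ⊆ I.msgBranch (m + 1) j b :=
  fun _ ⟨n, hn, hv⟩ => ⟨n + 1, by omega, c, hjc, hcb, k, hkc, hkj, hv⟩

/-- When every variable lies in two clauses and every clause has two variables, no sphere is
empty. -/
lemma msgSphere_nonempty (h1 : ∀ j b, I.Inc j b → ∃ c, I.Inc j c ∧ c ≠ b)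
    (h2 : ∀ j c, I.Inc j c → ∃ k, I.Inc k c ∧ k ≠ j) (m : ℕ) {j : V} {b : E} (hj : I.Inc j b) :
    (I.msgSphere m j b).Nonempty := by
  induction m generalizing j b with
  | zero => exact ⟨j, rfl⟩
  | succ m ih =>
    obtain ⟨c, hc, hcb⟩ := h1 j b hj
    obtain ⟨k, hk, hkj⟩ := h2 j c hc
    obtain ⟨v, hv⟩ := ih hk
    exact ⟨v, c, hc, hcb, k, hk, hkj, hv⟩

end Instance

end MsgCSP

/-! ### Clause derivatives and the recursion of the messages -/

namespace MsgCSP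

lemma eval_pderiv_multilinearPoly {r : ℕ} (g : (Fin r → ℤˣ) → ℝ) (κ : Fin r) (x : Fin r → ℝ) :
    MvPolynomial.eval x (MvPolynomial.pderiv κ (multilinearPoly g)) =
      ∑ S : Finset (Fin r) with κ ∈ S, fourierCoeff g S * ∏ j ∈ S.erase κ, x j := by
  have h0 : ∀ S : Finset (Fin r), κ ∉ S →
      MvPolynomial.pderiv κ (∏ j ∈ S, (MvPolynomial.X j : MvPolynomial (Fin r) ℝ)) = 0 := by
    intro S hS
    induction S using Finset.induction_on with
    | empty => simp
    | insert a S ha ih =>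
      simp only [Finset.mem_insert, not_or] at hS
      rw [Finset.prod_insert ha, Derivation.leibniz, ih hS.2,
        MvPolynomial.pderiv_X_of_ne (Ne.symm hS.1)]
      simp
  have h1 : ∀ S : Finset (Fin r), κ ∈ S →
      MvPolynomial.pderiv κ (∏ j ∈ S, (MvPolynomial.X j : MvPolynomial (Fin r) ℝ)) =
        ∏ j ∈ S.erase κ, MvPolynomial.X j := by
    intro S hS
    rw [← Finset.mul_prod_erase S _ hS, Derivation.leibniz, h0 _ (Finset.notMem_erase κ S),
      MvPolynomial.pderiv_X_self]
    simp
  rw [multilinearPoly, map_sum, map_sum, Finset.sum_filter]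
  refine Finset.sum_congr rfl fun S _ => ?_
  rw [MvPolynomial.pderiv_C_mul]
  split_ifs with hS
  · rw [h1 S hS]
    simp
  · rw [h0 S hS]
    simp

lemma fourierCoeff_singleton_eq_zero {r : ℕ} {f : (Fin r → ℤˣ) → ℝ} (hlin : fourierWeight f 1 = 0)
    (κ : Fin r) : fourierCoeff f {κ} = 0 := by
  have h := (Finset.sum_eq_zero_iff_of_nonneg (fun S _ => sq_nonneg (fourierCoeff f S))).1 hlin
    {κ} (by simp [Finset.mem_powersetCard])
  exact pow_eq_zero_iff (two_ne_zero) |>.1 h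

lemma abs_fourierCoeff_le_one {r : ℕ} {f : (Fin r → ℤˣ) → ℝ} (hf : ∀ x, f x = 0 ∨ f x = 1)
    (S : Finset (Fin r)) : |fourierCoeff f S| ≤ 1 := by
  rw [fourierCoeff, abs_div, abs_of_pos (by positivity : (0 : ℝ) < 2 ^ r), div_le_one (by positivity)]
  refine (Finset.abs_sum_le_sum_abs _ _).trans ?_
  have h1 : ∀ x : Fin r → ℤˣ, |f x * ∏ κ ∈ S, ((x κ : ℤ) : ℝ)| ≤ 1 := by
    intro x
    have : |∏ κ ∈ S, ((x κ : ℤ) : ℝ)| = 1 := by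
      rw [Finset.abs_prod]
      refine Finset.prod_eq_one fun κ _ => ?_
      rcases Int.units_eq_one_or (x κ) with h | h <;> simp [h]
    rw [abs_mul, this, mul_one]
    rcases hf x with h | h <;> simp [h]
  refine (Finset.sum_le_sum fun x _ => h1 x).trans ?_
  simp [Fintype.card_units_int]

namespace Instance

variable {r : ℕ} {V E : Type*} (I : Instance r V E)

lemma fourierCoeff_clauseFun (f : (Fin r → ℤˣ) → ℝ) (e : E) (S : Finset (Fin r)) :
    fourierCoeff (I.clauseFun f e) S =
      (∏ κ ∈ S, ((I.sign e κ : ℤ) : ℝ)) * fourierCoeff f S := by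
  rw [fourierCoeff, fourierCoeff, ← mul_div_assoc]
  congr 1
  rw [Finset.mul_sum]
  refine Fintype.sum_equiv (Equiv.mulLeft (I.sign e)) _ _ fun x => ?_
  have h2 : (∏ κ ∈ S, ((I.sign e κ : ℤ) : ℝ)) * (∏ κ ∈ S, ((I.sign e κ : ℤ) : ℝ)) = 1 := by
    rw [← Finset.prod_mul_distrib]
    refine Finset.prod_eq_one fun κ _ => ?_
    rcases Int.units_eq_one_or (I.sign e κ) with h | h <;> simp [h]
  have h3 : (∏ κ ∈ S, (((Equiv.mulLeft (I.sign e) x) κ : ℤ) : ℝ)) =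
      (∏ κ ∈ S, ((I.sign e κ : ℤ) : ℝ)) * ∏ κ ∈ S, ((x κ : ℤ) : ℝ) := by
    rw [← Finset.prod_mul_distrib]
    exact Finset.prod_congr rfl fun κ _ => by simp
  have h4 : I.clauseFun f e x = f (Equiv.mulLeft (I.sign e) x) := rfl
  rw [h3, h4]
  linear_combination (-f (Equiv.mulLeft (I.sign e) x) * ∏ κ ∈ S, ((x κ : ℤ) : ℝ)) * h2

lemma fourierCoeff_clauseFun_sq (f : (Fin r → ℤˣ) → ℝ) (e : E) (S : Finset (Fin r)) :
    fourierCoeff (I.clauseFun f e) S ^ 2 = fourierCoeff f S ^ 2 := by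
  have : (∏ κ ∈ S, ((I.sign e κ : ℤ) : ℝ)) ^ 2 = 1 := by
    rw [← Finset.prod_pow]
    refine Finset.prod_eq_one fun κ _ => ?_
    rcases Int.units_eq_one_or (I.sign e κ) with h | h <;> simp [h]
  rw [fourierCoeff_clauseFun, mul_pow, this, one_mul]

variable {I}

/-- Since a clause does not repeat variables, `D_{i;b} f_b` is a multilinear polynomial in the
entries of `b` other than `i`. -/
lemma partialD_eq (f : (Fin r → ℤˣ) → ℝ) {b : E} (hb : Function.Injective (I.bdry b)) (κ : Fin r)
    (x : Fin r → ℝ) : I.partialD f (I.bdry b κ) b x =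
      ∑ S : Finset (Fin r) with κ ∈ S,
        fourierCoeff (I.clauseFun f b) S * ∏ j ∈ S.erase κ, x j := by
  rw [partialD, ← eval_pderiv_multilinearPoly (I.clauseFun f b) κ x]
  convert Finset.sum_singleton _ _
  ext κ'
  simp [hb.eq_iff]

lemma partialD_congr {f : (Fin r → ℤˣ) → ℝ} {b : E} (hb : Function.Injective (I.bdry b)) {i : V}
    (hi : I.Inc i b) {x y : Fin r → ℝ} (h : ∀ κ, I.bdry b κ ≠ i → x κ = y κ) :
    I.partialD f i b x = I.partialD f i b y := by
  obtain ⟨κ, rfl⟩ := hi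
  rw [partialD_eq f hb, partialD_eq f hb]
  refine Finset.sum_congr rfl fun S _ => ?_
  congr 1
  refine Finset.prod_congr rfl fun j hj => h j ?_
  exact fun hjκ => (Finset.mem_erase.1 hj).1 (hb hjκ)

lemma measurable_partialD (f : (Fin r → ℤˣ) → ℝ) (i : V) (b : E) : Measurable (I.partialD f i b) := by
  unfold partialD
  exact Finset.measurable_sum _ fun κ _ => (MvPolynomial.continuous_eval _).measurable

lemma partialD_zero {f : (Fin r → ℤˣ) → ℝ} (hlin : fourierWeight f 1 = 0) {b : E}
    (hb : Function.Injective (I.bdry b)) {i : V} (hi : I.Inc i b) :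
    I.partialD f i b (fun _ => 0) = 0 := by
  obtain ⟨κ, rfl⟩ := hi
  rw [partialD_eq f hb]
  refine Finset.sum_eq_zero fun S hS => ?_
  rcases (S.erase κ).eq_empty_or_nonempty with h | ⟨j, hj⟩
  · have : S = {κ} := by
      rw [Finset.erase_eq_empty_iff] at h
      rcases h with h | h
      · simp [h] at hS
      · exact h
    rw [fourierCoeff_clauseFun, this, fourierCoeff_singleton_eq_zero hlin]
    simp
  · rw [Finset.prod_eq_zero hj rfl, mul_zero]

lemma mem_star [Fintype E] {i : V} {b : E} : b ∈ I.star i ↔ I.Inc i b := by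
  simp [star]

lemma mem_starErase [Fintype E] {i : V} {a b : E} :
    b ∈ I.starErase i a ↔ b ≠ a ∧ I.Inc i b := by
  simp [starErase, mem_star]

section Algorithm

variable (I) [Fintype E] (f : (Fin r → ℤˣ) → ℝ) (d : ℕ)
  (F : V → E → (ℓ : ℕ) → (Fin ℓ → ℝ) → ℝ) (z₀ : V → ℝ)

/-- The messages `z_{i→a}^{m-1}`, shifted by one and started from `0`. Because `f` has no linear
terms this start is consistent with `w^0 = 0`, and all iterations obey the same recursion. -/
def zPrev : ℕ → V → E → ℝ
  | 0, _, _ => 0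
  | m + 1, i, a => I.zMsg f d F z₀ m i a

/-- The increments of `zPrev`: the initial value, and then `A_{i→a}^m u_{i→a}^{m+1}`. -/
def zStep : ℕ → V → E → ℝ
  | 0, i, _ => z₀ i
  | m + 1, i, a => I.AMsg f d F z₀ m i a * I.uMsg f d F z₀ (m + 1) i a

/-- The contribution of the clause `b` to the increment `u^{m+1}` at its variable `i`. -/
def clauseStep (m : ℕ) (i : V) (b : E) : ℝ :=
  I.partialD f i b (fun κ => I.zPrev f d F z₀ (m + 1) (I.bdry b κ) b) -
    I.partialD f i b (fun κ => I.zPrev f d F z₀ m (I.bdry b κ) b)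

lemma zMsg_eq (m : ℕ) (i : V) (a : E) : I.zMsg f d F z₀ m i a =
    z₀ i + ∑ s : Fin m, I.AMsg f d F z₀ s i a * I.uMsg f d F z₀ (s + 1) i a := by
  rw [zMsg]
  rfl

lemma zPrev_succ (m : ℕ) (i : V) (a : E) :
    I.zPrev f d F z₀ (m + 1) i a = I.zPrev f d F z₀ m i a + I.zStep f d F z₀ m i a := by
  cases m with
  | zero => simp [zPrev, zStep, zMsg_eq]
  | succ m =>
    simp only [zPrev, zStep]
    rw [zMsg_eq, zMsg_eq, Fin.sum_univ_castSucc]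
    simp [add_assoc]

lemma wMsg_zero (i : V) (a : E) : I.wMsg f d F z₀ 0 i a = 0 := by
  rw [wMsg]

lemma wMsg_succ (m : ℕ) (i : V) (a : E) : I.wMsg f d F z₀ (m + 1) i a = (1 / √((d : ℝ) - 1)) *
    ∑ b ∈ I.starErase i a, I.partialD f i b (fun κ => I.zPrev f d F z₀ (m + 1) (I.bdry b κ) b) := by
  rw [wMsg]
  rfl

variable {I f d F}

lemma wMsg_eq (hlin : fourierWeight f 1 = 0) (hI : ∀ b, Function.Injective (I.bdry b)) (m : ℕ)
    (i : V) (a : E) : I.wMsg f d F z₀ m i a = (1 / √((d : ℝ) - 1)) *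
    ∑ b ∈ I.starErase i a, I.partialD f i b (fun κ => I.zPrev f d F z₀ m (I.bdry b κ) b) := by
  cases m with
  | zero =>
    rw [wMsg_zero, Finset.sum_eq_zero, mul_zero]
    intro b hb
    exact partialD_zero hlin (hI b) (mem_starErase.1 hb).2
  | succ m => exact wMsg_succ I f d F z₀ m i a

lemma uMsg_succ (hlin : fourierWeight f 1 = 0) (hI : ∀ b, Function.Injective (I.bdry b)) (m : ℕ)
    (i : V) (a : E) : I.uMsg f d F z₀ (m + 1) i a = (1 / √((d : ℝ) - 1)) *
    ∑ b ∈ I.starErase i a, I.clauseStep f d F z₀ m i b := by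
  rw [uMsg, Nat.add_sub_cancel, wMsg_eq z₀ hlin hI, wMsg_eq z₀ hlin hI, ← mul_sub,
    ← Finset.sum_sub_distrib]
  rfl

/-! ### Locality of the messages -/

lemma wMsg_congr_of_zPrev (hI : ∀ b, Function.Injective (I.bdry b)) {m : ℕ} {z z' : V → ℝ}
    (ih : ∀ i a, (∀ v ∈ I.msgBranch m i a, z v = z' v) →
      I.zPrev f d F z m i a = I.zPrev f d F z' m i a) {i : V} {a : E}
    (h : ∀ v ∈ I.msgBranch (m + 1) i a, z v = z' v) :
    I.wMsg f d F z m i a = I.wMsg f d F z' m i a := by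
  cases m with
  | zero => rw [wMsg_zero, wMsg_zero]
  | succ m =>
    rw [wMsg_succ, wMsg_succ]
    congr 1
    refine Finset.sum_congr rfl fun b hb => ?_
    obtain ⟨hba, hib⟩ := mem_starErase.1 hb
    refine partialD_congr (hI b) hib fun κ hκ => ih _ _ fun v hv => h v ?_
    exact msgBranch_subset_msgBranch_succ hib hba ⟨κ, rfl⟩ hκ hv

lemma zPrev_congr (hI : ∀ b, Function.Injective (I.bdry b)) (m : ℕ) {z z' : V → ℝ} {i : V} {a : E}
    (h : ∀ v ∈ I.msgBranch m i a, z v = z' v) :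
    I.zPrev f d F z m i a = I.zPrev f d F z' m i a := by
  induction m using Nat.strong_induction_on generalizing i a with
  | _ m ih =>
    cases m with
    | zero => rfl
    | succ m =>
      have hw : ∀ t ≤ m, I.wMsg f d F z t i a = I.wMsg f d F z' t i a := fun t ht =>
        wMsg_congr_of_zPrev hI (fun i a h => ih t (by omega) h)
          fun v hv => h v (msgBranch_mono (by omega) hv)
      have hu : ∀ t ≤ m, I.uMsg f d F z t i a = I.uMsg f d F z' t i a := fun t ht => by
        rw [uMsg, uMsg, hw t ht, hw (t - 1) (by omega)]
      simp only [zPrev]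
      rw [zMsg_eq, zMsg_eq, h i (msgSphere_subset_msgBranch (m := 0) (by omega) rfl)]
      congr 1
      refine Finset.sum_congr rfl fun s _ => ?_
      rw [hu _ (by omega), AMsg, AMsg]
      congr 2
      ext t
      exact hu _ (by omega)

lemma uMsg_congr (hI : ∀ b, Function.Injective (I.bdry b)) (m : ℕ) {z z' : V → ℝ} {i : V} {a : E}
    (h : ∀ v ∈ I.msgBranch (m + 1) i a, z v = z' v) :
    I.uMsg f d F z m i a = I.uMsg f d F z' m i a := by
  rw [uMsg, uMsg, wMsg_congr_of_zPrev hI (fun _ _ h => zPrev_congr hI m h) h,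
    wMsg_congr_of_zPrev hI (fun _ _ h => zPrev_congr hI (m - 1) h)
      fun v hv => h v (msgBranch_mono (by omega) hv)]

lemma AMsg_congr (hI : ∀ b, Function.Injective (I.bdry b)) (m : ℕ) {z z' : V → ℝ} {i : V} {a : E}
    (h : ∀ v ∈ I.msgBranch (m + 1) i a, z v = z' v) :
    I.AMsg f d F z m i a = I.AMsg f d F z' m i a := by
  rw [AMsg, AMsg]
  congr 1
  ext t
  exact uMsg_congr hI _ fun v hv => h v (msgBranch_mono (by omega) hv)

lemma zStep_congr (hI : ∀ b, Function.Injective (I.bdry b)) (m : ℕ) {z z' : V → ℝ} {i : V} {a : E}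
    (h : ∀ v ∈ I.msgBranch (m + 1) i a, z v = z' v) :
    I.zStep f d F z m i a = I.zStep f d F z' m i a := by
  have h1 := zPrev_succ I f d F z m i a
  have h2 := zPrev_succ I f d F z' m i a
  rw [zPrev_congr hI (m + 1) h, zPrev_congr hI m fun v hv => h v (msgBranch_mono (by omega) hv)] at h1
  linarith

/-- The initial values that determine the contribution of the clause `b` to `u^{m+1}` at `i`. -/
def clauseBranch (I : Instance r V E) (m : ℕ) (i : V) (b : E) : Set V :=
  {v | ∃ j, I.Inc j b ∧ j ≠ i ∧ v ∈ I.msgBranch (m + 1) j b}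

lemma clauseStep_congr (hI : ∀ b, Function.Injective (I.bdry b)) (m : ℕ) {z z' : V → ℝ} {i : V}
    {b : E} (hi : I.Inc i b) (h : ∀ v ∈ I.clauseBranch m i b, z v = z' v) :
    I.clauseStep f d F z m i b = I.clauseStep f d F z' m i b := by
  rw [clauseStep, clauseStep]
  congr 1 <;> refine partialD_congr (hI b) hi fun κ hκ => zPrev_congr hI _ fun v hv =>
    h v ⟨_, ⟨κ, rfl⟩, hκ, ?_⟩
  · exact hv
  · exact msgBranch_mono (by omega) hv

/-! ### Measurability of the messages -/

variable {L : ℕ}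

lemma measurable_wMsg_of_zPrev {m : ℕ}
    (ih : ∀ i a, Measurable fun z : V → ℝ => I.zPrev f d F z m i a) (i : V) (a : E) :
    Measurable fun z : V → ℝ => I.wMsg f d F z m i a := by
  cases m with
  | zero => simp only [wMsg_zero]; exact measurable_const
  | succ m =>
    simp only [wMsg_succ]
    refine Measurable.const_mul (Finset.measurable_fun_sum _ fun b _ => ?_) _
    exact (measurable_partialD f i b).comp (measurable_pi_lambda _ fun κ => ih _ _)

lemma measurable_zPrev (hF : ∀ s < L, ∀ i a, Measurable (F i a s)) {m : ℕ} (hm : m ≤ L + 1)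
    (i : V) (a : E) : Measurable fun z : V → ℝ => I.zPrev f d F z m i a := by
  induction m using Nat.strong_induction_on generalizing i a with
  | _ m ih =>
    cases m with
    | zero => exact measurable_const
    | succ m =>
      have hw : ∀ t ≤ m, Measurable fun z : V → ℝ => I.wMsg f d F z t i a := fun t ht =>
        measurable_wMsg_of_zPrev (fun i a => ih t (by omega) (by omega) i a) i a
      have hu : ∀ t ≤ m, Measurable fun z : V → ℝ => I.uMsg f d F z t i a := fun t ht => by
        unfold uMsg
        exact (hw t ht).sub (hw (t - 1) (by omega))
      simp only [zPrev, zMsg_eq]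
      refine (measurable_pi_apply i).add (Finset.measurable_fun_sum _ fun s _ => ?_)
      refine Measurable.mul ?_ (hu _ (by omega))
      unfold AMsg
      exact (hF s (by omega) i a).comp (measurable_pi_lambda _ fun t => hu _ (by omega))

lemma measurable_uMsg (hF : ∀ s < L, ∀ i a, Measurable (F i a s)) {m : ℕ} (hm : m ≤ L + 1)
    (i : V) (a : E) : Measurable fun z : V → ℝ => I.uMsg f d F z m i a := by
  unfold uMsg
  exact (measurable_wMsg_of_zPrev (fun i a => measurable_zPrev hF hm i a) i a).sub
    (measurable_wMsg_of_zPrev (fun i a => measurable_zPrev hF (by omega) i a) i a)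

lemma measurable_AMsg (hF : ∀ s < L, ∀ i a, Measurable (F i a s)) {m : ℕ} (hm : m < L)
    (i : V) (a : E) : Measurable fun z : V → ℝ => I.AMsg f d F z m i a := by
  unfold AMsg
  exact (hF m hm i a).comp (measurable_pi_lambda _ fun t => measurable_uMsg hF (by omega) i a)

end Algorithm

end Instance

end MsgCSP

namespace MsgCSP

/-! ### Random variables with controlled moments -/

section Moments

variable {Ω : Type*} [MeasurableSpace Ω] {μ : Measure Ω} [IsProbabilityMeasure μ]

/-- `X` is measurable, and its absolute moment of order `p` is finite and at most `C p`, for every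
natural number `p`. -/
structure HasMoments (μ : Measure Ω) (X : Ω → ℝ) (C : ℕ → ℝ) : Prop where
  meas : Measurable X
  int : ∀ p : ℕ, Integrable (fun ω => |X ω| ^ p) μ
  bound : ∀ p : ℕ, ∫ ω, |X ω| ^ p ∂μ ≤ C p

namespace HasMoments

variable {X Y : Ω → ℝ} {C D : ℕ → ℝ}

lemma mono (hX : HasMoments μ X C) (h : ∀ p, C p ≤ D p) : HasMoments μ X D :=
  ⟨hX.meas, hX.int, fun p => (hX.bound p).trans (h p)⟩

lemma of_abs_pow_le {Z : ℕ → Ω → ℝ} (hX : Measurable X) (hZ : ∀ p, Integrable (Z p) μ)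
    (h : ∀ p ω, |X ω| ^ p ≤ Z p ω) (hD : ∀ p, ∫ ω, Z p ω ∂μ ≤ D p) : HasMoments μ X D := by
  have hi : ∀ p : ℕ, Integrable (fun ω => |X ω| ^ p) μ := fun p =>
    (hZ p).mono' ((hX.abs.pow_const p).aestronglyMeasurable)
      (ae_of_all _ fun ω => by rw [Real.norm_of_nonneg (by positivity)]; exact h p ω)
  exact ⟨hX, hi, fun p => (integral_mono (hi p) (hZ p) (h p)).trans (hD p)⟩

lemma of_abs_le (hY : HasMoments μ Y C) (hX : Measurable X) (h : ∀ ω, |X ω| ≤ |Y ω|) :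
    HasMoments μ X C :=
  of_abs_pow_le hX hY.int (fun p ω => pow_le_pow_left₀ (abs_nonneg _) (h ω) p) hY.bound

protected lemma abs (hX : HasMoments μ X C) : HasMoments μ (fun ω => |X ω|) C :=
  hX.of_abs_le hX.meas.abs fun _ => (abs_abs _).le

lemma integrable (hX : HasMoments μ X C) : Integrable X μ :=
  (hX.int 1).mono' hX.meas.aestronglyMeasurable (ae_of_all _ fun ω => by simp)

lemma integrable_pow (hX : HasMoments μ X C) (p : ℕ) : Integrable (fun ω => X ω ^ p) μ :=
  (hX.int p).mono' (hX.meas.pow_const p).aestronglyMeasurable (ae_of_all _ fun ω => by simp)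

lemma nonneg (hX : HasMoments μ X C) (p : ℕ) : 0 ≤ C p :=
  (integral_nonneg fun ω => by positivity).trans (hX.bound p)

lemma const (c : ℝ) : HasMoments μ (fun _ => c) (fun p => |c| ^ p) :=
  ⟨measurable_const, fun _ => integrable_const _, fun p => by simp⟩

/-- A bound for the moments of a sum. -/
def addBound (C D : ℕ → ℝ) (p : ℕ) : ℝ := 2 ^ p * (C p + D p)

/-- A bound for the moments of a product. -/
def mulBound (C D : ℕ → ℝ) (p : ℕ) : ℝ := C (2 * p) + D (2 * p)

lemma abs_add_pow_le (x y : ℝ) (p : ℕ) : |x + y| ^ p ≤ 2 ^ p * (|x| ^ p + |y| ^ p) := by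
  have h1 : |x + y| ≤ 2 * max |x| |y| := by
    refine (abs_add_le x y).trans ?_
    linarith [le_max_left |x| |y|, le_max_right |x| |y|]
  refine (pow_le_pow_left₀ (abs_nonneg _) h1 p).trans ?_
  rw [mul_pow]
  refine mul_le_mul_of_nonneg_left ?_ (by positivity)
  rcases max_choice |x| |y| with h | h <;> rw [h]
  · linarith [pow_nonneg (abs_nonneg y) p]
  · linarith [pow_nonneg (abs_nonneg x) p]

lemma add (hX : HasMoments μ X C) (hY : HasMoments μ Y D) :
    HasMoments μ (fun ω => X ω + Y ω) (addBound C D) := by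
  refine of_abs_pow_le (hX.meas.add hY.meas)
    (fun p => ((hX.int p).add (hY.int p)).const_mul (2 ^ p))
    (fun p ω => abs_add_pow_le _ _ p) fun p => ?_
  simp only [Pi.add_apply]
  rw [integral_const_mul, integral_add (hX.int p) (hY.int p)]
  exact mul_le_mul_of_nonneg_left (add_le_add (hX.bound p) (hY.bound p)) (by positivity)

lemma neg (hX : HasMoments μ X C) : HasMoments μ (fun ω => -X ω) C :=
  hX.of_abs_le hX.meas.neg fun ω => by simp

lemma sub (hX : HasMoments μ X C) (hY : HasMoments μ Y D) :
    HasMoments μ (fun ω => X ω - Y ω) (addBound C D) := by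
  simpa only [sub_eq_add_neg] using hX.add hY.neg

lemma mul (hX : HasMoments μ X C) (hY : HasMoments μ Y D) :
    HasMoments μ (fun ω => X ω * Y ω) (mulBound C D) := by
  refine of_abs_pow_le (hX.meas.mul hY.meas)
    (fun p => (hX.int (2 * p)).add (hY.int (2 * p))) (fun p ω => ?_) fun p => ?_
  · simp only [Pi.add_apply]
    rw [abs_mul, mul_pow, pow_mul', pow_mul']
    nlinarith [sq_nonneg (|X ω| ^ p - |Y ω| ^ p), sq_nonneg (|X ω| ^ p), sq_nonneg (|Y ω| ^ p)]
  · simp only [Pi.add_apply]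
    rw [integral_add (hX.int _) (hY.int _)]
    exact add_le_add (hX.bound _) (hY.bound _)

lemma const_mul (c : ℝ) (hX : HasMoments μ X C) :
    HasMoments μ (fun ω => c * X ω) (fun p => |c| ^ p * C p) := by
  refine of_abs_pow_le (hX.meas.const_mul c) (fun p => (hX.int p).const_mul (|c| ^ p))
    (fun p _ => by rw [abs_mul, mul_pow]) fun p => ?_
  rw [integral_const_mul]
  exact mul_le_mul_of_nonneg_left (hX.bound p) (by positivity)

lemma integrable_mul (hX : HasMoments μ X C) (hY : HasMoments μ Y D) :
    Integrable (fun ω => X ω * Y ω) μ := (hX.mul hY).integrable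

lemma exists_finset_sum {ι : Type*} (s : Finset ι) {X : ι → Ω → ℝ}
    (h : ∀ b ∈ s, ∃ C, HasMoments μ (X b) C) : ∃ C, HasMoments μ (fun ω => ∑ b ∈ s, X b ω) C := by
  classical
  induction s using Finset.induction_on with
  | empty => exact ⟨_, by simpa using const (μ := μ) 0⟩
  | insert a s ha ih =>
    obtain ⟨C, hC⟩ := h a (by simp)
    obtain ⟨D, hD⟩ := ih fun b hb => h b (by simp [hb])
    refine ⟨addBound C D, ?_⟩
    simp only [Finset.sum_insert ha]
    exact hC.add hD

lemma exists_finset_prod {ι : Type*} (s : Finset ι) {X : ι → Ω → ℝ}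
    (h : ∀ b ∈ s, ∃ C, HasMoments μ (X b) C) : ∃ C, HasMoments μ (fun ω => ∏ b ∈ s, X b ω) C := by
  classical
  induction s using Finset.induction_on with
  | empty => exact ⟨_, by simpa using const (μ := μ) 1⟩
  | insert a s ha ih =>
    obtain ⟨C, hC⟩ := h a (by simp)
    obtain ⟨D, hD⟩ := ih fun b hb => h b (by simp [hb])
    refine ⟨mulBound C D, ?_⟩
    simp only [Finset.prod_insert ha]
    exact hC.mul hD

/-- A bound for the moments of a product of `n` factors. -/
def prodBound (C : ℕ → ℝ) : ℕ → ℕ → ℝ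
  | 0 => fun _ => 1
  | n + 1 => mulBound C (prodBound C n)

lemma finset_prod {ι : Type*} (s : Finset ι) {X : ι → Ω → ℝ}
    (h : ∀ b ∈ s, HasMoments μ (X b) C) :
    HasMoments μ (fun ω => ∏ b ∈ s, X b ω) (prodBound C s.card) := by
  classical
  induction s using Finset.induction_on with
  | empty => simpa [prodBound] using const (μ := μ) 1
  | insert a s ha ih =>
    simp only [Finset.prod_insert ha, Finset.card_insert_of_notMem ha]
    exact (h a (by simp)).mul (ih fun b hb => h b (by simp [hb]))

lemma comp {Ω' : Type*} [MeasurableSpace Ω'] {μ' : Measure Ω'} {g : Ω' → Ω}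
    (hg : MeasurePreserving g μ' μ) (hX : HasMoments μ X C) :
    HasMoments μ' (fun ω => X (g ω)) C :=
  ⟨hX.meas.comp hg.measurable, fun p => (hg.integrable_comp_of_integrable (hX.int p)),
    fun p => by
      have h1 := integral_map (μ := μ') hg.measurable.aemeasurable (f := fun ω => |X ω| ^ p)
        (by rw [hg.map_eq]; exact (hX.int p).aestronglyMeasurable)
      rw [hg.map_eq] at h1
      rw [← h1]
      exact hX.bound p⟩

/-- The moments of a sum of independent centred variables grow like those of a Gaussian. -/
lemma exists_integral_sum_pow_le (k : ℕ) (C : ℕ → ℝ) : ∃ D : ℝ, 0 ≤ D ∧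
    ∀ {Ω : Type*} [MeasurableSpace Ω] {μ : Measure Ω} [IsProbabilityMeasure μ] {ι : Type*}
      (X : ι → Ω → ℝ), iIndepFun X μ → (∀ b, HasMoments μ (X b) C) →
      (∀ b, ∫ ω, X b ω ∂μ = 0) → ∀ s : Finset ι,
      ∫ ω, (∑ b ∈ s, X b ω) ^ (2 * k) ∂μ ≤ D * (s.card : ℝ) ^ k := by
  classical
  induction k with
  | zero =>
    refine ⟨1, zero_le_one, fun X _ _ _ s => by simp⟩
  | succ k ih =>
    obtain ⟨D, hD0, hD⟩ := ih
    -- Adding a summand `X a` to the sum `S` changes the moment of order `2k + 2` by `O(|s| ^ k)`: the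
    -- term linear in `X a` vanishes, and the others contain at most `2k` factors `S`.
    set M : ℝ := ∑ j ∈ Finset.range (2 * k + 3), |C j| with hM
    have hM0 : 0 ≤ M := Finset.sum_nonneg fun _ _ => abs_nonneg _
    refine ⟨2 ^ (2 * k + 2) * M * (1 + D), by positivity, ?_⟩
    intro Ω _ μ _ ι X hind hX h0 s
    induction s using Finset.induction_on with
    | empty => simp
    | insert a s ha ihs =>
      obtain ⟨B, hS⟩ := exists_finset_sum s fun b _ => ⟨C, hX b⟩
      set S : Ω → ℝ := fun ω => ∑ b ∈ s, X b ω with hSdef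
      have hindep : IndepFun S (X a) μ := by
        have := hind.indepFun_finsetSum_of_notMem (fun b => (hX b).meas) ha
        convert this using 1
        ext ω; simp [hSdef]
      have hexp : ∀ ω, (∑ b ∈ insert a s, X b ω) ^ (2 * (k + 1)) =
          ∑ m ∈ Finset.range (2 * k + 3),
            ((2 * k + 2).choose m : ℝ) * (X a ω ^ m * S ω ^ (2 * k + 2 - m)) := by
        intro ω
        rw [Finset.sum_insert ha, show 2 * (k + 1) = 2 * k + 2 by ring, add_pow]
        exact Finset.sum_congr rfl fun m _ => by ring
      have hint : ∀ m n : ℕ, Integrable (fun ω => X a ω ^ m * S ω ^ n) μ := by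
        intro m n
        refine IndepFun.integrable_mul (X := fun ω => X a ω ^ m) (Y := fun ω => S ω ^ n) ?_
          ((hX a).integrable_pow m) (hS.integrable_pow n)
        exact hindep.symm.comp (measurable_id.pow_const m) (measurable_id.pow_const n)
      have hsplit : ∀ m n : ℕ, ∫ ω, X a ω ^ m * S ω ^ n ∂μ =
          (∫ ω, X a ω ^ m ∂μ) * ∫ ω, S ω ^ n ∂μ := by
        intro m n
        exact IndepFun.integral_fun_mul_eq_mul_integral
          (hindep.symm.comp (measurable_id.pow_const m) (measurable_id.pow_const n))
          ((hX a).meas.pow_const m).aestronglyMeasurable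
          (hS.meas.pow_const n).aestronglyMeasurable
      have hXa : ∀ m ∈ Finset.range (2 * k + 3), |∫ ω, X a ω ^ m ∂μ| ≤ M := by
        intro m hm
        refine (abs_integral_le_integral_abs).trans ?_
        simp only [abs_pow]
        refine ((hX a).bound m).trans ((le_abs_self _).trans ?_)
        exact Finset.single_le_sum (f := fun j => |C j|) (fun _ _ => abs_nonneg _) hm
      set Q : ℝ := 1 + D * (s.card : ℝ) ^ k with hQ
      have hQ0 : 0 ≤ Q := by positivity
      have hSn : ∀ n ≤ 2 * k, |∫ ω, S ω ^ n ∂μ| ≤ Q := by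
        intro n hn
        refine (abs_integral_le_integral_abs).trans ?_
        have h1 : ∀ ω, |S ω ^ n| ≤ 1 + S ω ^ (2 * k) := by
          intro ω
          rw [abs_pow]
          have h2 : S ω ^ (2 * k) = |S ω| ^ (2 * k) := by rw [pow_mul, pow_mul, sq_abs]
          rw [h2]
          rcases le_total |S ω| 1 with h | h
          · have := pow_le_one₀ (n := n) (abs_nonneg (S ω)) h
            have : 0 ≤ |S ω| ^ (2 * k) := by positivity
            linarith
          · have := pow_le_pow_right₀ h hn
            linarith
        have i1 := hS.integrable_pow (2 * k)
        refine (integral_mono (hS.integrable_pow n).abs ((integrable_const 1).add i1) h1).trans ?_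
        simp only [Pi.add_apply]
        rw [integral_add (integrable_const 1) i1]
        simp only [integral_const, probReal_univ, one_smul]
        linarith [hD X hind hX h0 s]
      have hstep : ∫ ω, (∑ b ∈ insert a s, X b ω) ^ (2 * (k + 1)) ∂μ ≤
          ∫ ω, S ω ^ (2 * (k + 1)) ∂μ + 2 ^ (2 * k + 2) * M * Q := by
        simp_rw [hexp]
        rw [integral_finsetSum _ fun m _ => (hint _ _).const_mul _]
        simp_rw [integral_const_mul, hsplit]
        rw [Finset.sum_range_succ']
        have h1 : ((2 * k + 2).choose 0 : ℝ) * ((∫ ω, X a ω ^ 0 ∂μ) *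
            ∫ ω, S ω ^ (2 * k + 2 - 0) ∂μ) = ∫ ω, S ω ^ (2 * (k + 1)) ∂μ := by
          simp [mul_add]
        rw [h1, add_comm]
        refine add_le_add le_rfl ?_
        have h2 : ∀ m ∈ Finset.range (2 * k + 2), ((2 * k + 2).choose (m + 1) : ℝ) *
            ((∫ ω, X a ω ^ (m + 1) ∂μ) * ∫ ω, S ω ^ (2 * k + 2 - (m + 1)) ∂μ) ≤
            ((2 * k + 2).choose (m + 1) : ℝ) * (M * Q) := by
          intro m hm
          refine mul_le_mul_of_nonneg_left ?_ (by positivity)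
          rcases Nat.eq_zero_or_pos m with rfl | hmpos
          · simp [h0 a]; positivity
          · refine (le_abs_self _).trans ?_
            rw [abs_mul]
            exact mul_le_mul (hXa _ (by simp at hm ⊢; omega)) (hSn _ (by omega))
              (abs_nonneg _) hM0
        refine (Finset.sum_le_sum h2).trans ?_
        rw [← Finset.sum_mul, mul_assoc]
        refine mul_le_mul_of_nonneg_right ?_ (by positivity)
        have h3 := Nat.sum_range_choose (2 * k + 2)
        rw [Finset.sum_range_succ'] at h3
        have h4 : ∑ m ∈ Finset.range (2 * k + 2), (2 * k + 2).choose (m + 1) ≤ 2 ^ (2 * k + 2) := by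
          omega
        exact_mod_cast h4
      refine hstep.trans ((add_le_add ihs le_rfl).trans ?_)
      rw [Finset.card_insert_of_notMem ha]
      push_cast
      have hc : (0 : ℝ) ≤ s.card := by positivity
      have hQ' : Q ≤ (1 + D) * ((s.card : ℝ) + 1) ^ k := by
        have h5 : (s.card : ℝ) ^ k ≤ ((s.card : ℝ) + 1) ^ k :=
          pow_le_pow_left₀ hc (by linarith) k
        have h6 : (1 : ℝ) ≤ ((s.card : ℝ) + 1) ^ k := one_le_pow₀ (by linarith)
        nlinarith
      have h7 : (s.card : ℝ) ^ (k + 1) + ((s.card : ℝ) + 1) ^ k ≤ ((s.card : ℝ) + 1) ^ (k + 1) := by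
        have h5 : (s.card : ℝ) ^ k ≤ ((s.card : ℝ) + 1) ^ k :=
          pow_le_pow_left₀ hc (by linarith) k
        rw [pow_succ, pow_succ]
        nlinarith
      have hA : 0 ≤ (2 : ℝ) ^ (2 * k + 2) * M := by positivity
      calc 2 ^ (2 * k + 2) * M * (1 + D) * (s.card : ℝ) ^ (k + 1) + 2 ^ (2 * k + 2) * M * Q
          ≤ 2 ^ (2 * k + 2) * M * (1 + D) * (s.card : ℝ) ^ (k + 1) +
            2 ^ (2 * k + 2) * M * ((1 + D) * ((s.card : ℝ) + 1) ^ k) := by gcongr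
        _ = 2 ^ (2 * k + 2) * M * (1 + D) * ((s.card : ℝ) ^ (k + 1) + ((s.card : ℝ) + 1) ^ k) := by
            ring
        _ ≤ _ := mul_le_mul_of_nonneg_left h7 (by positivity)

/-- Moment bounds for normalized sums of independent centred variables, uniform in the number of
summands. -/
lemma exists_normalized_sum (C : ℕ → ℝ) : ∃ D : ℕ → ℝ,
    ∀ {Ω : Type*} [MeasurableSpace Ω] {μ : Measure Ω} [IsProbabilityMeasure μ] {ι : Type*}
      (X : ι → Ω → ℝ), iIndepFun X μ → (∀ b, HasMoments μ (X b) C) →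
      (∀ b, ∫ ω, X b ω ∂μ = 0) → ∀ s : Finset ι,
      HasMoments μ (fun ω => (1 / √(s.card : ℝ)) * ∑ b ∈ s, X b ω) D := by
  choose D hD0 hD using fun k => exists_integral_sum_pow_le.{_, _} k C
  refine ⟨fun p => 1 + D p, ?_⟩
  intro Ω _ μ _ ι X hind hX h0 s
  obtain ⟨B, hS⟩ := exists_finset_sum s fun b _ => ⟨C, hX b⟩
  have hS' := hS.const_mul (1 / √(s.card : ℝ))
  refine of_abs_pow_le (Z := fun p ω => 1 + ((1 / √(s.card : ℝ)) * ∑ b ∈ s, X b ω) ^ (2 * p))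
    hS'.meas (fun p => (integrable_const 1).add (hS'.integrable_pow _)) (fun p ω => ?_) fun p => ?_
  · set t := (1 / √(s.card : ℝ)) * ∑ b ∈ s, X b ω
    have h2 : t ^ (2 * p) = (|t| ^ p) ^ 2 := by rw [← pow_mul, mul_comm p 2, pow_mul, pow_mul, sq_abs]
    rw [h2]
    nlinarith [sq_nonneg (|t| ^ p - 1), sq_nonneg (|t| ^ p)]
  · rw [integral_add (integrable_const 1) (hS'.integrable_pow _)]
    simp only [integral_const, probReal_univ, one_smul, mul_pow]
    refine add_le_add le_rfl ?_
    rw [integral_const_mul, pow_mul, div_pow, Real.sq_sqrt (by positivity), one_pow]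
    rcases Nat.eq_zero_or_pos s.card with h | h
    · rcases Nat.eq_zero_or_pos p with rfl | hp
      · simpa using hD 0 X hind hX h0 s
      · rw [h]; simp [hp.ne']; exact hD0 p
    · have hc : (0 : ℝ) < s.card := by exact_mod_cast h
      calc (1 / (s.card : ℝ)) ^ p * ∫ ω, (∑ b ∈ s, X b ω) ^ (2 * p) ∂μ
          ≤ (1 / (s.card : ℝ)) ^ p * (D p * (s.card : ℝ) ^ p) :=
            mul_le_mul_of_nonneg_left (hD p X hind hX h0 s) (by positivity)
        _ = D p := by
            rw [one_div, inv_pow]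
            field_simp

end HasMoments

end Moments

/-! ### Functions of disjoint sets of independent coordinates -/

section Coordinates

variable {W : Type*} [Fintype W] {P : Measure ℝ} [IsProbabilityMeasure P]

/-- Functions of disjoint sets of independent coordinates are independent. -/
lemma indepFun_of_dependsOn {α β : Type*} [MeasurableSpace α] [MeasurableSpace β]
    {X : (W → ℝ) → α} {Y : (W → ℝ) → β} (hX : Measurable X) (hY : Measurable Y) {S T : Set W}
    (hXS : DependsOn X S) (hYT : DependsOn Y T) (hST : Disjoint S T) :
    IndepFun X Y (Measure.pi fun _ : W => P) := by
  classical
  have hind : iIndepFun (fun w (x : W → ℝ) => x w) (Measure.pi fun _ : W => P) :=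
    iIndepFun_pi (X := fun _ x => x) fun _ => aemeasurable_id
  have key := hind.indepFun_finset S.toFinset T.toFinset (by simpa using hST)
    fun w => measurable_pi_apply w
  have hext : ∀ A : Finset W, Measurable
      (fun (y : A → ℝ) (w : W) => if h : w ∈ A then y ⟨w, h⟩ else (0 : ℝ)) := by
    intro A
    refine measurable_pi_lambda _ fun w => ?_
    by_cases h : w ∈ A
    · simp only [h, dif_pos]; exact measurable_pi_apply _
    · simp only [h]; exact measurable_const
  have := key.comp (hX.comp (hext _)) (hY.comp (hext _))
  convert this using 1
  · ext x
    exact hXS fun w hw => by simp [hw]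
  · ext x
    exact hYT fun w hw => by simp [hw]

lemma iIndepFun_of_dependsOn {ι : Type*} {β : ι → Type*} [∀ b, MeasurableSpace (β b)]
    {X : ∀ b : ι, (W → ℝ) → β b} (hX : ∀ b, Measurable (X b)) {S : ι → Set W}
    (hXS : ∀ b, DependsOn (X b) (S b)) (hS : Pairwise fun b b' => Disjoint (S b) (S b')) :
    iIndepFun X (Measure.pi fun _ : W => P) := by
  classical
  rw [iIndepFun_iff_measure_inter_preimage_eq_mul]
  intro s A hA
  induction s using Finset.induction_on with
  | empty => simp
  | insert a s ha ih =>
    rw [Finset.prod_insert ha, ← ih fun b hb => hA b (by simp [hb]), Finset.set_biInter_insert]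
    have h1 : IndepFun (X a) (fun x (b : s) => X b x) (Measure.pi fun _ : W => P) := by
      refine indepFun_of_dependsOn (hX a) (measurable_pi_lambda _ fun b => hX b)
        (T := ⋃ b ∈ s, S b) (hXS a) ?_ ?_
      · intro x y hxy
        ext b
        exact hXS b fun w hw => hxy w (Set.mem_biUnion b.2 hw)
      · rw [Set.disjoint_iUnion₂_right]
        exact fun b hb => hS fun hab => ha (hab ▸ hb)
    have h2 := h1.measure_inter_preimage_eq_mul (A a) (Set.pi Set.univ fun b : s => A b)
      (hA a (by simp)) (MeasurableSet.univ_pi fun b => hA b (by simp))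
    have h3 : (fun x (b : s) => X b x) ⁻¹' (Set.pi Set.univ fun b : s => A b) =
        ⋂ b ∈ s, X b ⁻¹' A b := by
      ext x; simp
    rw [h3] at h2
    exact h2

/-! ### Variables with vanishing conditional expectation -/

/-- `X` has mean zero given the coordinates outside `A`, expressed by orthogonality to the
functions of these coordinates that have all moments. -/
def CondZero (P : Measure ℝ) (X : (W → ℝ) → ℝ) (A : Set W) : Prop :=
  ∀ (Y : (W → ℝ) → ℝ) (C : ℕ → ℝ), HasMoments (Measure.pi fun _ : W => P) Y C →
    DependsOn Y Aᶜ → ∫ x, X x * Y x ∂(Measure.pi fun _ : W => P) = 0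

variable {X Y : (W → ℝ) → ℝ} {A B : Set W} {C D : ℕ → ℝ}

lemma dependsOn_mul {S : Set W} (hX : DependsOn X S) (hY : DependsOn Y S) :
    DependsOn (fun x => X x * Y x) S := fun x y h => by
  show X x * Y x = X y * Y y
  rw [hX h, hY h]

namespace CondZero

lemma mono (h : CondZero P X A) (hAB : A ⊆ B) : CondZero P X B :=
  fun Y C hY hYB => h Y C hY (hYB.mono (Set.compl_subset_compl.2 hAB))

lemma integral_eq_zero (h : CondZero P X A) : ∫ x, X x ∂(Measure.pi fun _ : W => P) = 0 := by
  have := h (fun _ => 1) _ (HasMoments.const 1) ((dependsOn_const 1).mono (Set.empty_subset _))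
  simpa using this

lemma mul (h : CondZero P X A) (hY : HasMoments (Measure.pi fun _ : W => P) Y C)
    (hYA : DependsOn Y Aᶜ) : CondZero P (fun x => Y x * X x) A := by
  intro Z D hZ hZA
  have := h _ _ (hY.mul hZ) (dependsOn_mul hYA hZA)
  rw [← this]
  congr 1
  ext x
  ring

lemma const_mul (c : ℝ) (h : CondZero P X A) : CondZero P (fun x => c * X x) A := by
  intro Z D hZ hZA
  simp only [mul_assoc]
  rw [integral_const_mul, h Z D hZ hZA, mul_zero]

lemma add (h : CondZero P X A) (h' : CondZero P Y A)
    (hX : HasMoments (Measure.pi fun _ : W => P) X C)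
    (hY : HasMoments (Measure.pi fun _ : W => P) Y D) : CondZero P (fun x => X x + Y x) A := by
  intro Z B hZ hZA
  simp only [add_mul]
  rw [integral_add (hX.integrable_mul hZ) (hY.integrable_mul hZ), h Z B hZ hZA, h' Z B hZ hZA,
    add_zero]

lemma finset_sum {ι : Type*} (s : Finset ι) {X : ι → (W → ℝ) → ℝ}
    (h : ∀ b ∈ s, CondZero P (X b) A)
    (hX : ∀ b ∈ s, ∃ C, HasMoments (Measure.pi fun _ : W => P) (X b) C) :
    CondZero P (fun x => ∑ b ∈ s, X b x) A := by
  intro Z B hZ hZA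
  simp only [Finset.sum_mul]
  rw [integral_finsetSum]
  · exact Finset.sum_eq_zero fun b hb => h b hb Z B hZ hZA
  · intro b hb
    obtain ⟨C, hC⟩ := hX b hb
    exact hC.integrable_mul hZ

/-- Telescoping a product: if the increments `Δ k` live on disjoint sets of coordinates, and each
has mean zero given the coordinates outside `A k`, then so has the increment of the product. -/
lemma prod_add_sub_prod {κ : Type*} (s : Finset κ) {a Δ : κ → (W → ℝ) → ℝ} {T A : κ → Set W}
    (hT : Pairwise fun k k' => Disjoint (T k) (T k')) (hAT : ∀ k, A k ⊆ T k)
    (ha : ∀ k, ∃ C, HasMoments (Measure.pi fun _ : W => P) (a k) C)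
    (hΔ : ∀ k, ∃ C, HasMoments (Measure.pi fun _ : W => P) (Δ k) C)
    (haT : ∀ k, DependsOn (a k) (T k \ A k)) (hΔT : ∀ k, DependsOn (Δ k) (T k))
    (hzero : ∀ k, CondZero P (Δ k) (A k)) :
    CondZero P (fun x => ∏ k ∈ s, (a k x + Δ k x) - ∏ k ∈ s, a k x) (⋃ k ∈ s, A k) := by
  classical
  induction s using Finset.induction_on with
  | empty => intro Z B _ _; simp
  | insert k s hk ih =>
    obtain ⟨Ca, hCa⟩ := ha k
    obtain ⟨CΔ, hCΔ⟩ := hΔ k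
    have hadd : ∀ k, ∃ C, HasMoments (Measure.pi fun _ : W => P) (fun x => a k x + Δ k x) C :=
      fun k => by
        obtain ⟨C1, h1⟩ := ha k
        obtain ⟨C2, h2⟩ := hΔ k
        exact ⟨_, h1.add h2⟩
    obtain ⟨C1, h1⟩ := HasMoments.exists_finset_prod s fun k _ => hadd k
    obtain ⟨C2, h2⟩ := HasMoments.exists_finset_prod s fun k _ => ha k
    have hne : ∀ k' ∈ s, k' ≠ k := fun k' hk' h => hk (h ▸ hk')
    have e1 : CondZero P (fun x => a k x * (∏ k ∈ s, (a k x + Δ k x) - ∏ k ∈ s, a k x))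
        (⋃ k ∈ s, A k) := by
      refine ih.mul hCa ((haT k).mono ?_)
      intro w hw
      simp only [Set.mem_compl_iff, Set.mem_iUnion, not_exists]
      exact fun k' hk' hwA =>
        Set.disjoint_left.1 (hT (hne k' hk')) (hAT k' hwA) hw.1
    have e2 : CondZero P (fun x => (∏ k ∈ s, (a k x + Δ k x)) * Δ k x) (A k) := by
      refine (hzero k).mul h1 ?_
      intro x y hxy
      refine Finset.prod_congr rfl fun k' hk' => ?_
      have hsub : T k' ⊆ (A k)ᶜ := fun w hw hwA =>
        Set.disjoint_left.1 (hT (hne k' hk')) hw (hAT k hwA)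
      rw [(haT k').mono (Set.sdiff_subset.trans hsub) hxy, (hΔT k').mono hsub hxy]
    have s1 : ⋃ k ∈ s, A k ⊆ ⋃ k' ∈ insert k s, A k' :=
      Set.iUnion₂_subset fun k' hk' =>
        Set.subset_iUnion₂ (s := fun k' (_ : k' ∈ insert k s) => A k') k'
          (Finset.mem_insert_of_mem hk')
    have s2 : A k ⊆ ⋃ k' ∈ insert k s, A k' :=
      Set.subset_iUnion₂ (s := fun k' (_ : k' ∈ insert k s) => A k') k
        (Finset.mem_insert_self k s)
    convert (e1.mono s1).add (e2.mono s2) (hCa.mul (h1.sub h2)) (h1.mul hCΔ) using 1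
    ext x
    rw [Finset.prod_insert hk, Finset.prod_insert hk]
    ring

end CondZero

/-- The monomials in independent centred variables are orthogonal. -/
lemma integral_prod_mul_prod {Ω κ : Type*} [Fintype κ] [DecidableEq κ] [MeasurableSpace Ω]
    {μ : Measure Ω} [IsProbabilityMeasure μ] {Z : κ → Ω → ℝ} (hind : iIndepFun Z μ)
    (hm : ∀ k, Measurable (Z k)) (h0 : ∀ k, ∫ ω, Z k ω ∂μ = 0) (S T : Finset κ) :
    ∫ ω, (∏ k ∈ S, Z k ω) * ∏ k ∈ T, Z k ω ∂μ =
      if S = T then ∏ k ∈ S, ∫ ω, Z k ω ^ 2 ∂μ else 0 := by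
  set g : κ → ℝ → ℝ := fun k x => (if k ∈ S then x else 1) * (if k ∈ T then x else 1) with hg
  have hgm : ∀ k, Measurable (g k) := fun k => by
    refine Measurable.mul ?_ ?_
    · split_ifs
      · exact measurable_id
      · exact measurable_const
    · split_ifs
      · exact measurable_id
      · exact measurable_const
  have h1 : ∀ ω, (∏ k ∈ S, Z k ω) * ∏ k ∈ T, Z k ω = ∏ k, g k (Z k ω) := by
    intro ω
    simp only [hg]
    rw [Finset.prod_mul_distrib, Finset.prod_ite_mem, Finset.prod_ite_mem, Finset.univ_inter,
      Finset.univ_inter]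
  simp_rw [h1]
  rw [hind.integral_fun_prod_comp (fun k => (hm k).aemeasurable)
    fun k => (hgm k).aestronglyMeasurable]
  split_ifs with hST
  · subst hST
    rw [← Finset.univ_inter S, ← Finset.prod_ite_mem]
    refine Finset.prod_congr rfl fun k _ => ?_
    by_cases hk : k ∈ S
    · simp [hg, hk, sq]
    · simp [hg, hk]
  · obtain ⟨k, hk⟩ : ∃ k, ¬(k ∈ S ↔ k ∈ T) := by
      by_contra! h
      exact hST (Finset.ext h)
    refine Finset.prod_eq_zero (Finset.mem_univ k) ?_
    by_cases hkS : k ∈ S <;> by_cases hkT : k ∈ T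
    · simp [hkS, hkT] at hk
    · simp [hg, hkS, hkT, h0]
    · simp [hg, hkS, hkT, h0]
    · simp [hkS, hkT] at hk

end Coordinates

end MsgCSP

namespace MsgCSP

namespace Instance

variable {r : ℕ} {V E W : Type*} {I : Instance r V E} {f : (Fin r → ℤˣ) → ℝ}

/-! ### Moments of the messages and their martingale property -/

/-- The law of independent `N(0, δ)` coordinates indexed by `W`. -/
abbrev gaussPi (δ : ℝ) (W : Type*) [Fintype W] : Measure (W → ℝ) :=
  Measure.pi fun _ : W => gaussianReal 0 δ.toNNReal

/-- The hypotheses on an instance and its nonlinearities, with the second moment normalization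
expressed on the canonical space of the initialization. -/
structure Admissible [Fintype V] [Fintype E] (I : Instance r V E) (f : (Fin r → ℤˣ) → ℝ) (δ K : ℝ)
    (L d : ℕ) (F : V → E → (ℓ : ℕ) → (Fin ℓ → ℝ) → ℝ) : Prop where
  two_le : 2 ≤ d
  reg : I.IndexRegular d
  girth : I.GirthAtLeast (2 * L + 2)
  meas : ∀ s < L, ∀ i a, Measurable (F i a s)
  bdd : ∀ s < L, ∀ i a x, |F i a s x| ≤ K
  norm : ∀ ℓ < L, ∀ i a, I.Inc i a →
    ∫ z, I.AMsg f d F z ℓ i a ^ 2 ∂(gaussPi δ V) = δ / nu f δ (ℓ + 1)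

lemma abs_partialD_le (hf : ∀ x, f x = 0 ∨ f x = 1) {b : E} (hb : Function.Injective (I.bdry b))
    {i : V} (hi : I.Inc i b) (x : Fin r → ℝ) :
    |I.partialD f i b x| ≤ 2 ^ r * ∏ j : Fin r, (1 + |x j|) := by
  obtain ⟨κ, rfl⟩ := hi
  rw [partialD_eq f hb]
  refine (Finset.abs_sum_le_sum_abs _ _).trans ?_
  have h1 : ∀ S : Finset (Fin r),
      |fourierCoeff (I.clauseFun f b) S * ∏ j ∈ S.erase κ, x j| ≤ ∏ j : Fin r, (1 + |x j|) := by
    intro S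
    have h2 : |fourierCoeff (I.clauseFun f b) S| ≤ 1 := abs_fourierCoeff_le_one (fun x => hf _) S
    have h3 : |∏ j ∈ S.erase κ, x j| ≤ ∏ j : Fin r, (1 + |x j|) := by
      rw [Finset.abs_prod, ← Finset.univ_inter (S.erase κ), ← Finset.prod_ite_mem]
      refine Finset.prod_le_prod (fun j _ => ?_) fun j _ => ?_
      · split_ifs <;> positivity
      · split_ifs
        · linarith [abs_nonneg (x j)]
        · linarith [abs_nonneg (x j)]
    rw [abs_mul]
    calc _ ≤ 1 * |∏ j ∈ S.erase κ, x j| := mul_le_mul_of_nonneg_right h2 (abs_nonneg _)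
      _ ≤ _ := by rw [one_mul]; exact h3
  refine (Finset.sum_le_sum fun S _ => h1 S).trans ?_
  rw [Finset.sum_const, nsmul_eq_mul]
  refine mul_le_mul_of_nonneg_right ?_ (Finset.prod_nonneg fun j _ => by positivity)
  have : (Finset.univ.filter fun S : Finset (Fin r) => κ ∈ S).card ≤ 2 ^ r := by
    refine (Finset.card_filter_le _ _).trans ?_
    simp
  exact_mod_cast this

/-- A bound for the moments of `D_{i;b} f_b` in terms of those of its arguments. -/
def partialBound (r : ℕ) (C : ℕ → ℝ) (p : ℕ) : ℝ :=
  |(2 : ℝ) ^ r| ^ p * HasMoments.prodBound (HasMoments.addBound (fun p => |(1 : ℝ)| ^ p) C) r p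

lemma hasMoments_partialD {Ω : Type*} [MeasurableSpace Ω] {μ : Measure Ω} [IsProbabilityMeasure μ]
    (hf : ∀ x, f x = 0 ∨ f x = 1) {b : E} (hb : Function.Injective (I.bdry b)) {i : V}
    (hi : I.Inc i b) {Z : Fin r → Ω → ℝ} {C : ℕ → ℝ} (hZ : ∀ κ, HasMoments μ (Z κ) C) :
    HasMoments μ (fun ω => I.partialD f i b (fun κ => Z κ ω)) (partialBound r C) := by
  have h1 := (HasMoments.finset_prod (μ := μ) (Finset.univ : Finset (Fin r))
    (fun κ _ => (HasMoments.const 1).add (hZ κ).abs)).const_mul (2 ^ r)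
  rw [Finset.card_univ, Fintype.card_fin] at h1
  refine h1.of_abs_le
    ((measurable_partialD f i b).comp (measurable_pi_lambda _ fun κ => (hZ κ).meas)) fun ω => ?_
  exact (abs_partialD_le hf hb hi _).trans (le_abs_self _)

lemma dependsOn_comp {ι : V → W} {α : Type*} {g : (V → ℝ) → α} {S : Set V}
    (h : ∀ z z' : V → ℝ, (∀ v ∈ S, z v = z' v) → g z = g z') :
    DependsOn (fun x : W → ℝ => g (x ∘ ι)) (ι '' S) :=
  fun _ _ hxy => h _ _ fun v hv => hxy (ι v) ⟨v, hv, rfl⟩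

lemma measurable_comp_right (ι : V → W) : Measurable fun x : W → ℝ => x ∘ ι :=
  measurable_pi_lambda _ fun v => measurable_pi_apply (ι v)

lemma measurePreserving_comp [Fintype V] [Fintype W] {P : Measure ℝ} [IsProbabilityMeasure P]
    {ι : V → W} (hι : Function.Injective ι) :
    MeasurePreserving (fun x : W → ℝ => x ∘ ι) (Measure.pi fun _ : W => P)
      (Measure.pi fun _ : V => P) := by
  refine ⟨measurable_comp_right ι, ?_⟩
  have hind : iIndepFun (fun w (x : W → ℝ) => x w) (Measure.pi fun _ : W => P) :=
    iIndepFun_pi (X := fun _ x => x) fun _ => aemeasurable_id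
  have h1 := (hind.precomp hι)
  rw [iIndepFun_iff_map_fun_eq_pi_map (fun v => (measurable_pi_apply (ι v)).aemeasurable)] at h1
  refine h1.trans ?_
  congr 1
  ext v : 1
  exact (measurePreserving_eval (fun _ : W => P) (ι v)).map_eq

lemma hasMoments_gaussian {δ : ℝ} [Fintype W] (w : W) :
    HasMoments (gaussPi δ W) (fun x => x w)
      (fun p => ∫ t, |t| ^ p ∂(gaussianReal 0 δ.toNNReal)) := by
  have hmp := measurePreserving_eval (fun _ : W => gaussianReal 0 δ.toNNReal) w
  have h0 : HasMoments (gaussianReal 0 δ.toNNReal) (fun t => t)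
      (fun p => ∫ t, |t| ^ p ∂(gaussianReal 0 δ.toNNReal)) := by
    refine ⟨measurable_id, fun p => ?_, fun p => le_rfl⟩
    have := (memLp_id_gaussianReal (μ := 0) (v := δ.toNNReal) p).integrable_norm_pow' (p := p)
    simpa using this
  exact h0.comp hmp

section

variable [Fintype V] [Fintype E] [Fintype W] {δ K : ℝ} {L d : ℕ}
  {F : V → E → (ℓ : ℕ) → (Fin ℓ → ℝ) → ℝ} {ι : V → W} {m : ℕ} {C : ℕ → ℝ}

lemma Admissible.card_star (h : I.Admissible f δ K L d F) (i : V) : (I.star i).card = d :=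
  (h.reg i).1

lemma Admissible.card_starErase (h : I.Admissible f δ K L d F) {i : V} {a : E} (hi : I.Inc i a) :
    (I.starErase i a).card = d - 1 := by
  classical
  rw [starErase, Finset.card_erase_of_mem (mem_star.2 hi), h.card_star]

lemma Admissible.cast_card_starErase (h : I.Admissible f δ K L d F) {i : V} {a : E}
    (hi : I.Inc i a) : ((I.starErase i a).card : ℝ) = (d : ℝ) - 1 := by
  rw [h.card_starErase hi, Nat.cast_sub (by linarith [h.two_le]), Nat.cast_one]

variable (I f δ d F ι) in
/-- At iteration `m`, along every directed edge, the message and its increment have moments bounded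
by `C`, and the increment has mean zero given all initial values outside the sphere of radius `m`.
The initial values are read off the larger family indexed by `W` along `ι`. -/
def MessageBound (m : ℕ) (C : ℕ → ℝ) : Prop :=
  ∀ i a, I.Inc i a →
    HasMoments (gaussPi δ W) (fun x => I.zPrev f d F (x ∘ ι) m i a) C ∧
    HasMoments (gaussPi δ W) (fun x => I.zStep f d F (x ∘ ι) m i a) C ∧
    CondZero (gaussianReal 0 δ.toNNReal) (fun x : W → ℝ => I.zStep f d F (x ∘ ι) m i a)
      (ι '' I.msgSphere m i a)

/-- The initial values that the contribution of the clause `b` to `u^{m+1}` at `i` uses, and its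
contributions to earlier increments do not. -/
def clauseSphere (I : Instance r V E) (m : ℕ) (i : V) (b : E) : Set V :=
  {v | ∃ j, I.Inc j b ∧ j ≠ i ∧ v ∈ I.msgSphere m j b}

lemma clauseSphere_subset_clauseBranch {i : V} {b : E} :
    I.clauseSphere m i b ⊆ I.clauseBranch m i b :=
  fun _ ⟨j, hj, hji, hv⟩ => ⟨j, hj, hji, msgSphere_subset_msgBranch (by omega) hv⟩

lemma clauseSphere_subset_msgSphere {i : V} {a b : E} (hi : I.Inc i b) (hba : b ≠ a) :
    I.clauseSphere m i b ⊆ I.msgSphere (m + 1) i a :=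
  fun _ ⟨j, hj, hji, hv⟩ => ⟨b, hi, hba, j, hj, hji, hv⟩

lemma Admissible.disjoint_clauseBranch (h : I.Admissible f δ K L d F) (hm : m < L) {i : V}
    {b b' : E} (hb : I.Inc i b) (hb' : I.Inc i b') (hne : b ≠ b') :
    Disjoint (I.clauseBranch m i b) (I.clauseBranch m i b') := by
  rw [Set.disjoint_left]
  rintro v ⟨j, hj, hji, k, hk, hv⟩ ⟨j', hj', hji', k', hk', hv'⟩
  exact hne (eq_of_mem_msgSphere_of_root h.girth (by omega) hb hj hji hb' hj' hji' hv hv').2.1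

lemma Admissible.disjoint_msgBranch (h : I.Admissible f δ K L d F) (hm : m ≤ L) {b : E}
    {j j' : V} (hj : I.Inc j b) (hj' : I.Inc j' b) (hne : j ≠ j') :
    Disjoint (I.msgBranch (m + 1) j b) (I.msgBranch (m + 1) j' b) := by
  rw [Set.disjoint_left]
  rintro v ⟨k, hk, hv⟩ ⟨k', hk', hv'⟩
  exact hne (eq_of_mem_msgSphere_of_clause h.girth (by omega) hj hj' hv hv').2

lemma Admissible.disjoint_msgBranch_msgSphere (h : I.Admissible f δ K L d F) (hm : m ≤ L) {b : E}
    {j : V} (hj : I.Inc j b) : Disjoint (I.msgBranch m j b) (I.msgSphere m j b) := by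
  rw [Set.disjoint_left]
  rintro v ⟨k, hk, hv⟩ hv'
  have := (eq_of_mem_msgSphere_of_clause h.girth (by omega) hj hj hv hv').1
  omega

lemma Admissible.disjoint_msgBranch_clauseSphere (h : I.Admissible f δ K L d F) (hm : m ≤ L)
    {i : V} {b : E} {j : V} (hj : I.Inc j b) :
    Disjoint (I.msgBranch m j b) (I.clauseSphere m i b) := by
  rw [Set.disjoint_left]
  rintro v ⟨k, hk, hv⟩ ⟨j', hj', -, hv'⟩
  have := (eq_of_mem_msgSphere_of_clause h.girth (by omega) hj hj' hv hv').1
  omega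

lemma compl_image_of_disjoint (hι : Function.Injective ι) {S T : Set V} (h : Disjoint S T) :
    ι '' S ⊆ (ι '' T)ᶜ :=
  Set.subset_compl_iff_disjoint_right.2 ((Set.disjoint_image_iff hι).2 h)

lemma Admissible.hasMoments_zPrev_succ (hB : I.MessageBound f δ d F ι m C) {i : V} {a : E}
    (hi : I.Inc i a) :
    HasMoments (gaussPi δ W) (fun x => I.zPrev f d F (x ∘ ι) (m + 1) i a)
      (HasMoments.addBound C C) := by
  simp only [zPrev_succ]
  exact (hB i a hi).1.add (hB i a hi).2.1

lemma Admissible.hasMoments_clauseStep (hf : ∀ x, f x = 0 ∨ f x = 1)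
    (h : I.Admissible f δ K L d F) (hB : I.MessageBound f δ d F ι m C) {i : V} {b : E}
    (hi : I.Inc i b) :
    HasMoments (gaussPi δ W) (fun x => I.clauseStep f d F (x ∘ ι) m i b)
      (HasMoments.addBound (partialBound r (HasMoments.addBound C C)) (partialBound r C)) :=
  (hasMoments_partialD hf (h.girth.1 b) hi
      (Z := fun κ (x : W → ℝ) => I.zPrev f d F (x ∘ ι) (m + 1) (I.bdry b κ) b)
      fun κ => Admissible.hasMoments_zPrev_succ hB ⟨κ, rfl⟩).sub
    (hasMoments_partialD hf (h.girth.1 b) hi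
      (Z := fun κ (x : W → ℝ) => I.zPrev f d F (x ∘ ι) m (I.bdry b κ) b)
      fun κ => (hB _ _ ⟨κ, rfl⟩).1)

/-- The martingale property of the contribution of a clause: it has mean zero given all initial
values except those that enter at the last iteration. -/
lemma Admissible.condZero_clauseStep (h : I.Admissible f δ K L d F) (hι : Function.Injective ι)
    (hm : m ≤ L) (hB : I.MessageBound f δ d F ι m C) {i : V} {b : E} (hi : I.Inc i b) :
    CondZero (gaussianReal 0 δ.toNNReal) (fun x : W → ℝ => I.clauseStep f d F (x ∘ ι) m i b)
      (ι '' I.clauseSphere m i b) := by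
  obtain ⟨κ, rfl⟩ := hi
  have hinj := h.girth.1
  have hexp : (fun x : W → ℝ => I.clauseStep f d F (x ∘ ι) m (I.bdry b κ) b) =
      fun x => ∑ S : Finset (Fin r) with κ ∈ S, fourierCoeff (I.clauseFun f b) S *
        (∏ k ∈ S.erase κ, (I.zPrev f d F (x ∘ ι) m (I.bdry b k) b +
          I.zStep f d F (x ∘ ι) m (I.bdry b k) b) -
          ∏ k ∈ S.erase κ, I.zPrev f d F (x ∘ ι) m (I.bdry b k) b) := by
    ext x
    rw [clauseStep, partialD_eq f (hinj b), partialD_eq f (hinj b), ← Finset.sum_sub_distrib]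
    refine Finset.sum_congr rfl fun S _ => ?_
    rw [mul_sub]
    simp only [zPrev_succ]
  have ha : ∀ k : Fin r, ∃ C, HasMoments (gaussPi δ W)
      (fun x => I.zPrev f d F (x ∘ ι) m (I.bdry b k) b) C := fun k => ⟨C, (hB _ _ ⟨k, rfl⟩).1⟩
  have hΔ : ∀ k : Fin r, ∃ C, HasMoments (gaussPi δ W)
      (fun x => I.zStep f d F (x ∘ ι) m (I.bdry b k) b) C := fun k => ⟨C, (hB _ _ ⟨k, rfl⟩).2.1⟩
  rw [hexp]
  refine CondZero.finset_sum _ (fun S hS => ?_) fun S hS => ?_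
  · refine CondZero.const_mul _ ?_
    have := CondZero.prod_add_sub_prod (S.erase κ)
      (a := fun k (x : W → ℝ) => I.zPrev f d F (x ∘ ι) m (I.bdry b k) b)
      (Δ := fun k (x : W → ℝ) => I.zStep f d F (x ∘ ι) m (I.bdry b k) b)
      (T := fun k => ι '' I.msgBranch (m + 1) (I.bdry b k) b)
      (A := fun k => ι '' I.msgSphere m (I.bdry b k) b)
      (P := gaussianReal 0 δ.toNNReal) ?_ ?_ ha hΔ ?_ ?_ ?_
    · refine this.mono (Set.iUnion₂_subset fun k hk => Set.image_mono ?_)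
      exact fun v hv => ⟨_, ⟨k, rfl⟩, fun hkκ => (Finset.mem_erase.1 hk).1 (hinj b hkκ), hv⟩
    · intro k k' hkk'
      exact (Set.disjoint_image_iff hι).2
        (h.disjoint_msgBranch hm ⟨k, rfl⟩ ⟨k', rfl⟩ fun hk => hkk' (hinj b hk))
    · exact fun k => Set.image_mono (msgSphere_subset_msgBranch (by omega))
    · intro k
      refine (dependsOn_comp fun z z' hz => zPrev_congr hinj m hz).mono ?_
      exact Set.subset_sdiff.2 ⟨Set.image_mono (msgBranch_mono (by omega)),
        (Set.disjoint_image_iff hι).2 (h.disjoint_msgBranch_msgSphere hm ⟨k, rfl⟩)⟩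
    · exact fun k => dependsOn_comp fun z z' hz => zStep_congr hinj m hz
    · exact fun k => (hB _ _ ⟨k, rfl⟩).2.2
  · obtain ⟨C1, h1⟩ := HasMoments.exists_finset_prod (S.erase κ) fun k _ => ha k
    obtain ⟨C2, h2⟩ := HasMoments.exists_finset_prod (S.erase κ) fun k _ =>
      show ∃ C, HasMoments (gaussPi δ W) (fun x => I.zPrev f d F (x ∘ ι) m (I.bdry b k) b +
          I.zStep f d F (x ∘ ι) m (I.bdry b k) b) C from
        ⟨_, (hB _ _ ⟨k, rfl⟩).1.add (hB _ _ ⟨k, rfl⟩).2.1⟩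
    exact ⟨_, (h2.sub h1).const_mul _⟩

lemma dependsOn_clauseStep (hI : ∀ b, Function.Injective (I.bdry b)) {i : V} {b : E}
    (hi : I.Inc i b) :
    DependsOn (fun x : W → ℝ => I.clauseStep f d F (x ∘ ι) m i b) (ι '' I.clauseBranch m i b) :=
  dependsOn_comp fun _ _ hz => clauseStep_congr hI m hi hz

variable (I f d F ι) in
open Classical in
/-- The contribution of the clause `b` to `u^{m+1}` at `i`, set to zero if `i ∉ ∂b`, so that it is
an independent family indexed by all clauses. -/
def clauseVar (m : ℕ) (i : V) (b : E) (x : W → ℝ) : ℝ :=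
  if I.Inc i b then I.clauseStep f d F (x ∘ ι) m i b else 0

lemma clauseVar_of_inc {i : V} {b : E} (hi : I.Inc i b) :
    I.clauseVar f d F ι m i b = fun x => I.clauseStep f d F (x ∘ ι) m i b := by
  ext x; simp [clauseVar, hi]

lemma clauseVar_of_not_inc {i : V} {b : E} (hi : ¬ I.Inc i b) :
    I.clauseVar f d F ι m i b = fun _ => 0 := by
  ext x; simp [clauseVar, hi]

/-- A bound for the moments of the contribution of a clause. -/
def clauseBound (r : ℕ) (C : ℕ → ℝ) (p : ℕ) : ℝ :=
  1 + |HasMoments.addBound (partialBound r (HasMoments.addBound C C)) (partialBound r C) p|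

lemma Admissible.hasMoments_clauseVar (hf : ∀ x, f x = 0 ∨ f x = 1)
    (h : I.Admissible f δ K L d F) (hB : I.MessageBound f δ d F ι m C) (i : V) (b : E) :
    HasMoments (gaussPi δ W) (I.clauseVar f d F ι m i b) (clauseBound r C) := by
  by_cases hi : I.Inc i b
  · rw [clauseVar_of_inc hi]
    exact (h.hasMoments_clauseStep hf hB hi).mono fun p => by
      unfold clauseBound
      linarith [le_abs_self
        (HasMoments.addBound (partialBound r (HasMoments.addBound C C)) (partialBound r C) p)]
  · rw [clauseVar_of_not_inc hi]
    refine (HasMoments.const 0).mono fun p => ?_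
    unfold clauseBound
    have : |(0 : ℝ)| ^ p ≤ 1 := pow_le_one₀ (by simp) (by simp)
    linarith [abs_nonneg
        (HasMoments.addBound (partialBound r (HasMoments.addBound C C)) (partialBound r C) p)]

open Classical in
lemma dependsOn_clauseVar (hI : ∀ b, Function.Injective (I.bdry b)) (i : V) (b : E) :
    DependsOn (I.clauseVar f d F ι m i b)
      (if I.Inc i b then ι '' I.clauseBranch m i b else ∅) := by
  by_cases hi : I.Inc i b
  · rw [clauseVar_of_inc hi, if_pos hi]
    exact dependsOn_clauseStep hI hi
  · rw [clauseVar_of_not_inc hi, if_neg hi]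
    exact dependsOn_const 0

open Classical in
lemma Admissible.disjoint_support_clauseVar (h : I.Admissible f δ K L d F)
    (hι : Function.Injective ι) (hm : m < L) (i : V) :
    Pairwise fun b b' => Disjoint (if I.Inc i b then ι '' I.clauseBranch m i b else ∅)
      (if I.Inc i b' then ι '' I.clauseBranch m i b' else ∅) := by
  intro b b' hbb'
  by_cases hb : I.Inc i b
  · by_cases hb' : I.Inc i b'
    · simp only [hb, hb', if_true]
      exact (Set.disjoint_image_iff hι).2 (h.disjoint_clauseBranch hm hb hb' hbb')
    · simp [hb']
  · simp [hb]

lemma Admissible.iIndepFun_clauseVar (hf : ∀ x, f x = 0 ∨ f x = 1)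
    (h : I.Admissible f δ K L d F) (hι : Function.Injective ι) (hm : m < L)
    (hB : I.MessageBound f δ d F ι m C) (i : V) :
    iIndepFun (fun b => I.clauseVar f d F ι m i b) (gaussPi δ W) :=
  iIndepFun_of_dependsOn (fun b => (h.hasMoments_clauseVar hf hB i b).meas)
    (fun b => dependsOn_clauseVar h.girth.1 i b) (h.disjoint_support_clauseVar hι hm i)

lemma Admissible.integral_clauseVar (h : I.Admissible f δ K L d F) (hι : Function.Injective ι)
    (hm : m ≤ L) (hB : I.MessageBound f δ d F ι m C) (i : V) (b : E) :
    ∫ x, I.clauseVar f d F ι m i b x ∂(gaussPi δ W) = 0 := by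
  by_cases hi : I.Inc i b
  · rw [clauseVar_of_inc hi]
    exact (h.condZero_clauseStep hι hm hB hi).integral_eq_zero
  · rw [clauseVar_of_not_inc hi]; simp

lemma Admissible.uMsg_eq (hlin : fourierWeight f 1 = 0) (h : I.Admissible f δ K L d F) {i : V}
    {a : E} (hi : I.Inc i a) (x : W → ℝ) : I.uMsg f d F (x ∘ ι) (m + 1) i a =
      (1 / √((I.starErase i a).card : ℝ)) *
        ∑ b ∈ I.starErase i a, I.clauseVar f d F ι m i b x := by
  rw [uMsg_succ (x ∘ ι) hlin h.girth.1, h.cast_card_starErase hi]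
  congr 1
  refine Finset.sum_congr rfl fun b hb => ?_
  rw [clauseVar_of_inc (mem_starErase.1 hb).2]

lemma Admissible.condZero_uMsg (hf : ∀ x, f x = 0 ∨ f x = 1) (hlin : fourierWeight f 1 = 0)
    (h : I.Admissible f δ K L d F) (hι : Function.Injective ι) (hm : m ≤ L)
    (hB : I.MessageBound f δ d F ι m C) {i : V} {a : E} :
    CondZero (gaussianReal 0 δ.toNNReal) (fun x : W → ℝ => I.uMsg f d F (x ∘ ι) (m + 1) i a)
      (ι '' I.msgSphere (m + 1) i a) := by
  simp only [uMsg_succ _ hlin h.girth.1]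
  refine CondZero.const_mul _ (CondZero.finset_sum _ (fun b hb => ?_) fun b hb => ?_)
  · obtain ⟨hba, hib⟩ := mem_starErase.1 hb
    exact (h.condZero_clauseStep hι hm hB hib).mono
      (Set.image_mono (clauseSphere_subset_msgSphere hib hba))
  · exact ⟨_, h.hasMoments_clauseStep hf hB (mem_starErase.1 hb).2⟩

/-- The bound is `C p` for the moments of `u^{m+1}` whenever `MessageBound` holds at iteration `m`
with the constants `C₀`. -/
lemma exists_uMsg_bound (hf : ∀ x, f x = 0 ∨ f x = 1) (hlin : fourierWeight f 1 = 0)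
    (δ K : ℝ) (C₀ : ℕ → ℝ) : ∃ C : ℕ → ℝ, ∀ {V E W : Type*} [Fintype V] [Fintype E] [Fintype W]
      (I : Instance r V E) (L d m : ℕ) (F : V → E → (ℓ : ℕ) → (Fin ℓ → ℝ) → ℝ) (ι : V → W),
      I.Admissible f δ K L d F → Function.Injective ι → m < L → I.MessageBound f δ d F ι m C₀ →
      ∀ i a, I.Inc i a →
        HasMoments (gaussPi δ W) (fun x => I.uMsg f d F (x ∘ ι) (m + 1) i a) C := by
  obtain ⟨C, hC⟩ := HasMoments.exists_normalized_sum (clauseBound r C₀)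
  refine ⟨C, ?_⟩
  intro V E W _ _ _ I L d m F ι h hι hm hB i a hi
  simp only [h.uMsg_eq hlin hi]
  exact hC _ (h.iIndepFun_clauseVar hf hι hm hB i) (h.hasMoments_clauseVar hf hB i)
    (h.integral_clauseVar hι hm.le hB i) _

/-- Moment bounds that hold for all admissible instances at once. -/
lemma exists_messageBound (hf : ∀ x, f x = 0 ∨ f x = 1) (hlin : fourierWeight f 1 = 0)
    (δ K : ℝ) (m : ℕ) : ∃ C : ℕ → ℝ, ∀ {V E W : Type*} [Fintype V] [Fintype E] [Fintype W]
      (I : Instance r V E) (L d : ℕ) (F : V → E → (ℓ : ℕ) → (Fin ℓ → ℝ) → ℝ) (ι : V → W),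
      I.Admissible f δ K L d F → Function.Injective ι → m ≤ L →
      I.MessageBound f δ d F ι m C := by
  induction m with
  | zero =>
    refine ⟨fun p => 1 + ∫ t, |t| ^ p ∂(gaussianReal 0 δ.toNNReal), ?_⟩
    intro V E W _ _ _ I L d F ι h hι hm i a hi
    refine ⟨?_, ?_, ?_⟩
    · refine (HasMoments.const 0).mono fun p => ?_
      have h1 : |(0 : ℝ)| ^ p ≤ 1 := pow_le_one₀ (by simp) (by simp)
      have h2 : 0 ≤ ∫ t, |t| ^ p ∂(gaussianReal 0 δ.toNNReal) :=
        integral_nonneg fun t => by positivity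
      linarith
    · exact (hasMoments_gaussian (ι i)).mono fun p => by linarith
    · intro Y B hY hYA
      have h1 : IndepFun (fun x : W → ℝ => x (ι i)) Y (gaussPi δ W) := by
        refine indepFun_of_dependsOn (S := {ι i}) (measurable_pi_apply _) hY.meas ?_ hYA ?_
        · exact fun x y hxy => hxy _ rfl
        · rw [Set.disjoint_compl_right_iff_subset]
          rintro _ rfl
          exact ⟨i, rfl, rfl⟩
      have h2 := h1.integral_fun_mul_eq_mul_integral
        (measurable_pi_apply _).aestronglyMeasurable hY.meas.aestronglyMeasurable
      have h3 : ∫ x : W → ℝ, x (ι i) ∂(gaussPi δ W) = 0 := by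
        have h4 := (measurePreserving_eval (fun _ : W => gaussianReal 0 δ.toNNReal) (ι i)).map_eq
        have h5 := integral_map (μ := gaussPi δ W) (φ := Function.eval (ι i))
          (measurable_pi_apply _).aemeasurable (f := fun t : ℝ => t)
          measurable_id.aestronglyMeasurable
        rw [h4, integral_id_gaussianReal] at h5
        exact h5.symm
      show ∫ x, x (ι i) * Y x ∂(gaussPi δ W) = 0
      rw [h2, h3, zero_mul]
  | succ m ih =>
    obtain ⟨C₀, hC₀⟩ := ih
    obtain ⟨C₁, hC₁⟩ := exists_uMsg_bound.{_, _, _} hf hlin δ K C₀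
    set B₁ := HasMoments.addBound C₀ C₀ with hB₁
    set B₂ : ℕ → ℝ := fun p => |K| ^ p * C₁ p with hB₂
    refine ⟨fun p => |B₁ p| + |B₂ p|, ?_⟩
    intro V E W _ _ _ I L d F ι h hι hm i a hi
    have hB := hC₀ I L d F ι h hι (by omega)
    have hu := hC₁ I L d m F ι h hι (by omega) hB i a hi
    have hmA : Measurable fun x : W → ℝ => I.AMsg f d F (x ∘ ι) m i a :=
      (measurable_AMsg h.meas (by omega) i a).comp (measurable_comp_right ι)
    have hAle : ∀ x : W → ℝ, |I.AMsg f d F (x ∘ ι) m i a| ≤ |K| := fun x =>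
      (h.bdd m (by omega) i a _).trans (le_abs_self K)
    refine ⟨?_, ?_, ?_⟩
    · exact (Admissible.hasMoments_zPrev_succ hB hi).mono fun p => by
        linarith [le_abs_self (B₁ p), abs_nonneg (B₂ p)]
    · refine ((hu.const_mul K).mono fun p => ?_).of_abs_le (hmA.mul hu.meas) fun x => ?_
      · linarith [le_abs_self (B₂ p), abs_nonneg (B₁ p)]
      · simp only [zStep]
        rw [abs_mul, abs_mul]
        exact mul_le_mul_of_nonneg_right (hAle x) (abs_nonneg _)
    -- The nonlinearity only uses earlier information, so it preserves the martingale property.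
    · refine (h.condZero_uMsg hf hlin hι (by omega) hB).mul
        ((HasMoments.const K).of_abs_le hmA hAle) ?_
      refine (dependsOn_comp fun z z' hz => AMsg_congr h.girth.1 m hz).mono ?_
      exact compl_image_of_disjoint hι (h.disjoint_msgBranch_msgSphere hm hi)

end

end Instance

end MsgCSP

namespace MsgCSP

/-! ### Second moments of the messages -/

/-- The second moment of `D_κ f` at independent centred arguments with second moments `s`. -/
def gradVar {r : ℕ} (f : (Fin r → ℤˣ) → ℝ) (κ : Fin r) (s : Fin r → ℝ) : ℝ :=
  ∑ S : Finset (Fin r) with κ ∈ S, fourierCoeff f S ^ 2 * ∏ k ∈ S.erase κ, s k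

lemma continuous_gradVar {r : ℕ} (f : (Fin r → ℤˣ) → ℝ) (κ : Fin r) :
    Continuous (gradVar f κ) := by
  unfold gradVar
  fun_prop

/-- Summing over the coordinates counts each Fourier coefficient with multiplicity its degree, which
produces the derivative of the mixture polynomial. -/
lemma sum_gradVar {r : ℕ} (f : (Fin r → ℤˣ) → ℝ) (t : ℝ) :
    ∑ κ, gradVar f κ (fun _ => t) = (xi f).derivative.eval t := by
  have h1 : (xi f).derivative.eval t =
      ∑ j ∈ Finset.Icc 1 r, fourierWeight f j * (j * t ^ (j - 1)) := by
    rw [xi, Polynomial.derivative_sum, Polynomial.eval_finsetSum]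
    refine Finset.sum_congr rfl fun j _ => ?_
    rw [Polynomial.derivative_C_mul_X_pow]
    simp
    ring
  have h2 : ∀ κ, gradVar f κ (fun _ => t) =
      ∑ S : Finset (Fin r), if κ ∈ S then fourierCoeff f S ^ 2 * t ^ (S.card - 1) else 0 := by
    intro κ
    rw [gradVar, Finset.sum_filter]
    refine Finset.sum_congr rfl fun S _ => ?_
    split_ifs with h
    · rw [Finset.prod_const, Finset.card_erase_of_mem h]
    · rfl
  have h3 : ∑ S : Finset (Fin r), (S.card : ℝ) * (fourierCoeff f S ^ 2 * t ^ (S.card - 1)) =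
      ∑ j ∈ Finset.range (r + 1), fourierWeight f j * (j * t ^ (j - 1)) := by
    rw [← Finset.powerset_univ, Finset.sum_powerset]
    rw [Finset.card_univ, Fintype.card_fin]
    refine Finset.sum_congr rfl fun j _ => ?_
    rw [fourierWeight, Finset.sum_mul]
    refine Finset.sum_congr rfl fun S hS => ?_
    rw [(Finset.mem_powersetCard.1 hS).2]
    ring
  simp_rw [h2]
  rw [Finset.sum_comm, h1]
  have h4 : ∀ S : Finset (Fin r),
      ∑ κ, (if κ ∈ S then fourierCoeff f S ^ 2 * t ^ (S.card - 1) else 0) =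
        (S.card : ℝ) * (fourierCoeff f S ^ 2 * t ^ (S.card - 1)) := by
    intro S
    rw [Finset.sum_ite_mem, Finset.univ_inter, Finset.sum_const, nsmul_eq_mul]
  simp_rw [h4]
  rw [h3, Finset.sum_range_succ', Finset.range_eq_Ico, Finset.sum_Ico_add' (c := 1)
    (f := fun j => fourierWeight f j * ((j : ℝ) * t ^ (j - 1)))]
  simp only [CharP.cast_eq_zero, zero_mul, mul_zero, add_zero]
  rfl

/-- The limiting second moment of the contribution of a clause to `u^{m+1}` at its `κ`-th
variable. -/
def stepVar {r : ℕ} (f : (Fin r → ℤˣ) → ℝ) (δ : ℝ) (m : ℕ) (κ : Fin r) : ℝ :=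
  gradVar f κ (fun _ => ((m : ℝ) + 1) * δ) - gradVar f κ (fun _ => (m : ℝ) * δ)

lemma sum_stepVar {r : ℕ} (f : (Fin r → ℤˣ) → ℝ) (δ : ℝ) (m : ℕ) (hr : r ≠ 0) :
    ∑ κ, stepVar f δ m κ = r * nu f δ (m + 1) := by
  have : (r : ℝ) ≠ 0 := by exact_mod_cast hr
  simp only [stepVar, Finset.sum_sub_distrib, sum_gradVar, nu]
  push_cast
  rw [add_sub_cancel_right]
  field_simp

namespace Instance

section

variable {r : ℕ} {V E W : Type*} {I : Instance r V E} {f : (Fin r → ℤˣ) → ℝ}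
  [Fintype V] [Fintype E] [Fintype W] {δ K : ℝ} {L d : ℕ}
  {F : V → E → (ℓ : ℕ) → (Fin ℓ → ℝ) → ℝ} {ι : V → W} {m : ℕ} {C C' : ℕ → ℝ}

lemma Admissible.integral_zPrev (hB : ∀ k < m, ∃ C, I.MessageBound f δ d F ι k C) {i : V} {a : E}
    (hi : I.Inc i a) :
    (∃ C, HasMoments (gaussPi δ W) (fun x => I.zPrev f d F (x ∘ ι) m i a) C) ∧
    ∫ x, I.zPrev f d F (x ∘ ι) m i a ∂(gaussPi δ W) = 0 := by
  induction m with
  | zero => exact ⟨⟨_, HasMoments.const 0⟩, by simp [zPrev]⟩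
  | succ m ih =>
    obtain ⟨-, h0⟩ := ih fun k hk => hB k (by omega)
    obtain ⟨C, hC⟩ := hB m (by omega)
    refine ⟨⟨_, hasMoments_zPrev_succ hC hi⟩, ?_⟩
    simp only [zPrev_succ]
    obtain ⟨h1, h2, h3⟩ := hC i a hi
    rw [integral_add h1.integrable h2.integrable, h0, h3.integral_eq_zero, zero_add]

/-- `E[D_{i;b} f_b(z)²]` in terms of the second moments of the messages `z` into `b`. -/
lemma Admissible.integral_partialD_sq (h : I.Admissible f δ K L d F) (hι : Function.Injective ι)
    (hm : m ≤ L + 1) (hB : ∀ k < m, ∃ C, I.MessageBound f δ d F ι k C) (b : E) (κ : Fin r) :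
    ∫ x, I.partialD f (I.bdry b κ) b (fun k => I.zPrev f d F (x ∘ ι) m (I.bdry b k) b) ^ 2
      ∂(gaussPi δ W) =
    gradVar f κ (fun k => ∫ x, I.zPrev f d F (x ∘ ι) m (I.bdry b k) b ^ 2 ∂(gaussPi δ W)) := by
  have hinj := h.girth.1
  set Z : Fin r → (W → ℝ) → ℝ := fun k x => I.zPrev f d F (x ∘ ι) m (I.bdry b k) b with hZ
  have hZm : ∀ k, ∃ C, HasMoments (gaussPi δ W) (Z k) C := fun k =>
    (integral_zPrev hB ⟨k, rfl⟩).1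
  have hZ0 : ∀ k, ∫ x, Z k x ∂(gaussPi δ W) = 0 := fun k => (integral_zPrev hB ⟨k, rfl⟩).2
  have hind : iIndepFun Z (gaussPi δ W) := by
    refine iIndepFun_of_dependsOn (fun k => (hZm k).choose_spec.meas)
      (S := fun k => ι '' I.msgBranch m (I.bdry b k) b)
      (fun k => dependsOn_comp fun z z' hz => zPrev_congr hinj m hz) fun k k' hkk' => ?_
    refine (Set.disjoint_image_iff hι).2 ?_
    cases m with
    | zero => simp [msgBranch_zero]
    | succ m =>
      exact h.disjoint_msgBranch (by omega) ⟨k, rfl⟩ ⟨k', rfl⟩ fun hk => hkk' (hinj b hk)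
  have hexp : ∀ x, I.partialD f (I.bdry b κ) b (fun k => Z k x) ^ 2 =
      ∑ S : Finset (Fin r) with κ ∈ S, ∑ T : Finset (Fin r) with κ ∈ T,
        fourierCoeff (I.clauseFun f b) S * fourierCoeff (I.clauseFun f b) T *
          ((∏ k ∈ S.erase κ, Z k x) * ∏ k ∈ T.erase κ, Z k x) := by
    intro x
    rw [partialD_eq f (hinj b), sq, Finset.sum_mul_sum]
    exact Finset.sum_congr rfl fun S _ => Finset.sum_congr rfl fun T _ => by ring
  have hint : ∀ S T : Finset (Fin r), Integrable (fun x =>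
      fourierCoeff (I.clauseFun f b) S * fourierCoeff (I.clauseFun f b) T *
          ((∏ k ∈ S.erase κ, Z k x) * ∏ k ∈ T.erase κ, Z k x)) (gaussPi δ W) := by
    intro S T
    obtain ⟨C1, h1⟩ := HasMoments.exists_finset_prod (S.erase κ) fun k _ => hZm k
    obtain ⟨C2, h2⟩ := HasMoments.exists_finset_prod (T.erase κ) fun k _ => hZm k
    exact (h1.integrable_mul h2).const_mul _
  change ∫ x, I.partialD f (I.bdry b κ) b (fun k => Z k x) ^ 2 ∂(gaussPi δ W) =
    gradVar f κ (fun k => ∫ x, Z k x ^ 2 ∂(gaussPi δ W))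
  simp_rw [hexp]
  rw [integral_finsetSum _ fun S _ => integrable_finsetSum _ fun T _ => hint S T]
  rw [gradVar]
  refine Finset.sum_congr rfl fun S hS => ?_
  rw [integral_finsetSum _ fun T _ => hint S T]
  simp_rw [integral_const_mul]
  rw [Finset.sum_eq_single S]
  · rw [integral_prod_mul_prod hind (fun k => (hZm k).choose_spec.meas) hZ0, if_pos rfl, ← sq,
      fourierCoeff_clauseFun_sq]
  · intro T hT hTS
    rw [integral_prod_mul_prod hind (fun k => (hZm k).choose_spec.meas) hZ0, if_neg, mul_zero]
    intro hST
    have hκS : κ ∈ S := (Finset.mem_filter.1 hS).2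
    have hκT : κ ∈ T := (Finset.mem_filter.1 hT).2
    exact hTS (by rw [← Finset.insert_erase hκT, ← hST, Finset.insert_erase hκS])
  · exact fun hS' => absurd hS hS'

/-- The second moment of the contribution of a clause, an increment of `gradVar`: a martingale
difference is orthogonal to the past. -/
lemma Admissible.integral_clauseVar_sq (hf : ∀ x, f x = 0 ∨ f x = 1)
    (h : I.Admissible f δ K L d F) (hι : Function.Injective ι)
    (hm : m ≤ L) (hB : ∀ k ≤ m, ∃ C, I.MessageBound f δ d F ι k C) (b : E) (κ : Fin r) :
    ∫ x, I.clauseVar f d F ι m (I.bdry b κ) b x ^ 2 ∂(gaussPi δ W) =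
    gradVar f κ (fun k => ∫ x, I.zPrev f d F (x ∘ ι) (m + 1) (I.bdry b k) b ^ 2 ∂(gaussPi δ W)) -
    gradVar f κ (fun k => ∫ x, I.zPrev f d F (x ∘ ι) m (I.bdry b k) b ^ 2 ∂(gaussPi δ W)) := by
  have hib : I.Inc (I.bdry b κ) b := ⟨κ, rfl⟩
  obtain ⟨C, hC⟩ := hB m le_rfl
  have h1 := h.hasMoments_clauseStep hf hC hib
  have h2 := hasMoments_partialD (μ := gaussPi δ W) hf (h.girth.1 b) hib
      (Z := fun κ (x : W → ℝ) => I.zPrev f d F (x ∘ ι) m (I.bdry b κ) b)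
      fun κ => (hC _ _ ⟨κ, rfl⟩).1
  have h3 := h.condZero_clauseStep hι hm hC hib _ _ h2 (by
    intro x y hxy
    refine partialD_congr (h.girth.1 b) hib fun k _ => ?_
    refine (dependsOn_comp (ι := ι) fun z z' hz => zPrev_congr h.girth.1 m hz).mono ?_ hxy
    exact compl_image_of_disjoint hι
      (h.disjoint_msgBranch_clauseSphere hm ⟨k, rfl⟩))
  rw [← h.integral_partialD_sq hι (by omega) (fun k hk => hB k (by omega)) b κ,
    ← h.integral_partialD_sq hι (by omega) (fun k hk => hB k (by omega)) b κ, clauseVar_of_inc hib]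
  have h4 : ∀ x : W → ℝ, I.partialD f (I.bdry b κ) b
      (fun k => I.zPrev f d F (x ∘ ι) (m + 1) (I.bdry b k) b) ^ 2 =
      (I.clauseStep f d F (x ∘ ι) m (I.bdry b κ) b ^ 2 +
        2 * (I.clauseStep f d F (x ∘ ι) m (I.bdry b κ) b *
          I.partialD f (I.bdry b κ) b (fun k => I.zPrev f d F (x ∘ ι) m (I.bdry b k) b))) +
        I.partialD f (I.bdry b κ) b (fun k => I.zPrev f d F (x ∘ ι) m (I.bdry b k) b) ^ 2 := by
    intro x
    rw [clauseStep]
    ring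
  simp_rw [h4]
  have i1 := h1.integrable_pow 2
  have i2 := (h1.integrable_mul h2).const_mul 2
  have i12 : Integrable (fun x : W → ℝ => I.clauseStep f d F (x ∘ ι) m (I.bdry b κ) b ^ 2 +
      2 * (I.clauseStep f d F (x ∘ ι) m (I.bdry b κ) b *
        I.partialD f (I.bdry b κ) b (fun k => I.zPrev f d F (x ∘ ι) m (I.bdry b k) b)))
      (gaussPi δ W) := i1.add i2
  rw [integral_add i12 (h2.integrable_pow 2), integral_add i1 i2, integral_const_mul, h3]
  ring

/-- The contributions of different clauses to `u^{m+1}` are orthogonal, even after weighting by a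
function of earlier information. -/
lemma Admissible.integral_mul_uMsg_sq (hf : ∀ x, f x = 0 ∨ f x = 1)
    (hlin : fourierWeight f 1 = 0)
    (h : I.Admissible f δ K L d F) (hι : Function.Injective ι)
    (hm : m < L) (hB : I.MessageBound f δ d F ι m C) {i : V} {a : E} (hi : I.Inc i a)
    {Y : (W → ℝ) → ℝ} (hY : HasMoments (gaussPi δ W) Y C')
    (hYA : DependsOn Y (ι '' I.msgSphere (m + 1) i a)ᶜ) :
    ∫ x, Y x * I.uMsg f d F (x ∘ ι) (m + 1) i a ^ 2 ∂(gaussPi δ W) =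
      (1 / ((d : ℝ) - 1)) * ∑ b ∈ I.starErase i a,
        ∫ x, Y x * I.clauseVar f d F ι m i b x ^ 2 ∂(gaussPi δ W) := by
  have hX := h.hasMoments_clauseVar hf hB i
  have hd : (0 : ℝ) ≤ (d : ℝ) - 1 := by
    have : (2 : ℝ) ≤ d := by exact_mod_cast h.two_le
    linarith
  have hexp : ∀ x : W → ℝ, Y x * I.uMsg f d F (x ∘ ι) (m + 1) i a ^ 2 =
      (1 / ((d : ℝ) - 1)) * ∑ b ∈ I.starErase i a, ∑ b' ∈ I.starErase i a,
        Y x * (I.clauseVar f d F ι m i b x * I.clauseVar f d F ι m i b' x) := by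
    intro x
    rw [h.uMsg_eq hlin hi, h.cast_card_starErase hi, mul_pow, div_pow, Real.sq_sqrt hd, one_pow, sq,
      Finset.sum_mul_sum]
    simp_rw [← Finset.mul_sum]
    ring
  have hint : ∀ b b', Integrable (fun x =>
      Y x * (I.clauseVar f d F ι m i b x * I.clauseVar f d F ι m i b' x)) (gaussPi δ W) :=
    fun b b' => hY.integrable_mul ((hX b).mul (hX b'))
  simp_rw [hexp]
  rw [integral_const_mul,
    integral_finsetSum _ fun b _ => integrable_finsetSum _ fun b' _ => hint b b']
  congr 1
  refine Finset.sum_congr rfl fun b hb => ?_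
  rw [integral_finsetSum _ fun b' _ => hint b b', Finset.sum_eq_single b]
  · simp_rw [sq]
  · intro b' hb' hne
    obtain ⟨hba, hib⟩ := mem_starErase.1 hb
    obtain ⟨hba', hib'⟩ := mem_starErase.1 hb'
    have h1 := h.condZero_clauseStep hι hm.le hB hib _ _ (hY.mul (hX b')) (by
      refine dependsOn_mul (hYA.mono ?_) ?_
      · exact Set.compl_subset_compl.2
          (Set.image_mono (clauseSphere_subset_msgSphere hib hba))
      · rw [clauseVar_of_inc hib']
        refine (dependsOn_clauseStep h.girth.1 hib').mono ?_
        exact compl_image_of_disjoint hι ((h.disjoint_clauseBranch hm hib' hib hne).mono_right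
          clauseSphere_subset_clauseBranch))
    rw [← h1]
    congr 1
    ext x
    rw [clauseVar_of_inc hib]
    ring
  · exact fun h' => absurd hb h'

lemma Admissible.integral_uMsg_sq (hf : ∀ x, f x = 0 ∨ f x = 1)
    (hlin : fourierWeight f 1 = 0)
    (h : I.Admissible f δ K L d F) (hι : Function.Injective ι)
    (hm : m < L) (hB : I.MessageBound f δ d F ι m C) {i : V} {a : E} (hi : I.Inc i a) :
    ∫ x, I.uMsg f d F (x ∘ ι) (m + 1) i a ^ 2 ∂(gaussPi δ W) =
      (1 / ((d : ℝ) - 1)) * ∑ b ∈ I.starErase i a,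
        ∫ x, I.clauseVar f d F ι m i b x ^ 2 ∂(gaussPi δ W) := by
  have := h.integral_mul_uMsg_sq hf hlin hι hm hB hi (HasMoments.const 1)
    ((dependsOn_const 1).mono (Set.empty_subset _))
  simpa using this

lemma Admissible.integral_AMsg_sq (h : I.Admissible f δ K L d F) (hι : Function.Injective ι)
    (hm : m < L) {i : V} {a : E} (hi : I.Inc i a) :
    ∫ x, I.AMsg f d F (x ∘ ι) m i a ^ 2 ∂(gaussPi δ W) = δ / nu f δ (m + 1) := by
  have hmp := measurePreserving_comp (P := gaussianReal 0 δ.toNNReal) hι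
  have h1 := integral_map (μ := gaussPi δ W) hmp.measurable.aemeasurable
    (f := fun z : V → ℝ => I.AMsg f d F z m i a ^ 2)
    ((measurable_AMsg h.meas hm i a).pow_const 2).aestronglyMeasurable
  rw [← h.norm m hm i a hi, ← h1, hmp.map_eq]

/-- Weighting `(u^{m+1})²` by a bounded function of earlier information has, up to `O(1/√d)`, the
effect of multiplying its expectation: the squares of the contributions of the clauses are
independent, so their average has fluctuations of order `1/√d`. -/
lemma exists_integral_AMsg_sq_mul_uMsg_sq (hf : ∀ x, f x = 0 ∨ f x = 1)
    (hlin : fourierWeight f 1 = 0) (δ K : ℝ) (C₀ : ℕ → ℝ) : ∃ B : ℝ,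
    ∀ {V E W : Type*} [Fintype V] [Fintype E] [Fintype W]
      (I : Instance r V E) (L d m : ℕ) (F : V → E → (ℓ : ℕ) → (Fin ℓ → ℝ) → ℝ) (ι : V → W),
      I.Admissible f δ K L d F → Function.Injective ι → m < L → I.MessageBound f δ d F ι m C₀ →
      ∀ i a, I.Inc i a →
        |∫ x, I.AMsg f d F (x ∘ ι) m i a ^ 2 * I.uMsg f d F (x ∘ ι) (m + 1) i a ^ 2 ∂(gaussPi δ W) -
          δ / nu f δ (m + 1) * ∫ x, I.uMsg f d F (x ∘ ι) (m + 1) i a ^ 2 ∂(gaussPi δ W)| ≤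
        B / √((d : ℝ) - 1) := by
  set C₁ : ℕ → ℝ := HasMoments.addBound
    (HasMoments.mulBound (clauseBound r C₀) (clauseBound r C₀)) (fun p => clauseBound r C₀ 2 ^ p)
    with hC₁
  obtain ⟨D, hD⟩ := HasMoments.exists_normalized_sum C₁
  refine ⟨K ^ 2 * D 1, ?_⟩
  intro V E W _ _ _ I L d m F ι h hι hm hB i a hi
  have hX := h.hasMoments_clauseVar hf hB i
  set v : E → ℝ := fun b => ∫ x, I.clauseVar f d F ι m i b x ^ 2 ∂(gaussPi δ W) with hv
  have hv0 : ∀ b, 0 ≤ v b := fun b => integral_nonneg fun x => sq_nonneg _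
  have hvle : ∀ b, v b ≤ clauseBound r C₀ 2 := fun b => by
    have := (hX b).bound 2
    simpa only [sq_abs] using this
  -- The fluctuations of the squared contributions: independent, centred, with bounded moments.
  set Q : E → (W → ℝ) → ℝ := fun b x => I.clauseVar f d F ι m i b x ^ 2 - v b with hQ
  have hQm : ∀ b, HasMoments (gaussPi δ W) (Q b) C₁ := by
    intro b
    have h1 := ((hX b).mul (hX b)).sub ((HasMoments.const (μ := gaussPi δ W) (v b)).mono
      (D := fun p => clauseBound r C₀ 2 ^ p) fun p => by
        rw [abs_of_nonneg (hv0 b)]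
        exact pow_le_pow_left₀ (hv0 b) (hvle b) p)
    simpa only [← sq] using h1
  have hQ0 : ∀ b, ∫ x, Q b x ∂(gaussPi δ W) = 0 := by
    intro b
    simp only [hQ]
    rw [integral_sub ((hX b).integrable_pow 2) (integrable_const _)]
    simp [hv]
  have hQind : iIndepFun Q (gaussPi δ W) :=
    (h.iIndepFun_clauseVar hf hι hm hB i).comp (fun b t => t ^ 2 - v b)
      fun b => (measurable_id.pow_const 2).sub_const _
  have hS := hD Q hQind hQm hQ0 (I.starErase i a)
  have hmA : Measurable fun x : W → ℝ => I.AMsg f d F (x ∘ ι) m i a :=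
    (measurable_AMsg h.meas hm i a).comp (measurable_comp_right ι)
  have hAle : ∀ x : W → ℝ, |I.AMsg f d F (x ∘ ι) m i a| ≤ |K| := fun x =>
    (h.bdd m hm i a _).trans (le_abs_self K)
  have hA := (HasMoments.const (μ := gaussPi δ W) K).of_abs_le hmA hAle
  have hA2 := hA.mul hA
  have hAdep : DependsOn (fun x : W → ℝ => I.AMsg f d F (x ∘ ι) m i a)
      (ι '' I.msgSphere (m + 1) i a)ᶜ :=
    (dependsOn_comp fun z z' hz => AMsg_congr h.girth.1 m hz).mono
      (compl_image_of_disjoint hι (h.disjoint_msgBranch_msgSphere hm hi))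
  have e1 := h.integral_mul_uMsg_sq hf hlin hι hm hB hi hA2 (dependsOn_mul hAdep hAdep)
  have e2 : ∫ x, I.uMsg f d F (x ∘ ι) (m + 1) i a ^ 2 ∂(gaussPi δ W) =
      (1 / ((d : ℝ) - 1)) * ∑ b ∈ I.starErase i a, v b := h.integral_uMsg_sq hf hlin hι hm hB hi
  have hd : (0 : ℝ) < (d : ℝ) - 1 := by
    have : (2 : ℝ) ≤ d := by exact_mod_cast h.two_le
    linarith
  simp only [← sq] at e1
  have hA2' : HasMoments (gaussPi δ W) (fun x : W → ℝ => I.AMsg f d F (x ∘ ι) m i a ^ 2)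
      (HasMoments.mulBound (fun p => |K| ^ p) fun p => |K| ^ p) := by
    simpa only [← sq] using hA2
  have e3 : (∫ x, I.AMsg f d F (x ∘ ι) m i a ^ 2 * I.uMsg f d F (x ∘ ι) (m + 1) i a ^ 2
        ∂(gaussPi δ W)) -
          δ / nu f δ (m + 1) * ∫ x, I.uMsg f d F (x ∘ ι) (m + 1) i a ^ 2 ∂(gaussPi δ W) =
      (1 / √((d : ℝ) - 1)) * ∫ x, I.AMsg f d F (x ∘ ι) m i a ^ 2 *
        ((1 / √((I.starErase i a).card : ℝ)) * ∑ b ∈ I.starErase i a, Q b x) ∂(gaussPi δ W) := by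
    rw [e1, e2, ← h.integral_AMsg_sq hι hm hi, h.cast_card_starErase hi]
    have e4 : ∀ x : W → ℝ, I.AMsg f d F (x ∘ ι) m i a ^ 2 *
        ((1 / √((d : ℝ) - 1)) * ∑ b ∈ I.starErase i a, Q b x) =
        (1 / √((d : ℝ) - 1)) * ∑ b ∈ I.starErase i a,
          (I.AMsg f d F (x ∘ ι) m i a ^ 2 * I.clauseVar f d F ι m i b x ^ 2 -
            v b * I.AMsg f d F (x ∘ ι) m i a ^ 2) := by
      intro x
      simp only [hQ, Finset.mul_sum]
      exact Finset.sum_congr rfl fun b _ => by ring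
    have i1 : ∀ b, Integrable (fun x : W → ℝ =>
        I.AMsg f d F (x ∘ ι) m i a ^ 2 * I.clauseVar f d F ι m i b x ^ 2) (gaussPi δ W) := by
      intro b
      have := hA2'.integrable_mul ((hX b).mul (hX b))
      simpa only [← sq] using this
    have i2 : ∀ b, Integrable (fun x : W → ℝ =>
        v b * I.AMsg f d F (x ∘ ι) m i a ^ 2) (gaussPi δ W) :=
      fun b => hA2'.integrable.const_mul _
    have i3 : ∀ b, Integrable (fun x : W → ℝ =>
        I.AMsg f d F (x ∘ ι) m i a ^ 2 * I.clauseVar f d F ι m i b x ^ 2 -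
          v b * I.AMsg f d F (x ∘ ι) m i a ^ 2) (gaussPi δ W) := fun b => (i1 b).sub (i2 b)
    simp_rw [e4]
    rw [integral_const_mul, integral_finsetSum _ fun b _ => i3 b]
    have e5 : ∀ b, ∫ x, (I.AMsg f d F (x ∘ ι) m i a ^ 2 * I.clauseVar f d F ι m i b x ^ 2 -
            v b * I.AMsg f d F (x ∘ ι) m i a ^ 2) ∂(gaussPi δ W) =
        (∫ x, I.AMsg f d F (x ∘ ι) m i a ^ 2 * I.clauseVar f d F ι m i b x ^ 2 ∂(gaussPi δ W)) -
          v b * ∫ x, I.AMsg f d F (x ∘ ι) m i a ^ 2 ∂(gaussPi δ W) := by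
      intro b
      rw [integral_sub (i1 b) (i2 b), integral_const_mul]
    simp_rw [e5]
    have e6 : 1 / ((d : ℝ) - 1) = 1 / √((d : ℝ) - 1) * (1 / √((d : ℝ) - 1)) := by
      rw [div_mul_div_comm, Real.mul_self_sqrt hd.le, one_mul]
    rw [Finset.sum_sub_distrib, ← Finset.sum_mul, e6]
    ring
  have e6 : |∫ x, I.AMsg f d F (x ∘ ι) m i a ^ 2 *
        ((1 / √((I.starErase i a).card : ℝ)) * ∑ b ∈ I.starErase i a, Q b x) ∂(gaussPi δ W)| ≤
      K ^ 2 * D 1 := by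
    refine abs_integral_le_integral_abs.trans ?_
    calc _ ≤ ∫ x, K ^ 2 * |(1 / √((I.starErase i a).card : ℝ)) *
          ∑ b ∈ I.starErase i a, Q b x| ^ 1 ∂(gaussPi δ W) := by
          refine integral_mono (hA2'.integrable_mul hS).abs ((hS.int 1).const_mul _) fun x => ?_
          simp only [pow_one]
          rw [abs_mul]
          refine mul_le_mul_of_nonneg_right ?_ (abs_nonneg _)
          rw [abs_of_nonneg (sq_nonneg _), ← sq_abs, ← sq_abs K]
          exact pow_le_pow_left₀ (abs_nonneg _) (hAle x) 2
      _ ≤ K ^ 2 * D 1 := by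
          rw [integral_const_mul]
          exact mul_le_mul_of_nonneg_left (hS.bound 1) (sq_nonneg K)
  rw [e3, abs_mul, abs_of_nonneg (one_div_nonneg.2 (Real.sqrt_nonneg _))]
  calc _ ≤ (1 / √((d : ℝ) - 1)) * (K ^ 2 * D 1) :=
        mul_le_mul_of_nonneg_left e6 (one_div_nonneg.2 (Real.sqrt_nonneg _))
    _ = _ := by ring

end

end Instance

end MsgCSP

namespace MsgCSP

/-! ### Second moments for large degree -/

lemma exists_gradVar_close {r : ℕ} (f : (Fin r → ℤˣ) → ℝ) (t : ℝ) {ε : ℝ} (hε : 0 < ε) :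
    ∃ η > 0, ∀ (κ : Fin r) (s : Fin r → ℝ), (∀ k, |s k - t| ≤ η) →
      |gradVar f κ s - gradVar f κ (fun _ => t)| ≤ ε := by
  have hc : Continuous fun (s : Fin r → ℝ) (κ : Fin r) => gradVar f κ s :=
    continuous_pi fun κ => continuous_gradVar f κ
  obtain ⟨η, hη, h⟩ := Metric.continuous_iff.1 hc (fun _ => t) ε hε
  refine ⟨η / 2, by positivity, fun κ s hs => ?_⟩
  have h1 : dist s (fun _ => t) < η := by
    refine lt_of_le_of_lt ((dist_pi_le_iff (by positivity)).2 fun k => ?_) (half_lt_self hη)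
    rw [Real.dist_eq]
    exact hs k
  have h2 := (dist_pi_lt_iff hε).1 (h s h1) κ
  rw [Real.dist_eq] at h2
  exact h2.le

namespace Instance

section

variable {r : ℕ} {V E W : Type*} {I : Instance r V E} {f : (Fin r → ℤˣ) → ℝ}
  [Fintype V] [Fintype E] [Fintype W] {δ K : ℝ} {L d : ℕ}
  {F : V → E → (ℓ : ℕ) → (Fin ℓ → ℝ) → ℝ} {ι : V → W} {m : ℕ} {C C' : ℕ → ℝ}

open Classical in
/-- Index-regularity averages a function of the position of `i` over the clauses of `i`. -/
lemma IndexRegular.sum_star (h : I.IndexRegular d) (i : V) (g : Fin r → ℝ) :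
    r * ∑ b ∈ I.star i, ∑ κ with I.bdry b κ = i, g κ = d * ∑ κ, g κ := by
  have h1 : ∑ b ∈ I.star i, ∑ κ with I.bdry b κ = i, g κ =
      ∑ κ, ((Finset.univ.filter fun e => I.bdry e κ = i).card : ℝ) * g κ := by
    have h2 : ∀ b, ∑ κ with I.bdry b κ = i, g κ = ∑ κ, if I.bdry b κ = i then g κ else 0 :=
      fun b => Finset.sum_filter _ _
    simp_rw [h2]
    rw [Finset.sum_subset (Finset.subset_univ (I.star i)), Finset.sum_comm]
    · refine Finset.sum_congr rfl fun κ _ => ?_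
      rw [← Finset.sum_filter, Finset.sum_const, nsmul_eq_mul]
    · intro b _ hb
      refine Finset.sum_eq_zero fun κ _ => if_neg fun hκ => hb (mem_star.2 ⟨κ, hκ⟩)
  rw [h1, Finset.mul_sum, Finset.mul_sum]
  refine Finset.sum_congr rfl fun κ _ => ?_
  rw [← mul_assoc]
  congr 1
  have := (h i).2 κ
  exact_mod_cast this

/-- If the messages `z` have nearly the second moments `mδ` and `(m+1)δ`, then `u^{m+1}` has nearly
the second moment `ν_{m+1}`. -/
lemma exists_uMsg_sq_close (hf : ∀ x, f x = 0 ∨ f x = 1) (hlin : fourierWeight f 1 = 0)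
    (δ K : ℝ) (m : ℕ) {ε : ℝ} (hε : 0 < ε) : ∃ η > 0, ∃ D : ℕ,
    ∀ {V E W : Type*} [Fintype V] [Fintype E] [Fintype W]
      (I : Instance r V E) (L d : ℕ) (F : V → E → (ℓ : ℕ) → (Fin ℓ → ℝ) → ℝ) (ι : V → W),
      I.Admissible f δ K L d F → Function.Injective ι → m < L → D ≤ d →
      (∀ i a, I.Inc i a →
        |∫ x, I.zPrev f d F (x ∘ ι) m i a ^ 2 ∂(gaussPi δ W) - m * δ| ≤ η) →
      (∀ i a, I.Inc i a →
        |∫ x, I.zPrev f d F (x ∘ ι) (m + 1) i a ^ 2 ∂(gaussPi δ W) - (m + 1) * δ| ≤ η) →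
      ∀ i a, I.Inc i a →
        |∫ x, I.uMsg f d F (x ∘ ι) (m + 1) i a ^ 2 ∂(gaussPi δ W) - nu f δ (m + 1)| ≤ ε := by
  classical
  obtain ⟨η₁, hη₁, h₁⟩ := exists_gradVar_close f (m * δ) (show 0 < ε / 4 by positivity)
  obtain ⟨η₂, hη₂, h₂⟩ := exists_gradVar_close f ((m + 1) * δ) (show 0 < ε / 4 by positivity)
  set M : ℝ := |nu f δ (m + 1)| + ∑ κ, |stepVar f δ m κ| with hM
  obtain ⟨D, hD⟩ := exists_nat_gt (2 * M / ε)
  refine ⟨min η₁ η₂, lt_min hη₁ hη₂, D + 1, ?_⟩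
  intro V E W _ _ _ I L d F ι h hι hm hDd hz hz' i a hi
  have hBs : ∀ k ≤ m, ∃ C, I.MessageBound f δ d F ι k C := fun k hk => by
    obtain ⟨C, hC⟩ := exists_messageBound.{_, _, _} hf hlin δ K k
    exact ⟨C, hC I L d F ι h hι (by omega)⟩
  obtain ⟨C, hC⟩ := hBs m le_rfl
  have hinj := h.girth.1
  -- The limiting second moment of the contribution of the clause `b`, which depends only on the
  -- position of `i` in `b`.
  set nb : E → ℝ := fun b => ∑ κ with I.bdry b κ = i, stepVar f δ m κ with hnb
  have hd : (0 : ℝ) < (d : ℝ) - 1 := by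
    have : (2 : ℝ) ≤ d := by exact_mod_cast h.two_le
    linarith
  have hr : r ≠ 0 := by
    rintro rfl
    obtain ⟨κ, -⟩ := hi
    exact κ.elim0
  have hv : ∀ b ∈ I.starErase i a,
      |∫ x, I.clauseVar f d F ι m i b x ^ 2 ∂(gaussPi δ W) - nb b| ≤ ε / 2 := by
    intro b hb
    obtain ⟨-, κ, rfl⟩ := mem_starErase.1 hb
    have e1 : nb b = stepVar f δ m κ := by
      simp only [hnb]
      rw [Finset.sum_eq_single_of_mem κ (by simp)]
      intro κ' hκ' hne
      exact absurd (hinj b (Finset.mem_filter.1 hκ').2) hne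
    rw [h.integral_clauseVar_sq hf hι hm.le hBs b κ, e1, stepVar]
    have e2 := h₁ κ (fun k => ∫ x, I.zPrev f d F (x ∘ ι) m (I.bdry b k) b ^ 2 ∂(gaussPi δ W))
      fun k => (hz _ _ ⟨k, rfl⟩).trans (min_le_left _ _)
    have e3 := h₂ κ (fun k => ∫ x, I.zPrev f d F (x ∘ ι) (m + 1) (I.bdry b k) b ^ 2
      ∂(gaussPi δ W)) fun k => (hz' _ _ ⟨k, rfl⟩).trans (min_le_right _ _)
    rw [abs_le] at e2 e3 ⊢
    constructor <;> linarith [e2.1, e2.2, e3.1, e3.2]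
  -- Index-regularity averages the limiting second moments over all positions.
  have hsum : ∑ b ∈ I.starErase i a, nb b = d * nu f δ (m + 1) - nb a := by
    have e1 := h.reg.sum_star i (stepVar f δ m)
    rw [sum_stepVar f δ m hr] at e1
    have hr' : (r : ℝ) ≠ 0 := by exact_mod_cast hr
    have e2 : ∑ b ∈ I.star i, nb b = d * nu f δ (m + 1) := by
      refine mul_left_cancel₀ hr' (e1.trans (by ring))
    rw [starErase, ← e2, ← Finset.sum_erase_add _ _ (mem_star.2 hi)]
    ring
  have hna : |nb a| ≤ ∑ κ, |stepVar f δ m κ| :=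
    (Finset.abs_sum_le_sum_abs _ _).trans
      (Finset.sum_le_sum_of_subset_of_nonneg (Finset.filter_subset _ _) fun _ _ _ => abs_nonneg _)
  have hdiff : |∑ b ∈ I.starErase i a, (∫ x, I.clauseVar f d F ι m i b x ^ 2 ∂(gaussPi δ W) - nb b)|
      ≤ ((d : ℝ) - 1) * (ε / 2) := by
    refine (Finset.abs_sum_le_sum_abs _ _).trans ((Finset.sum_le_sum hv).trans ?_)
    rw [Finset.sum_const, nsmul_eq_mul, h.cast_card_starErase hi]
  have hMd : M ≤ ((d : ℝ) - 1) * (ε / 2) := by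
    have e1 : (D : ℝ) + 1 ≤ d := by exact_mod_cast hDd
    have e2 : 2 * M < D * ε := by rwa [div_lt_iff₀ hε] at hD
    nlinarith
  rw [h.integral_uMsg_sq hf hlin hι hm hC hi]
  rw [Finset.sum_sub_distrib, hsum] at hdiff
  have e1 : (1 / ((d : ℝ) - 1)) * ∑ b ∈ I.starErase i a,
      ∫ x, I.clauseVar f d F ι m i b x ^ 2 ∂(gaussPi δ W) - nu f δ (m + 1) =
      (1 / ((d : ℝ) - 1)) * ((∑ b ∈ I.starErase i a,
      ∫ x, I.clauseVar f d F ι m i b x ^ 2 ∂(gaussPi δ W)) - ((d : ℝ) - 1) * nu f δ (m + 1)) := by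
    field_simp
  rw [e1, abs_mul, abs_of_pos (by positivity), one_div, inv_mul_le_iff₀ hd]
  rw [abs_le] at hdiff ⊢
  have e2 := abs_le.1 (hna)
  have e3 := abs_le.1 (le_refl |nu f δ (m + 1)|)
  constructor <;> linarith [hdiff.1, hdiff.2, e2.1, e2.2, e3.1, e3.2]

/-- The messages `z` have nearly the second moment of a Brownian path at time `mδ`, uniformly over
admissible instances of large degree. -/
lemma exists_zPrev_sq_close (hf : ∀ x, f x = 0 ∨ f x = 1) (hlin : fourierWeight f 1 = 0)
    {δ : ℝ} (hδ : 0 < δ) (K : ℝ) (hnu : ∀ m, 0 < nu f δ (m + 1)) (m : ℕ) : ∀ ε > 0, ∃ D : ℕ,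
    ∀ {V E W : Type*} [Fintype V] [Fintype E] [Fintype W]
      (I : Instance r V E) (L d : ℕ) (F : V → E → (ℓ : ℕ) → (Fin ℓ → ℝ) → ℝ) (ι : V → W),
      I.Admissible f δ K L d F → Function.Injective ι → m ≤ L → D ≤ d → ∀ i a, I.Inc i a →
        |∫ x, I.zPrev f d F (x ∘ ι) m i a ^ 2 ∂(gaussPi δ W) - m * δ| ≤ ε := by
  induction m using Nat.strong_induction_on with
  | _ m ih =>
    intro ε hε
    -- The increments of `z` are martingale differences, hence orthogonal.
    have hstep : ∀ {V E W : Type _} [Fintype V] [Fintype E] [Fintype W]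
      (I : Instance r V E) (L d : ℕ) (F : V → E → (ℓ : ℕ) → (Fin ℓ → ℝ) → ℝ) (ι : V → W),
      I.Admissible f δ K L d F → Function.Injective ι → ∀ k < L, ∀ i a, I.Inc i a →
        ∫ x, I.zPrev f d F (x ∘ ι) (k + 1) i a ^ 2 ∂(gaussPi δ W) =
        ∫ x, I.zPrev f d F (x ∘ ι) k i a ^ 2 ∂(gaussPi δ W) +
          ∫ x, I.zStep f d F (x ∘ ι) k i a ^ 2 ∂(gaussPi δ W) := by
      intro V E W _ _ _ I L d F ι h hι k hk i a hi
      obtain ⟨C, hC⟩ := exists_messageBound.{_, _, _} hf hlin δ K k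
      obtain ⟨h1, h2, h3⟩ := hC I L d F ι h hι hk.le i a hi
      have h4 : ∀ x : W → ℝ, I.zPrev f d F (x ∘ ι) (k + 1) i a ^ 2 =
          (I.zPrev f d F (x ∘ ι) k i a ^ 2 + I.zStep f d F (x ∘ ι) k i a ^ 2) +
          2 * (I.zStep f d F (x ∘ ι) k i a * I.zPrev f d F (x ∘ ι) k i a) := by
        intro x
        rw [zPrev_succ]
        ring
      have h5 := h3 _ _ h1 ((dependsOn_comp fun z z' hz => zPrev_congr h.girth.1 k hz).mono
        (compl_image_of_disjoint hι (h.disjoint_msgBranch_msgSphere hk.le hi)))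
      have i1 : Integrable (fun x : W → ℝ => I.zPrev f d F (x ∘ ι) k i a ^ 2 +
          I.zStep f d F (x ∘ ι) k i a ^ 2) (gaussPi δ W) :=
        (h1.integrable_pow 2).add (h2.integrable_pow 2)
      simp_rw [h4]
      rw [integral_add i1 ((h2.integrable_mul h1).const_mul 2), integral_const_mul, h5,
        integral_add (h1.integrable_pow 2) (h2.integrable_pow 2)]
      ring
    rcases m with _ | _ | m
    · refine ⟨0, ?_⟩
      intro V E W _ _ _ I L d F ι h hι hm hD i a hi
      simp [zPrev, hε.le]
    · refine ⟨0, ?_⟩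
      intro V E W _ _ _ I L d F ι h hι hm hD i a hi
      rw [hstep I L d F ι h hι 0 (by omega) i a hi]
      have h1 : ∫ x : W → ℝ, I.zStep f d F (x ∘ ι) 0 i a ^ 2 ∂(gaussPi δ W) = δ := by
        have h4 := (measurePreserving_eval (fun _ : W => gaussianReal 0 δ.toNNReal) (ι i)).map_eq
        have h5 := integral_map (μ := gaussPi δ W) (φ := Function.eval (ι i))
          (measurable_pi_apply _).aemeasurable (f := fun t : ℝ => t ^ 2)
          (measurable_id.pow_const 2).aestronglyMeasurable
        have h6 := variance_of_integral_eq_zero (μ := gaussianReal 0 δ.toNNReal) (X := id)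
          measurable_id.aemeasurable (by simp)
        rw [variance_id_gaussianReal, Real.coe_toNNReal _ hδ.le] at h6
        rw [h4] at h5
        exact h5.symm.trans h6.symm
      rw [h1]
      simp [zPrev, hε.le]
    -- By the normalization of the nonlinearity the increment has second moment about
    -- `δ / ν_{m+1} * ν_{m+1} = δ`.
    · obtain ⟨C, hC⟩ := exists_messageBound.{_, _, _} hf hlin δ K m
      obtain ⟨B, hB⟩ := exists_integral_AMsg_sq_mul_uMsg_sq.{_, _, _} hf hlin δ K C
      have hν := hnu m
      set ε' : ℝ := ε / 3 / (δ / nu f δ (m + 1)) with hε'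
      have hε'0 : 0 < ε' := by positivity
      obtain ⟨η, hη, D₁, h₁⟩ := exists_uMsg_sq_close.{_, _, _} hf hlin δ K m hε'0
      obtain ⟨D₂, h₂⟩ := ih m (by omega) η hη
      obtain ⟨D₃, h₃⟩ := ih (m + 1) (by omega) (min η (ε / 3)) (by positivity)
      obtain ⟨N, hN⟩ := exists_nat_gt ((3 * |B| / ε) ^ 2)
      refine ⟨D₁ + D₂ + D₃ + N + 1, ?_⟩
      intro V E W _ _ _ I L d F ι h hι hm hD i a hi
      have hz := h₃ I L d F ι h hι (by omega) (by omega)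
      have hu := h₁ I L d F ι h hι (by omega) (by omega)
        (h₂ I L d F ι h hι (by omega) (by omega))
        (fun i a hi => by
          have := (hz i a hi).trans (min_le_left _ _)
          push_cast at this
          exact this) i a hi
      have hA := hB I L d m F ι h hι (by omega) (hC I L d F ι h hι (by omega)) i a hi
      rw [hstep I L d F ι h hι (m + 1) (by omega) i a hi]
      have hsq : ∀ x : W → ℝ, I.zStep f d F (x ∘ ι) (m + 1) i a ^ 2 =
          I.AMsg f d F (x ∘ ι) m i a ^ 2 * I.uMsg f d F (x ∘ ι) (m + 1) i a ^ 2 := fun x => by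
        rw [zStep, mul_pow]
      simp_rw [hsq]
      have hd : (N : ℝ) ≤ (d : ℝ) - 1 := by
        have : ((N + 1 : ℕ) : ℝ) ≤ d := by exact_mod_cast (by omega : N + 1 ≤ d)
        push_cast at this
        linarith
      have hB3 : B / √((d : ℝ) - 1) ≤ ε / 3 := by
        have e1 : 3 * |B| / ε < √((d : ℝ) - 1) :=
          Real.lt_sqrt_of_sq_lt (hN.trans_le hd)
        have e2 : 0 < √((d : ℝ) - 1) := lt_of_le_of_lt (by positivity) e1
        rw [div_lt_iff₀ hε] at e1
        rw [div_le_iff₀ e2]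
        linarith [le_abs_self B]
      have hu' : |δ / nu f δ (m + 1) * ∫ x, I.uMsg f d F (x ∘ ι) (m + 1) i a ^ 2 ∂(gaussPi δ W) -
          δ| ≤ ε / 3 := by
        have e1 : δ / nu f δ (m + 1) * ∫ x, I.uMsg f d F (x ∘ ι) (m + 1) i a ^ 2 ∂(gaussPi δ W) - δ
            = δ / nu f δ (m + 1) * (∫ x, I.uMsg f d F (x ∘ ι) (m + 1) i a ^ 2 ∂(gaussPi δ W) -
              nu f δ (m + 1)) := by
          field_simp
        have e2 : 0 < δ / nu f δ (m + 1) := by positivity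
        rw [e1, abs_mul, abs_of_pos e2]
        calc _ ≤ δ / nu f δ (m + 1) * ε' := mul_le_mul_of_nonneg_left hu e2.le
          _ = ε / 3 := by rw [hε']; field_simp
      have hz1 := (hz i a hi).trans (min_le_right _ _)
      push_cast at hz1 ⊢
      rw [abs_le] at hz1 hu' hA ⊢
      constructor <;> linarith [hz1.1, hz1.2, hu'.1, hu'.2, hA.1, hA.2]

/-- `E[(u_{i→a}^{m+1})²] → ν_{m+1}`, uniformly over admissible instances. -/
lemma exists_uMsg_sq_sub_nu_le (hf : ∀ x, f x = 0 ∨ f x = 1) (hlin : fourierWeight f 1 = 0)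
    {δ : ℝ} (hδ : 0 < δ) (K : ℝ) (hnu : ∀ m, 0 < nu f δ (m + 1)) (m : ℕ) {ε : ℝ} (hε : 0 < ε) :
    ∃ D : ℕ, ∀ {V E W : Type*} [Fintype V] [Fintype E] [Fintype W]
      (I : Instance r V E) (L d : ℕ) (F : V → E → (ℓ : ℕ) → (Fin ℓ → ℝ) → ℝ) (ι : V → W),
      I.Admissible f δ K L d F → Function.Injective ι → m < L → D ≤ d → ∀ i a, I.Inc i a →
        |∫ x, I.uMsg f d F (x ∘ ι) (m + 1) i a ^ 2 ∂(gaussPi δ W) - nu f δ (m + 1)| ≤ ε := by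
  obtain ⟨η, hη, D₁, h₁⟩ := exists_uMsg_sq_close.{_, _, _} hf hlin δ K m hε
  obtain ⟨D₂, h₂⟩ := exists_zPrev_sq_close.{_, _, _} hf hlin hδ K hnu m η hη
  obtain ⟨D₃, h₃⟩ := exists_zPrev_sq_close.{_, _, _} hf hlin hδ K hnu (m + 1) η hη
  refine ⟨D₁ + D₂ + D₃, ?_⟩
  intro V E W _ _ _ I L d F ι h hι hm hD
  refine h₁ I L d F ι h hι hm (by omega) (h₂ I L d F ι h hι (by omega) (by omega)) fun i a hi => ?_
  have := h₃ I L d F ι h hι (by omega) (by omega) i a hi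
  push_cast at this
  exact this

end

end Instance

end MsgCSP

namespace MsgCSP

/-! ### A quantitative central limit theorem for characteristic functions -/

lemma norm_cexp_sub_taylor_le (x : ℝ) :
    ‖Complex.exp (x * Complex.I) - (1 + x * Complex.I - (x : ℂ) ^ 2 / 2)‖ ≤ 4 * |x| ^ 3 := by
  have hn : ‖(x : ℂ) * Complex.I‖ = |x| := by simp
  rcases le_total |x| 1 with h | h
  · have h1 := Complex.exp_bound (x := (x : ℂ) * Complex.I) (by rw [hn]; exact h) (n := 3)
      (by norm_num)
    rw [hn] at h1
    have h2 : ∑ m ∈ Finset.range 3, ((x : ℂ) * Complex.I) ^ m / (m.factorial : ℂ) =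
        1 + x * Complex.I - (x : ℂ) ^ 2 / 2 := by
      simp [Finset.sum_range_succ, mul_pow, Nat.factorial]
      ring
    rw [h2] at h1
    refine h1.trans ?_
    have : (0 : ℝ) ≤ |x| ^ 3 := by positivity
    norm_num [Nat.factorial]
    linarith
  · have h1 : ‖Complex.exp (x * Complex.I)‖ = 1 := Complex.norm_exp_ofReal_mul_I x
    have h2 : ‖(1 : ℂ) + x * Complex.I - (x : ℂ) ^ 2 / 2‖ ≤ 1 + |x| + |x| ^ 2 / 2 := by
      refine (norm_sub_le _ _).trans (add_le_add ((norm_add_le _ _).trans ?_) ?_)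
      · rw [hn]; simp
      · simp
    refine (norm_sub_le _ _).trans ?_
    rw [h1]
    nlinarith [h, mul_nonneg (abs_nonneg x) (sub_nonneg.2 h), abs_nonneg x,
      mul_nonneg (mul_nonneg (abs_nonneg x) (abs_nonneg x)) (sub_nonneg.2 h)]

lemma abs_one_sub_sub_exp_neg_le {y : ℝ} (hy : 0 ≤ y) : |1 - y - Real.exp (-y)| ≤ y ^ 2 := by
  rcases le_total y 1 with h | h
  · have := Real.abs_exp_sub_one_sub_id_le (x := -y) (by rw [abs_neg, abs_of_nonneg hy]; exact h)
    rw [abs_sub_comm]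
    have e : Real.exp (-y) - (1 - y) = Real.exp (-y) - 1 - -y := by ring
    rw [e]
    simpa using this
  · have h1 := Real.add_one_le_exp (-y)
    have h2 : Real.exp (-y) ≤ 1 := Real.exp_le_one_iff.2 (by linarith)
    rw [abs_le]
    constructor <;> nlinarith

lemma norm_prod_sub_prod_le {κ : Type*} (s : Finset κ) {a b : κ → ℂ} (ha : ∀ k ∈ s, ‖a k‖ ≤ 1)
    (hb : ∀ k ∈ s, ‖b k‖ ≤ 1) :
    ‖∏ k ∈ s, a k - ∏ k ∈ s, b k‖ ≤ ∑ k ∈ s, ‖a k - b k‖ := by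
  classical
  induction s using Finset.induction_on with
  | empty => simp
  | insert k s hk ih =>
    rw [Finset.prod_insert hk, Finset.prod_insert hk, Finset.sum_insert hk]
    have h1 := ih (fun k hk => ha k (by simp [hk])) fun k hk => hb k (by simp [hk])
    have h2 : ‖∏ k ∈ s, b k‖ ≤ 1 := by
      rw [norm_prod]
      exact Finset.prod_le_one (fun _ _ => norm_nonneg _) fun k hk => hb k (by simp [hk])
    have h3 : a k * ∏ k ∈ s, a k - b k * ∏ k ∈ s, b k =
        (a k - b k) * ∏ k ∈ s, b k + a k * (∏ k ∈ s, a k - ∏ k ∈ s, b k) := by ring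
    rw [h3]
    refine (norm_add_le _ _).trans (add_le_add ?_ ?_)
    · rw [norm_mul]
      exact mul_le_of_le_one_right (norm_nonneg _) h2
    · rw [norm_mul]
      exact (mul_le_of_le_one_left (norm_nonneg _) (ha k (by simp))).trans h1

section

variable {Ω : Type*} [MeasurableSpace Ω] {μ : Measure Ω} [IsProbabilityMeasure μ]

lemma integrable_cexp {X : Ω → ℝ} (hX : Measurable X) :
    Integrable (fun ω => Complex.exp (X ω * Complex.I)) μ := by
  refine (integrable_const (1 : ℝ)).mono' ?_ (ae_of_all _ fun ω => ?_)
  · exact (Complex.measurable_exp.comp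
      ((Complex.measurable_ofReal.comp hX).mul_const _)).aestronglyMeasurable
  · rw [Complex.norm_exp_ofReal_mul_I]

/-- The characteristic function of a small multiple of a centred variable is, to third order, that
of a Gaussian with the same variance. -/
lemma norm_integral_cexp_sub_le {X : Ω → ℝ} {C : ℕ → ℝ} (hX : HasMoments μ X C)
    (h0 : ∫ ω, X ω ∂μ = 0) {c : ℝ} (hc0 : 0 ≤ c) (hc : c ≤ 1) :
    ‖∫ ω, Complex.exp ((c * X ω : ℝ) * Complex.I) ∂μ -
      (Real.exp (-(c ^ 2 * (∫ ω, X ω ^ 2 ∂μ) / 2)) : ℂ)‖ ≤ (4 * C 3 + C 2 ^ 2) * c ^ 3 := by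
  set v : ℝ := ∫ ω, X ω ^ 2 ∂μ with hv
  have hv0 : 0 ≤ v := integral_nonneg fun ω => sq_nonneg _
  have hvC : v ≤ C 2 := by simpa only [sq_abs] using hX.bound 2
  have i1 : Integrable (fun ω => ((c * X ω : ℝ) : ℂ)) μ := (hX.integrable.const_mul c).ofReal
  have i2 : Integrable (fun ω => (((c * X ω : ℝ) : ℂ)) ^ 2 / 2) μ := by
    have h1 : Integrable (fun ω => ((c ^ 2 / 2 * X ω ^ 2 : ℝ) : ℂ)) μ :=
      ((hX.integrable_pow 2).const_mul (c ^ 2 / 2)).ofReal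
    have h2 : (fun ω => (((c * X ω : ℝ) : ℂ)) ^ 2 / 2) =
        fun ω => ((c ^ 2 / 2 * X ω ^ 2 : ℝ) : ℂ) := by
      ext ω
      push_cast
      ring
    rw [h2]
    exact h1
  have i3 : Integrable (fun ω => (1 : ℂ) + (c * X ω : ℝ) * Complex.I) μ :=
    (integrable_const _).add (i1.mul_const _)
  have i4 : Integrable (fun ω => (1 : ℂ) + (c * X ω : ℝ) * Complex.I -
      (((c * X ω : ℝ) : ℂ)) ^ 2 / 2) μ := i3.sub i2
  have e1 : ∫ ω, ((1 : ℂ) + (c * X ω : ℝ) * Complex.I - (((c * X ω : ℝ) : ℂ)) ^ 2 / 2) ∂μ =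
      ((1 - c ^ 2 * v / 2 : ℝ) : ℂ) := by
    rw [integral_sub i3 i2, integral_add (integrable_const _) (i1.mul_const _),
      integral_mul_const, integral_complex_ofReal, integral_const_mul, h0]
    have : ∀ ω, (((c * X ω : ℝ) : ℂ)) ^ 2 / 2 = (((c ^ 2 / 2) * X ω ^ 2 : ℝ) : ℂ) := by
      intro ω; push_cast; ring
    simp_rw [this]
    rw [integral_complex_ofReal, integral_const_mul]
    simp only [integral_const, probReal_univ, one_smul]
    push_cast
    ring
  have e2 : ‖∫ ω, Complex.exp ((c * X ω : ℝ) * Complex.I) ∂μ - ((1 - c ^ 2 * v / 2 : ℝ) : ℂ)‖ ≤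
      4 * C 3 * c ^ 3 := by
    rw [← e1, ← integral_sub (integrable_cexp (hX.meas.const_mul c)) i4]
    refine (norm_integral_le_integral_norm _).trans ?_
    have hb : ∀ ω, ‖Complex.exp ((c * X ω : ℝ) * Complex.I) -
        (1 + (c * X ω : ℝ) * Complex.I - (((c * X ω : ℝ) : ℂ)) ^ 2 / 2)‖ ≤
        4 * c ^ 3 * |X ω| ^ 3 := by
      intro ω
      refine (norm_cexp_sub_taylor_le _).trans_eq ?_
      rw [abs_mul, abs_of_nonneg hc0]
      ring
    refine (integral_mono (((integrable_cexp (hX.meas.const_mul c)).sub i4).norm)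
      ((hX.int 3).const_mul _) hb).trans ?_
    rw [integral_const_mul]
    have := mul_le_mul_of_nonneg_left (hX.bound 3) (show 0 ≤ 4 * c ^ 3 by positivity)
    linarith
  have e3 : ‖((1 - c ^ 2 * v / 2 : ℝ) : ℂ) - (Real.exp (-(c ^ 2 * v / 2)) : ℂ)‖ ≤
      C 2 ^ 2 * c ^ 3 := by
    rw [← Complex.ofReal_sub, Complex.norm_real, Real.norm_eq_abs]
    refine (abs_one_sub_sub_exp_neg_le (by positivity)).trans ?_
    have h1 : c ^ 4 ≤ c ^ 3 := pow_le_pow_of_le_one hc0 hc (by norm_num)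
    have h2 : v ^ 2 ≤ C 2 ^ 2 := pow_le_pow_left₀ hv0 hvC 2
    have h3 : c ^ 4 * v ^ 2 ≤ c ^ 3 * C 2 ^ 2 :=
      mul_le_mul h1 h2 (by positivity) (by positivity)
    nlinarith [show 0 ≤ c ^ 4 * v ^ 2 by positivity]
  calc _ ≤ _ + _ := norm_sub_le_norm_sub_add_norm_sub _ ((1 - c ^ 2 * v / 2 : ℝ) : ℂ) _
    _ ≤ 4 * C 3 * c ^ 3 + C 2 ^ 2 * c ^ 3 := add_le_add e2 e3
    _ = _ := by ring

/-- The characteristic function of a normalized sum of independent centred variables is close to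
that of a Gaussian with the same variance. -/
lemma norm_charFun_normalized_sum_sub_le {κ : Type*} {X : κ → Ω → ℝ} {C : ℕ → ℝ}
    (hind : iIndepFun X μ) (hX : ∀ k, HasMoments μ (X k) C) (h0 : ∀ k, ∫ ω, X k ω ∂μ = 0)
    (s : Finset κ) (hs : s.Nonempty) :
    ‖∫ ω, Complex.exp (((1 / √(s.card : ℝ)) * ∑ k ∈ s, X k ω : ℝ) * Complex.I) ∂μ -
      (Real.exp (-((1 / (s.card : ℝ)) * (∑ k ∈ s, ∫ ω, X k ω ^ 2 ∂μ) / 2)) : ℂ)‖ ≤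
      (4 * C 3 + C 2 ^ 2) / √(s.card : ℝ) := by
  set N : ℝ := (s.card : ℝ) with hN
  have hN1 : 1 ≤ N := by
    rw [hN]
    exact_mod_cast hs.card_pos
  set c : ℝ := 1 / √N with hc
  have hsq : 1 ≤ √N := Real.one_le_sqrt.2 hN1
  have hc0 : 0 ≤ c := by positivity
  have hc1 : c ≤ 1 := by rw [hc]; exact (div_le_one (by positivity)).2 hsq
  have hc2 : c ^ 2 = 1 / N := by
    rw [hc, div_pow, Real.sq_sqrt (by linarith), one_pow]
  have e1 : ∫ ω, Complex.exp ((c * ∑ k ∈ s, X k ω : ℝ) * Complex.I) ∂μ =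
      ∏ k ∈ s, ∫ ω, Complex.exp ((c * X k ω : ℝ) * Complex.I) ∂μ := by
    have hi : iIndepFun (fun k : s => X k) μ := hind.precomp Subtype.val_injective
    have h1 := hi.integral_fun_prod_comp (𝕜 := ℂ) (fun k => (hX k).meas.aemeasurable)
      (f := fun _ t => Complex.exp ((c * t : ℝ) * Complex.I))
      (fun k => (Complex.measurable_exp.comp ((Complex.measurable_ofReal.comp
        (measurable_id.const_mul c)).mul_const _)).aestronglyMeasurable)
    rw [← Finset.prod_coe_sort s fun k => ∫ ω, Complex.exp ((c * X k ω : ℝ) * Complex.I) ∂μ, ← h1]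
    congr 1
    ext ω
    rw [Finset.prod_coe_sort s fun k => Complex.exp ((c * X k ω : ℝ) * Complex.I),
      ← Complex.exp_sum, Finset.mul_sum, Complex.ofReal_sum, Finset.sum_mul]
  have e2 : (Real.exp (-((1 / N) * (∑ k ∈ s, ∫ ω, X k ω ^ 2 ∂μ) / 2)) : ℂ) =
      ∏ k ∈ s, (Real.exp (-(c ^ 2 * (∫ ω, X k ω ^ 2 ∂μ) / 2)) : ℂ) := by
    rw [← Complex.ofReal_prod, ← Real.exp_sum, hc2]
    congr 2
    rw [Finset.mul_sum, Finset.sum_div, Finset.sum_neg_distrib]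
  rw [e1, e2]
  refine (norm_prod_sub_prod_le s (fun k _ => ?_) fun k _ => ?_).trans ?_
  · refine (norm_integral_le_integral_norm _).trans ?_
    simp_rw [Complex.norm_exp_ofReal_mul_I]
    simp
  · rw [Complex.norm_real, Real.norm_eq_abs, Real.abs_exp, Real.exp_le_one_iff]
    have : 0 ≤ ∫ ω, X k ω ^ 2 ∂μ := integral_nonneg fun ω => sq_nonneg _
    have : 0 ≤ c ^ 2 * (∫ ω, X k ω ^ 2 ∂μ) / 2 := by positivity
    linarith
  · refine (Finset.sum_le_sum fun k _ =>
      norm_integral_cexp_sub_le (hX k) (h0 k) hc0 hc1).trans_eq ?_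
    rw [Finset.sum_const, nsmul_eq_mul, ← hN]
    have : N * c ^ 3 = 1 / √N := by
      rw [pow_succ, hc2, hc]
      field_simp
    calc N * ((4 * C 3 + C 2 ^ 2) * c ^ 3) = (4 * C 3 + C 2 ^ 2) * (N * c ^ 3) := by ring
      _ = _ := by rw [this]; ring

/-- Adding a small perturbation changes a characteristic function little. -/
lemma norm_integral_cexp_add_sub_le {X Y : Ω → ℝ} {C : ℕ → ℝ} (hX : Measurable X)
    (hY : HasMoments μ Y C) :
    ‖∫ ω, Complex.exp ((X ω + Y ω : ℝ) * Complex.I) ∂μ -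
      ∫ ω, Complex.exp (X ω * Complex.I) ∂μ‖ ≤ ∫ ω, |Y ω| ∂μ := by
  have hXY : Measurable fun ω => X ω + Y ω := hX.add hY.meas
  rw [← integral_sub (integrable_cexp hXY) (integrable_cexp hX)]
  refine (norm_integral_le_integral_norm _).trans ?_
  refine integral_mono (((integrable_cexp hXY).sub (integrable_cexp hX)).norm)
    hY.integrable.abs fun ω => ?_
  have h1 : Complex.exp ((X ω + Y ω : ℝ) * Complex.I) - Complex.exp (X ω * Complex.I) =
      Complex.exp (X ω * Complex.I) * (Complex.exp (Complex.I * Y ω) - 1) := by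
    rw [mul_sub, ← Complex.exp_add, mul_one]
    push_cast
    ring_nf
  simp only [h1]
  rw [norm_mul, Complex.norm_exp_ofReal_mul_I, one_mul]
  exact Real.norm_exp_I_mul_ofReal_sub_one_le

end

/-- Two sequences of random variables whose joint characteristic functions converge to that of two
independent centred Gaussians converge jointly in distribution. -/
lemma tendsto_integral_pair {Ω : ℕ → Type*} [∀ n, MeasurableSpace (Ω n)]
    {μ : ∀ n, Measure (Ω n)} [∀ n, IsProbabilityMeasure (μ n)] {X Y : ∀ n, Ω n → ℝ}
    (hX : ∀ n, Measurable (X n)) (hY : ∀ n, Measurable (Y n)) {v : ℝ} (hv : 0 ≤ v)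
    (h : ∀ s t : ℝ, Tendsto (fun n =>
        ∫ ω, Complex.exp ((s * X n ω + t * Y n ω : ℝ) * Complex.I) ∂(μ n)) atTop
      (𝓝 (Real.exp (-((s ^ 2 + t ^ 2) * v / 2)) : ℂ)))
    (g : BoundedContinuousFunction (ℝ × ℝ) ℝ) :
    Tendsto (fun n => ∫ ω, g (X n ω, Y n ω) ∂(μ n)) atTop
      (𝓝 (∫ p, g p ∂((gaussianReal 0 v.toNNReal).prod (gaussianReal 0 v.toNNReal)))) := by
  have hm : ∀ n, Measurable fun ω => WithLp.toLp 2 (X n ω, Y n ω) := fun n =>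
    (WithLp.measurable_toLp 2 (ℝ × ℝ)).comp ((hX n).prodMk (hY n))
  have hm0 : Measurable (WithLp.toLp 2 : ℝ × ℝ → WithLp 2 (ℝ × ℝ)) := WithLp.measurable_toLp 2 _
  let ρ : ℕ → ProbabilityMeasure (WithLp 2 (ℝ × ℝ)) := fun n =>
    ⟨(μ n).map fun ω => WithLp.toLp 2 (X n ω, Y n ω),
      Measure.isProbabilityMeasure_map (hm n).aemeasurable⟩
  let ρ₀ : ProbabilityMeasure (WithLp 2 (ℝ × ℝ)) :=
    ⟨((gaussianReal 0 v.toNNReal).prod (gaussianReal 0 v.toNNReal)).map (WithLp.toLp 2),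
      Measure.isProbabilityMeasure_map hm0.aemeasurable⟩
  have hlim : Tendsto ρ atTop (𝓝 ρ₀) := by
    refine ProbabilityMeasure.tendsto_of_tendsto_charFun fun t => ?_
    have h1 : charFun (ρ₀ : Measure (WithLp 2 (ℝ × ℝ))) t =
        (Real.exp (-((t.fst ^ 2 + t.snd ^ 2) * v / 2)) : ℂ) := by
      show charFun (((gaussianReal 0 v.toNNReal).prod (gaussianReal 0 v.toNNReal)).map
        (WithLp.toLp 2)) t = _
      rw [charFun_prod, charFun_gaussianReal, charFun_gaussianReal, ← Complex.exp_add]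
      push_cast [Real.coe_toNNReal v hv]
      congr 1
      show _ = -((((t.ofLp.1 : ℝ) : ℂ) ^ 2 + ((t.ofLp.2 : ℝ) : ℂ) ^ 2) * (v : ℂ) / 2)
      ring
    have h2 : ∀ n, charFun (ρ n : Measure (WithLp 2 (ℝ × ℝ))) t =
        ∫ ω, Complex.exp ((t.fst * X n ω + t.snd * Y n ω : ℝ) * Complex.I) ∂(μ n) := by
      intro n
      show charFun ((μ n).map fun ω => WithLp.toLp 2 (X n ω, Y n ω)) t = _
      rw [charFun_apply, integral_map (hm n).aemeasurable]
      · rfl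
      · exact (Continuous.aestronglyMeasurable (by fun_prop))
    rw [h1]
    simp_rw [h2]
    exact h _ _
  rw [ProbabilityMeasure.tendsto_iff_forall_integral_tendsto] at hlim
  have hc : Continuous fun p : WithLp 2 (ℝ × ℝ) => WithLp.ofLp p := by fun_prop
  have h3 := hlim (g.compContinuous ⟨_, hc⟩)
  have h4 : ∀ n, ∫ p, (g.compContinuous ⟨_, hc⟩) p ∂(ρ n : Measure (WithLp 2 (ℝ × ℝ))) =
      ∫ ω, g (X n ω, Y n ω) ∂(μ n) := by
    intro n
    show ∫ p, (g.compContinuous ⟨_, hc⟩) p ∂((μ n).map fun ω => WithLp.toLp 2 (X n ω, Y n ω)) = _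
    rw [integral_map (hm n).aemeasurable]
    · rfl
    · exact (BoundedContinuousFunction.continuous _).aestronglyMeasurable
  have h5 : ∫ p, (g.compContinuous ⟨_, hc⟩) p ∂(ρ₀ : Measure (WithLp 2 (ℝ × ℝ))) =
      ∫ p, g p ∂((gaussianReal 0 v.toNNReal).prod (gaussianReal 0 v.toNNReal)) := by
    show ∫ p, (g.compContinuous ⟨_, hc⟩) p
      ∂(((gaussianReal 0 v.toNNReal).prod (gaussianReal 0 v.toNNReal)).map (WithLp.toLp 2)) = _
    rw [integral_map hm0.aemeasurable]
    · rfl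
    · exact (BoundedContinuousFunction.continuous _).aestronglyMeasurable
  rw [h5] at h3
  exact h3.congr h4

end MsgCSP

namespace MsgCSP

/-! ### Quantile coupling -/

section Quantile

variable {m γ : Measure ℝ} [IsProbabilityMeasure m] [IsProbabilityMeasure γ]

lemma continuous_cdf [NullSingletonClass m] : Continuous (cdf m) := by
  rw [continuous_iff_continuousAt]
  intro x
  rw [(monotone_cdf m).continuousAt_iff_leftLim_eq_rightLim, StieltjesFunction.rightLim_eq]
  have h1 := (cdf m).measure_singleton x
  rw [measure_cdf, measure_singleton, eq_comm, ENNReal.ofReal_eq_zero] at h1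
  exact le_antisymm ((monotone_cdf m).leftLim_le le_rfl) (by linarith)

lemma exists_cdf_eq [NullSingletonClass m] {q : ℝ} (hq : q ∈ Set.Ioo (0 : ℝ) 1) :
    ∃ t, cdf m t = q :=
  mem_range_of_exists_le_of_exists_ge continuous_cdf
    (((tendsto_cdf_atBot m).eventually (gt_mem_nhds hq.1)).exists.imp fun _ h => h.le)
    (((tendsto_cdf_atTop m).eventually (lt_mem_nhds hq.2)).exists.imp fun _ h => h.le)

/-- The distribution function of an atomless law is uniformly distributed under this law. -/
lemma measureReal_cdf_le [NullSingletonClass m] {q : ℝ} (hq : q ∈ Set.Ioo (0 : ℝ) 1) :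
    m.real {t | cdf m t ≤ q} = q := by
  obtain ⟨t, ht⟩ := exists_cdf_eq (m := m) hq
  refine le_antisymm (le_of_forall_gt_imp_ge_of_dense fun q' hq' => ?_) ?_
  · rcases lt_or_ge q' 1 with h1 | h1
    · obtain ⟨t', ht'⟩ := exists_cdf_eq (m := m) ⟨hq.1.trans hq', h1⟩
      have : {t | cdf m t ≤ q} ⊆ Set.Iic t' := by
        intro s hs
        by_contra h
        have := monotone_cdf m (not_le.1 h).le
        rw [Set.mem_ofPred_eq] at hs
        linarith
      rw [← ht', cdf_eq_real]
      exact measureReal_mono this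
    · exact (measureReal_le_one).trans h1
  · nth_rewrite 1 [← ht]
    rw [cdf_eq_real]
    exact measureReal_mono fun s hs => (monotone_cdf m hs).trans ht.le

lemma ae_cdf_mem_Ioo [NullSingletonClass m] : ∀ᵐ t ∂m, cdf m t ∈ Set.Ioo (0 : ℝ) 1 := by
  have hm : Measurable (cdf m) := (monotone_cdf m).measurable
  have h0 : m.real {t | cdf m t ≤ 0} = 0 := by
    refine le_antisymm (le_of_forall_gt_imp_ge_of_dense fun q hq => ?_) measureReal_nonneg
    rcases lt_or_ge q 1 with h1 | h1
    · rw [← measureReal_cdf_le (m := m) ⟨hq, h1⟩]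
      exact measureReal_mono fun s hs => le_trans hs hq.le
    · exact (measureReal_le_one).trans h1
  have h1 : m.real {t | cdf m t < 1} = 1 := by
    refine le_antisymm measureReal_le_one (le_of_forall_lt_imp_le_of_dense fun q hq => ?_)
    rcases lt_or_ge 0 q with h1 | h1
    · rw [← measureReal_cdf_le (m := m) ⟨h1, hq⟩]
      exact measureReal_mono fun s hs => lt_of_le_of_lt hs hq
    · exact h1.trans measureReal_nonneg
  have e0 : ∀ᵐ t ∂m, ¬ cdf m t ≤ 0 := by
    rw [ae_iff]
    simpa [measureReal_eq_zero_iff] using h0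
  have e1 : ∀ᵐ t ∂m, cdf m t < 1 :=
    (mem_ae_iff_prob_eq_one (measurableSet_lt hm measurable_const)).2
      ((ENNReal.toReal_eq_one_iff _).1 h1)
  filter_upwards [e0, e1] with t h0 h1 using ⟨not_le.1 h0, h1⟩

/-- The quantile function of `γ`, set to zero outside `(0, 1)`. -/
def quantile (γ : Measure ℝ) (q : ℝ) : ℝ :=
  open Classical in if q ∈ Set.Ioo (0 : ℝ) 1 then sInf {t | q ≤ cdf γ t} else 0

lemma quantile_le_iff [NullSingletonClass γ] {q : ℝ} (hq : q ∈ Set.Ioo (0 : ℝ) 1) (s : ℝ) :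
    quantile γ q ≤ s ↔ q ≤ cdf γ s := by
  rw [quantile, if_pos hq]
  set S := {t | q ≤ cdf γ t} with hS
  have hne : S.Nonempty := by
    obtain ⟨t, ht⟩ := exists_cdf_eq (m := γ) hq
    exact ⟨t, ht.ge⟩
  have hbdd : BddBelow S := by
    obtain ⟨t, ht⟩ := exists_cdf_eq (m := γ) (q := q / 2)
      ⟨by linarith [hq.1], by linarith [hq.1, hq.2]⟩
    refine ⟨t, fun s hs => le_of_not_gt fun h => ?_⟩
    have h1 := monotone_cdf γ h.le
    have h2 : q ≤ cdf γ s := hs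
    linarith [hq.1]
  have hcl : IsClosed S := isClosed_le continuous_const continuous_cdf
  constructor
  · intro h
    have h1 : q ≤ cdf γ (sInf S) := hcl.csInf_mem hne hbdd
    exact h1.trans (monotone_cdf γ h)
  · exact fun h => csInf_le hbdd h

lemma cdf_quantile [NullSingletonClass γ] {q : ℝ} (hq : q ∈ Set.Ioo (0 : ℝ) 1) :
    cdf γ (quantile γ q) = q := by
  refine le_antisymm ?_ ((quantile_le_iff hq _).1 le_rfl)
  obtain ⟨t, ht⟩ := exists_cdf_eq (m := γ) hq
  have := monotone_cdf γ ((quantile_le_iff hq t).2 ht.ge)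
  exact this.trans ht.le

lemma measurable_quantile [NullSingletonClass γ] : Measurable (quantile γ) := by
  refine measurable_of_Iic fun s => ?_
  have : quantile γ ⁻¹' Set.Iic s = (Set.Ioo (0 : ℝ) 1 ∩ Set.Iic (cdf γ s)) ∪
      ((Set.Ioo (0 : ℝ) 1)ᶜ ∩ {_q | (0 : ℝ) ≤ s}) := by
    ext q
    by_cases hq : q ∈ Set.Ioo (0 : ℝ) 1
    · simp only [Set.mem_preimage, Set.mem_Iic, quantile_le_iff hq, Set.mem_union, Set.mem_inter_iff,
        hq, Set.mem_compl_iff, not_true, true_and, false_and, or_false]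
    · simp only [Set.mem_preimage, Set.mem_Iic, Set.mem_union, Set.mem_inter_iff,
        hq, Set.mem_compl_iff, not_false_iff, true_and, false_and, false_or, Set.mem_ofPred_eq]
      rw [quantile, if_neg hq]
  rw [this]
  exact (measurableSet_Ioo.inter measurableSet_Iic).union
    (measurableSet_Ioo.compl.inter (MeasurableSet.const _))

/-- The increasing rearrangement carries `m` to `γ`. -/
lemma map_quantile_cdf [NullSingletonClass m] [NullSingletonClass γ] :
    m.map (fun t => quantile γ (cdf m t)) = γ := by
  have hm : Measurable fun t => quantile γ (cdf m t) :=
    measurable_quantile.comp (monotone_cdf m).measurable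
  have := Measure.isProbabilityMeasure_map (μ := m) hm.aemeasurable
  refine Measure.ext_of_Iic _ _ fun s => ?_
  rw [Measure.map_apply hm measurableSet_Iic]
  have h1 : m ((fun t => quantile γ (cdf m t)) ⁻¹' Set.Iic s) = m {t | cdf m t ≤ cdf γ s} := by
    refine measure_congr ?_
    filter_upwards [ae_cdf_mem_Ioo (m := m)] with t ht
    exact propext (quantile_le_iff ht s)
  rw [h1]
  rcases (cdf_nonneg γ s).eq_or_lt with h0 | h0
  · have h2 : γ (Set.Iic s) = 0 := by rw [← ofReal_cdf, ← h0, ENNReal.ofReal_zero]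
    rw [h2, ← h0]
    have := ae_cdf_mem_Ioo (m := m)
    rw [ae_iff] at this
    refine measure_mono_null ?_ this
    intro t ht h
    exact absurd h.1 (not_lt.2 ht)
  rcases (cdf_le_one γ s).eq_or_lt with h2 | h2
  · have h3 : γ (Set.Iic s) = 1 := by rw [← ofReal_cdf, h2, ENNReal.ofReal_one]
    rw [h3, h2]
    have : {t | cdf m t ≤ 1} = Set.univ := Set.eq_univ_of_forall fun t => cdf_le_one m t
    rw [this, measure_univ]
  · have h3 := measureReal_cdf_le (m := m) ⟨h0, h2⟩
    rw [← ofReal_cdf γ, ← ofReal_measureReal, h3]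

end Quantile

end MsgCSP

namespace MsgCSP

section Coupling

variable {V : Type*} [Fintype V] {P γ : Measure ℝ} [IsProbabilityMeasure P]
  [IsProbabilityMeasure γ] {A : Set V} {H : (V → ℝ) → ℝ}

open Classical in
/-- The embedding of `V` into two copies of itself that sends `A` to the second copy and its
complement to the first. -/
def resampleIndex (A : Set V) (v : V) : V ⊕ V := if v ∈ A then Sum.inr v else Sum.inl v

lemma resampleIndex_injective : Function.Injective (resampleIndex A) := by
  intro v w h
  simp only [resampleIndex] at h
  split_ifs at h <;> simpa using h

open Classical in
/-- The family `x` with its entries indexed by `A` replaced by those of `x'`. -/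
def merge (A : Set V) (x x' : V → ℝ) : V → ℝ := fun v => if v ∈ A then x' v else x v

lemma merge_apply_of_notMem {x x' : V → ℝ} {v : V} (hv : v ∉ A) : merge A x x' v = x v := if_neg hv

lemma merge_apply_of_mem {x x' : V → ℝ} {v : V} (hv : v ∈ A) : merge A x x' v = x' v := if_pos hv

lemma merge_merge (x x' x'' : V → ℝ) : merge A (merge A x x') x'' = merge A x x'' := by
  ext v
  by_cases hv : v ∈ A <;> simp [merge, hv]

lemma merge_eq_comp (p : (V → ℝ) × (V → ℝ)) : merge A p.1 p.2 =
    (MeasurableEquiv.sumPiEquivProdPi fun _ : V ⊕ V => ℝ).symm p ∘ resampleIndex A := by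
  ext v
  by_cases hv : v ∈ A <;> simp [merge, resampleIndex, hv, MeasurableEquiv.sumPiEquivProdPi]

variable (A) in
lemma measurable_merge : Measurable fun p : (V → ℝ) × (V → ℝ) => merge A p.1 p.2 := by
  simp only [merge_eq_comp]
  exact (Instance.measurable_comp_right _).comp (MeasurableEquiv.measurable _)

variable (A) in
lemma measurable_merge_right (x : V → ℝ) : Measurable fun x' : V → ℝ => merge A x x' :=
  (measurable_merge A).comp (measurable_const.prodMk measurable_id)

lemma measurable_comp_merge (hH : Measurable H) (x : V → ℝ) :
    Measurable fun x' : V → ℝ => H (merge A x x') :=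
  hH.comp (measurable_merge_right A x)

variable (A P) in
/-- Resampling some of the independent coordinates preserves their law. -/
lemma measurePreserving_merge : MeasurePreserving (fun p : (V → ℝ) × (V → ℝ) => merge A p.1 p.2)
    ((Measure.pi fun _ : V => P).prod (Measure.pi fun _ : V => P)) (Measure.pi fun _ : V => P) := by
  have h1 := measurePreserving_sumPiEquivProdPi_symm (fun _ : V ⊕ V => P)
  have h2 := (Instance.measurePreserving_comp (P := P) (resampleIndex_injective (A := A))).comp h1
  convert h2 using 1
  ext1 p
  exact merge_eq_comp p

variable (P A H) in
/-- The law of `H` given the coordinates of `x` outside `A`. -/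
abbrev resampleLaw (x : V → ℝ) : Measure ℝ :=
  (Measure.pi fun _ : V => P).map fun x' => H (merge A x x')

lemma isProbabilityMeasure_resampleLaw (hH : Measurable H) (x : V → ℝ) :
    IsProbabilityMeasure (resampleLaw P A H x) :=
  Measure.isProbabilityMeasure_map (measurable_comp_merge hH x).aemeasurable

lemma resampleLaw_merge (x x' : V → ℝ) :
    resampleLaw P A H (merge A x x') = resampleLaw P A H x := by
  simp only [resampleLaw, merge_merge]

lemma cdf_resampleLaw (hH : Measurable H) (x : V → ℝ) (t : ℝ) : cdf (resampleLaw P A H x) t =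
    (Measure.pi fun _ : V => P).real {x' | H (merge A x x') ≤ t} := by
  have := isProbabilityMeasure_resampleLaw (P := P) (A := A) hH x
  rw [cdf_eq_real, resampleLaw, map_measureReal_apply (measurable_comp_merge hH x) measurableSet_Iic]
  rfl

lemma measurable_cdf_resampleLaw (hH : Measurable H) :
    Measurable fun x => cdf (resampleLaw P A H x) (H x) := by
  simp only [cdf_resampleLaw hH, measureReal_def]
  refine Measurable.ennreal_toReal ?_
  have hs : MeasurableSet {p : (V → ℝ) × (V → ℝ) | H (merge A p.1 p.2) ≤ H p.1} :=
    measurableSet_le (hH.comp (measurable_merge A)) (hH.comp measurable_fst)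
  exact measurable_measure_prodMk_left (ν := Measure.pi fun _ : V => P) hs

variable (P γ A H) in
/-- The variable with law `γ`, independent of the coordinates outside `A`, that is the increasing
function of `H` given these coordinates. -/
def couple (x : V → ℝ) : ℝ := quantile γ (cdf (resampleLaw P A H x) (H x))

lemma measurable_couple [NullSingletonClass γ] (hH : Measurable H) :
    Measurable (couple P γ A H) :=
  measurable_quantile.comp (measurable_cdf_resampleLaw hH)

/-- The coupled variable has law `γ` and is independent of the coordinates outside `A`. -/
lemma measure_couple_inter [NullSingletonClass γ] (hH : Measurable H)
    (hat : ∀ x, NullSingletonClass (resampleLaw P A H x)) {B : Set ℝ} (hB : MeasurableSet B)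
    {C : Set (V → ℝ)} (hC : MeasurableSet C) (hCA : ∀ x x', merge A x x' ∈ C ↔ x ∈ C) :
    (Measure.pi fun _ : V => P) (couple P γ A H ⁻¹' B ∩ C) =
      γ B * (Measure.pi fun _ : V => P) C := by
  have hU := measurable_couple (P := P) (γ := γ) (A := A) hH
  have hm := measurePreserving_merge P A
  rw [← hm.measure_preimage ((hU hB).inter hC).nullMeasurableSet,
    Measure.prod_apply (hm.measurable ((hU hB).inter hC))]
  have key : ∀ x, (Measure.pi fun _ : V => P) (Prod.mk x ⁻¹'
      ((fun p : (V → ℝ) × (V → ℝ) => merge A p.1 p.2) ⁻¹' (couple P γ A H ⁻¹' B ∩ C))) =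
      C.indicator (fun _ => γ B) x := by
    intro x
    by_cases hx : x ∈ C
    · rw [Set.indicator_of_mem hx]
      have h1 : Prod.mk x ⁻¹' ((fun p : (V → ℝ) × (V → ℝ) => merge A p.1 p.2) ⁻¹'
          (couple P γ A H ⁻¹' B ∩ C)) = (fun x' => H (merge A x x')) ⁻¹'
            ((fun t => quantile γ (cdf (resampleLaw P A H x) t)) ⁻¹' B) := by
        ext x'
        simp only [Set.mem_preimage, Set.mem_inter_iff, hCA, hx, and_true, couple,
          resampleLaw_merge]
      have hp := isProbabilityMeasure_resampleLaw (P := P) (A := A) hH x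
      have ha := hat x
      have hq : Measurable fun t => quantile γ (cdf (resampleLaw P A H x) t) :=
        measurable_quantile.comp (monotone_cdf _).measurable
      rw [h1, ← Measure.map_apply (measurable_comp_merge hH x) (hq hB),
        ← Measure.map_apply hq hB, map_quantile_cdf]
    · rw [Set.indicator_of_notMem hx]
      have h1 : Prod.mk x ⁻¹' ((fun p : (V → ℝ) × (V → ℝ) => merge A p.1 p.2) ⁻¹'
          (couple P γ A H ⁻¹' B ∩ C)) = ∅ := by
        ext x'
        simp [hCA, hx]
      rw [h1, measure_empty]
  simp_rw [key]
  rw [lintegral_indicator hC, setLIntegral_const]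

lemma map_couple [NullSingletonClass γ] (hH : Measurable H)
    (hat : ∀ x, NullSingletonClass (resampleLaw P A H x)) :
    (Measure.pi fun _ : V => P).map (couple P γ A H) = γ := by
  ext B hB
  rw [Measure.map_apply (measurable_couple hH) hB]
  have := measure_couple_inter (P := P) (γ := γ) hH hat hB MeasurableSet.univ fun _ _ => by simp
  simpa using this

lemma ae_cdf_resampleLaw_mem_Ioo (hH : Measurable H)
    (hat : ∀ x, NullSingletonClass (resampleLaw P A H x)) :
    ∀ᵐ x ∂(Measure.pi fun _ : V => P), cdf (resampleLaw P A H x) (H x) ∈ Set.Ioo (0 : ℝ) 1 := by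
  have hm := measurePreserving_merge P A
  have hs : MeasurableSet {x | cdf (resampleLaw P A H x) (H x) ∈ Set.Ioo (0 : ℝ) 1} :=
    measurable_cdf_resampleLaw hH measurableSet_Ioo
  rw [← hm.map_eq, ae_map_iff hm.measurable.aemeasurable hs]
  refine (Measure.ae_prod_iff_ae_ae (hm.measurable hs)).2 (ae_of_all _ fun x => ?_)
  have hp := isProbabilityMeasure_resampleLaw (P := P) (A := A) hH x
  have ha := hat x
  have h1 := ae_of_ae_map (measurable_comp_merge hH x).aemeasurable
    (ae_cdf_mem_Ioo (m := resampleLaw P A H x))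
  filter_upwards [h1] with x' hx'
  simpa only [resampleLaw_merge] using hx'

lemma abs_cdf_le_one (t : ℝ) : |cdf γ t| ≤ 1 := by
  rw [abs_of_nonneg (cdf_nonneg γ t)]
  exact cdf_le_one γ t

/-- Since the distribution function of `γ` at the coupled variable is the conditional probability
that the resampled version of `H` is at most `H`, its correlation with a function of `H` is an
expectation over the pair of `H` and its resampled version. -/
lemma integral_cdf_couple_mul [NullSingletonClass γ] (hH : Measurable H)
    (hat : ∀ x, NullSingletonClass (resampleLaw P A H x)) :
    ∫ x, cdf γ (couple P γ A H x) * cdf γ (H x) ∂(Measure.pi fun _ : V => P) =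
      ∫ p : (V → ℝ) × (V → ℝ), {p : (V → ℝ) × (V → ℝ) | H (merge A p.1 p.2) ≤ H p.1}.indicator
        (fun p => cdf γ (H p.1)) p
        ∂((Measure.pi fun _ : V => P).prod (Measure.pi fun _ : V => P)) := by
  have hΦ : Measurable (cdf γ) := (monotone_cdf γ).measurable
  have hs : MeasurableSet {p : (V → ℝ) × (V → ℝ) | H (merge A p.1 p.2) ≤ H p.1} :=
    measurableSet_le (hH.comp (measurable_merge A)) (hH.comp measurable_fst)
  rw [integral_prod]
  · refine integral_congr_ae ?_
    filter_upwards [ae_cdf_resampleLaw_mem_Ioo (P := P) hH hat] with x hx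
    have h1 : ∀ y : V → ℝ, {p : (V → ℝ) × (V → ℝ) | H (merge A p.1 p.2) ≤ H p.1}.indicator
        (fun p => cdf γ (H p.1)) (x, y) =
        {x' | H (merge A x x') ≤ H x}.indicator (fun _ => cdf γ (H x)) y := fun y => rfl
    have hs' : MeasurableSet {x' | H (merge A x x') ≤ H x} :=
      measurableSet_le (measurable_comp_merge hH x) measurable_const
    simp_rw [h1]
    rw [integral_indicator_const _ hs', couple, cdf_quantile hx, cdf_resampleLaw hH, smul_eq_mul]
  · refine (integrable_const (1 : ℝ)).mono'
      ((hΦ.comp (hH.comp measurable_fst)).indicator hs).aestronglyMeasurable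
      (ae_of_all _ fun p => ?_)
    refine (norm_indicator_le_norm_self _ _).trans ?_
    exact abs_cdf_le_one _

/-- Continuous functions that increase to the indicator function of `0 < t`. -/
def ramp (k : ℕ) (t : ℝ) : ℝ := min 1 (max 0 (k * t))

lemma continuous_ramp (k : ℕ) : Continuous (ramp k) := by unfold ramp; fun_prop

lemma ramp_nonneg (k : ℕ) (t : ℝ) : 0 ≤ ramp k t := le_min zero_le_one (le_max_left _ _)

lemma ramp_le_one (k : ℕ) (t : ℝ) : ramp k t ≤ 1 := min_le_left _ _

lemma ramp_of_nonpos (k : ℕ) {t : ℝ} (ht : t ≤ 0) : ramp k t = 0 := by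
  rw [ramp, max_eq_left (mul_nonpos_of_nonneg_of_nonpos (by positivity) ht)]
  simp

lemma tendsto_ramp {t : ℝ} (ht : 0 < t) : Tendsto (fun k => ramp k t) atTop (𝓝 1) := by
  obtain ⟨N, hN⟩ := exists_nat_gt (1 / t)
  refine tendsto_const_nhds.congr' ?_
  filter_upwards [eventually_ge_atTop N] with k hk
  have h1 : 1 / t < k := hN.trans_le (by exact_mod_cast hk)
  rw [div_lt_iff₀ ht] at h1
  rw [ramp, min_eq_left]
  exact h1.le.trans (le_max_right _ _)

/-- For independent `x` and `y` of law `γ`, the expectation of `Φ(x)` on `y < x` is that of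
`Φ(x) ^ 2`, where `Φ` is the distribution function. -/
lemma tendsto_integral_ramp_mul_cdf [NullSingletonClass γ] :
    Tendsto (fun k => ∫ p : ℝ × ℝ, ramp k (p.1 - p.2) * cdf γ p.1 ∂(γ.prod γ)) atTop
      (𝓝 (∫ t, cdf γ t ^ 2 ∂γ)) := by
  have hΦ : Measurable (cdf γ) := (monotone_cdf γ).measurable
  have hs : MeasurableSet {p : ℝ × ℝ | p.2 < p.1} := measurableSet_lt measurable_snd measurable_fst
  have h1 : ∫ p : ℝ × ℝ, {p : ℝ × ℝ | p.2 < p.1}.indicator (fun p => cdf γ p.1) p ∂(γ.prod γ) =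
      ∫ t, cdf γ t ^ 2 ∂γ := by
    rw [integral_prod]
    · congr 1
      ext x
      have h2 : ∀ y, {p : ℝ × ℝ | p.2 < p.1}.indicator (fun p => cdf γ p.1) (x, y) =
          (Set.Iio x).indicator (fun _ => cdf γ x) y := fun y => rfl
      simp_rw [h2]
      rw [integral_indicator_const _ measurableSet_Iio, smul_eq_mul, sq]
      congr 1
      rw [cdf_eq_real]
      exact measureReal_congr Iio_ae_eq_Iic
    · refine (integrable_const (1 : ℝ)).mono'
        ((hΦ.comp measurable_fst).indicator hs).aestronglyMeasurable (ae_of_all _ fun p => ?_)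
      exact (norm_indicator_le_norm_self _ _).trans (abs_cdf_le_one _)
  rw [← h1]
  refine tendsto_integral_of_dominated_convergence (fun _ => (1 : ℝ)) (fun k => ?_)
    (integrable_const _) (fun k => ae_of_all _ fun p => ?_) (ae_of_all _ fun p => ?_)
  · exact (((continuous_ramp k).measurable.comp (measurable_fst.sub measurable_snd)).mul
      (hΦ.comp measurable_fst)).aestronglyMeasurable
  · rw [norm_mul, Real.norm_of_nonneg (ramp_nonneg _ _)]
    exact mul_le_one₀ (ramp_le_one _ _) (norm_nonneg _) (abs_cdf_le_one _)
  · by_cases hp : p.2 < p.1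
    · rw [Set.indicator_of_mem (show p ∈ {p : ℝ × ℝ | p.2 < p.1} from hp)]
      simpa using (tendsto_ramp (sub_pos.2 hp)).mul_const (cdf γ p.1)
    · rw [Set.indicator_of_notMem (show p ∉ {p : ℝ × ℝ | p.2 < p.1} from hp)]
      simp [ramp_of_nonpos _ (sub_nonpos.2 (not_lt.1 hp))]

end Coupling

/-- If `H` and its resampled version are asymptotically independent with law `γ`, then `H` is
close to the coupled variable of law `γ`. -/
lemma tendsto_integral_cdf_couple_sub_sq {V : ℕ → Type*} [∀ n, Fintype (V n)] {P γ : Measure ℝ}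
    [IsProbabilityMeasure P] [IsProbabilityMeasure γ] [NullSingletonClass γ]
    {A : ∀ n, Set (V n)} {H : ∀ n, (V n → ℝ) → ℝ} (hH : ∀ n, Measurable (H n))
    (hat : ∀ n x, NullSingletonClass (resampleLaw P (A n) (H n) x))
    (hlim : ∀ g : BoundedContinuousFunction (ℝ × ℝ) ℝ, Tendsto (fun n =>
      ∫ p : (V n → ℝ) × (V n → ℝ), g (H n p.1, H n (merge (A n) p.1 p.2))
        ∂((Measure.pi fun _ : V n => P).prod (Measure.pi fun _ : V n => P))) atTop
      (𝓝 (∫ p, g p ∂(γ.prod γ)))) :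
    Tendsto (fun n => ∫ x, (cdf γ (couple P γ (A n) (H n) x) - cdf γ (H n x)) ^ 2
      ∂(Measure.pi fun _ : V n => P)) atTop (𝓝 0) := by
  have hΦ : Measurable (cdf γ) := (monotone_cdf γ).measurable
  set c : ℝ := ∫ t, cdf γ t ^ 2 ∂γ with hc
  let g₀ : BoundedContinuousFunction (ℝ × ℝ) ℝ := BoundedContinuousFunction.ofNormedAddCommGroup
    (fun p => cdf γ p.1 ^ 2) ((continuous_cdf.comp continuous_fst).pow 2) 1 fun p => by
      rw [norm_pow]
      exact pow_le_one₀ (norm_nonneg _) (abs_cdf_le_one _)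
  let g : ℕ → BoundedContinuousFunction (ℝ × ℝ) ℝ := fun k =>
    BoundedContinuousFunction.ofNormedAddCommGroup (fun p => ramp k (p.1 - p.2) * cdf γ p.1)
      (((continuous_ramp k).comp (continuous_fst.sub continuous_snd)).mul
        (continuous_cdf.comp continuous_fst)) 1 fun p => by
      rw [norm_mul, Real.norm_of_nonneg (ramp_nonneg _ _)]
      exact mul_le_one₀ (ramp_le_one _ _) (norm_nonneg _) (abs_cdf_le_one _)
  have e0 : ∫ p, g₀ p ∂(γ.prod γ) = c := by
    show ∫ p : ℝ × ℝ, cdf γ p.1 ^ 2 ∂(γ.prod γ) = c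
    rw [integral_fun_fst (fun t => cdf γ t ^ 2)]
    simp [hc]
  have e1 : ∀ n, ∫ p : (V n → ℝ) × (V n → ℝ), g₀ (H n p.1, H n (merge (A n) p.1 p.2))
      ∂((Measure.pi fun _ : V n => P).prod (Measure.pi fun _ : V n => P)) =
      ∫ x, cdf γ (H n x) ^ 2 ∂(Measure.pi fun _ : V n => P) := by
    intro n
    show ∫ p : (V n → ℝ) × (V n → ℝ), cdf γ (H n p.1) ^ 2
      ∂((Measure.pi fun _ : V n => P).prod (Measure.pi fun _ : V n => P)) = _
    rw [integral_fun_fst (fun x => cdf γ (H n x) ^ 2)]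
    simp
  -- With `Φ` the distribution function of `γ` and `c` the second moment of a uniform variable, the
  -- square expands into `E Φ(U)² = c`, the cross term, and `E Φ(H)² → c`. The cross term is bounded
  -- below by its continuous minorant, whose limit is again close to `c`.
  have hle : ∀ n k, ∫ x, (cdf γ (couple P γ (A n) (H n) x) - cdf γ (H n x)) ^ 2
      ∂(Measure.pi fun _ : V n => P) ≤
      c - 2 * ∫ p : (V n → ℝ) × (V n → ℝ), g k (H n p.1, H n (merge (A n) p.1 p.2))
        ∂((Measure.pi fun _ : V n => P).prod (Measure.pi fun _ : V n => P)) +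
      ∫ p : (V n → ℝ) × (V n → ℝ), g₀ (H n p.1, H n (merge (A n) p.1 p.2))
        ∂((Measure.pi fun _ : V n => P).prod (Measure.pi fun _ : V n => P)) := by
    intro n k
    have hU : Measurable (couple P γ (A n) (H n)) := measurable_couple (hH n)
    have hbd : ∀ {X : (V n → ℝ) → ℝ}, Measurable X → (∀ x, |X x| ≤ 1) →
        Integrable X (Measure.pi fun _ : V n => P) := fun hX hb =>
      (integrable_const (1 : ℝ)).mono' hX.aestronglyMeasurable (ae_of_all _ hb)
    have i1 : Integrable (fun x => cdf γ (couple P γ (A n) (H n) x) ^ 2)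
        (Measure.pi fun _ : V n => P) := hbd ((hΦ.comp hU).pow_const 2) fun x => by
      rw [abs_pow]; exact pow_le_one₀ (abs_nonneg _) (abs_cdf_le_one _)
    have i2 : Integrable (fun x => cdf γ (H n x) ^ 2)
        (Measure.pi fun _ : V n => P) := hbd ((hΦ.comp (hH n)).pow_const 2) fun x => by
      rw [abs_pow]; exact pow_le_one₀ (abs_nonneg _) (abs_cdf_le_one _)
    have i3 : Integrable (fun x => cdf γ (couple P γ (A n) (H n) x) * cdf γ (H n x))
        (Measure.pi fun _ : V n => P) := hbd ((hΦ.comp hU).mul (hΦ.comp (hH n))) fun x => by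
      rw [abs_mul]
      exact mul_le_one₀ (abs_cdf_le_one _) (abs_nonneg _) (abs_cdf_le_one _)
    have s1 : ∫ x, (cdf γ (couple P γ (A n) (H n) x) - cdf γ (H n x)) ^ 2
        ∂(Measure.pi fun _ : V n => P) =
        ∫ x, cdf γ (couple P γ (A n) (H n) x) ^ 2 ∂(Measure.pi fun _ : V n => P) -
        2 * ∫ x, cdf γ (couple P γ (A n) (H n) x) * cdf γ (H n x) ∂(Measure.pi fun _ : V n => P) +
        ∫ x, cdf γ (H n x) ^ 2 ∂(Measure.pi fun _ : V n => P) := by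
      have i4 := i3.const_mul 2
      have i5 : Integrable (fun x => cdf γ (couple P γ (A n) (H n) x) ^ 2 -
        2 * (cdf γ (couple P γ (A n) (H n) x) * cdf γ (H n x)))
          (Measure.pi fun _ : V n => P) := i1.sub i4
      rw [← integral_const_mul, ← integral_sub i1 i4, ← integral_add i5 i2]
      congr 1
      ext x
      ring
    have s2 : ∫ x, cdf γ (couple P γ (A n) (H n) x) ^ 2 ∂(Measure.pi fun _ : V n => P) = c := by
      have h1 := integral_map (μ := Measure.pi fun _ : V n => P) hU.aemeasurable
        (f := fun t => cdf γ t ^ 2) (hΦ.pow_const 2).aestronglyMeasurable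
      rw [map_couple (hH n) (hat n)] at h1
      exact h1.symm
    have s3 : ∫ p : (V n → ℝ) × (V n → ℝ), g k (H n p.1, H n (merge (A n) p.1 p.2))
        ∂((Measure.pi fun _ : V n => P).prod (Measure.pi fun _ : V n => P)) ≤
        ∫ x, cdf γ (couple P γ (A n) (H n) x) * cdf γ (H n x) ∂(Measure.pi fun _ : V n => P) := by
      rw [integral_cdf_couple_mul (hH n) (hat n)]
      have hs : MeasurableSet {p : (V n → ℝ) × (V n → ℝ) | H n (merge (A n) p.1 p.2) ≤ H n p.1} :=
        measurableSet_le ((hH n).comp (measurable_merge (A n))) ((hH n).comp measurable_fst)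
      have hm1 : Measurable fun p : (V n → ℝ) × (V n → ℝ) =>
          g k (H n p.1, H n (merge (A n) p.1 p.2)) :=
        (g k).continuous.measurable.comp
          (((hH n).comp measurable_fst).prodMk ((hH n).comp (measurable_merge (A n))))
      refine integral_mono ?_ ?_ fun p => ?_
      · exact (integrable_const ‖g k‖).mono' hm1.aestronglyMeasurable
          (ae_of_all _ fun p => (g k).norm_coe_le_norm _)
      · refine (integrable_const (1 : ℝ)).mono'
          ((hΦ.comp ((hH n).comp measurable_fst)).indicator hs).aestronglyMeasurable
          (ae_of_all _ fun p => ?_)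
        exact (norm_indicator_le_norm_self _ _).trans (abs_cdf_le_one _)
      · show ramp k (H n p.1 - H n (merge (A n) p.1 p.2)) * cdf γ (H n p.1) ≤ _
        by_cases hp : H n (merge (A n) p.1 p.2) ≤ H n p.1
        · rw [Set.indicator_of_mem (show p ∈ {p : (V n → ℝ) × (V n → ℝ) |
            H n (merge (A n) p.1 p.2) ≤ H n p.1} from hp)]
          exact mul_le_of_le_one_left (cdf_nonneg _ _) (ramp_le_one _ _)
        · rw [Set.indicator_of_notMem (show p ∉ {p : (V n → ℝ) × (V n → ℝ) |
            H n (merge (A n) p.1 p.2) ≤ H n p.1} from hp),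
            ramp_of_nonpos _ (sub_nonpos.2 (not_le.1 hp).le), zero_mul]
    rw [s1, s2, e1]
    linarith
  have hnn : ∀ n, 0 ≤ ∫ x, (cdf γ (couple P γ (A n) (H n) x) - cdf γ (H n x)) ^ 2
      ∂(Measure.pi fun _ : V n => P) := fun n => integral_nonneg fun x => sq_nonneg _
  have hbound : ∀ k, Tendsto (fun n => c -
      2 * ∫ p : (V n → ℝ) × (V n → ℝ), g k (H n p.1, H n (merge (A n) p.1 p.2))
        ∂((Measure.pi fun _ : V n => P).prod (Measure.pi fun _ : V n => P)) +
      ∫ p : (V n → ℝ) × (V n → ℝ), g₀ (H n p.1, H n (merge (A n) p.1 p.2))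
        ∂((Measure.pi fun _ : V n => P).prod (Measure.pi fun _ : V n => P))) atTop
      (𝓝 (c - 2 * ∫ p, g k p ∂(γ.prod γ) + c)) := by
    intro k
    have := hlim g₀
    rw [e0] at this
    exact (tendsto_const_nhds.sub ((hlim (g k)).const_mul 2)).add this
  have hk : Tendsto (fun k => c - 2 * ∫ p, g k p ∂(γ.prod γ) + c) atTop (𝓝 0) := by
    have h1 : Tendsto (fun k => ∫ p, g k p ∂(γ.prod γ)) atTop (𝓝 c) :=
      tendsto_integral_ramp_mul_cdf
    have h2 := (tendsto_const_nhds (x := c)).sub (h1.const_mul 2) |>.add_const c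
    have h3 : c - 2 * c + c = 0 := by ring
    rwa [h3] at h2
  rw [Metric.tendsto_atTop]
  intro ε hε
  obtain ⟨k, hk'⟩ := (hk.eventually (gt_mem_nhds hε)).exists
  obtain ⟨N, hN⟩ := eventually_atTop.1 ((hbound k).eventually (gt_mem_nhds hk'))
  refine ⟨N, fun n hn => ?_⟩
  rw [Real.dist_eq, sub_zero, abs_of_nonneg (hnn n)]
  exact (hle n k).trans_lt (hN n hn)

end MsgCSP

namespace MsgCSP

open scoped NNReal

/-! ### From distribution functions to moments -/

/-- On `[-M, M]` the Gaussian distribution function has slope at least its density at `M`. -/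
lemma mul_sub_le_cdf_sub {v : ℝ≥0} (hv : v ≠ 0) {M s u : ℝ} (hs : |s| ≤ M) (hu : |u| ≤ M)
    (hsu : s ≤ u) : gaussianPDFReal 0 v M * (u - s) ≤
      cdf (gaussianReal 0 v) u - cdf (gaussianReal 0 v) s := by
  have h1 := (cdf (gaussianReal 0 v)).measure_Ioc s u
  rw [measure_cdf, gaussianReal_apply_eq_integral 0 hv,
    ENNReal.ofReal_eq_ofReal_iff (setIntegral_nonneg measurableSet_Ioc fun x _ =>
      gaussianPDFReal_nonneg _ _ _) (sub_nonneg.2 (monotone_cdf _ hsu))] at h1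
  rw [← h1]
  have h2 := setIntegral_ge_of_const_le_real (μ := volume) (s := Set.Ioc s u)
    (f := gaussianPDFReal 0 v) (c := gaussianPDFReal 0 v M) measurableSet_Ioc (by simp)
    (fun x hx => ?_) (integrable_gaussianPDFReal 0 v).integrableOn
  · rwa [Real.volume_real_Ioc_of_le hsu] at h2
  · have hx' : |x| ≤ M := abs_le.2
      ⟨(abs_le.1 hs).1.trans hx.1.le, hx.2.trans (abs_le.1 hu).2⟩
    have hx2 : x ^ 2 ≤ M ^ 2 := sq_le_sq' (abs_le.1 hx').1 (abs_le.1 hx').2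
    simp only [gaussianPDFReal, sub_zero]
    refine mul_le_mul_of_nonneg_left (Real.exp_le_exp.2 ?_) (by positivity)
    exact div_le_div_of_nonneg_right (by linarith) (by positivity)

lemma mul_abs_sub_le_abs_cdf_sub {v : ℝ≥0} (hv : v ≠ 0) {M s u : ℝ} (hs : |s| ≤ M)
    (hu : |u| ≤ M) : gaussianPDFReal 0 v M * |u - s| ≤
      |cdf (gaussianReal 0 v) u - cdf (gaussianReal 0 v) s| := by
  rcases le_total s u with h | h
  · rw [abs_of_nonneg (sub_nonneg.2 h)]
    exact (mul_sub_le_cdf_sub hv hs hu h).trans (le_abs_self _)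
  · rw [abs_sub_comm, abs_of_nonneg (sub_nonneg.2 h), abs_sub_comm (cdf _ _)]
    exact (mul_sub_le_cdf_sub hv hu hs h).trans (le_abs_self _)

/-- Real numbers with close values of the Gaussian distribution function are close, unless one of
them is large. -/
lemma exists_abs_sub_pow_le {v : ℝ≥0} (hv : v ≠ 0) {q : ℕ} (hq : 2 ≤ q) {M : ℝ} (hM : 0 < M) :
    ∃ C : ℝ, 0 ≤ C ∧ ∀ u s : ℝ, |u - s| ^ q ≤
      C * (cdf (gaussianReal 0 v) u - cdf (gaussianReal 0 v) s) ^ 2 +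
        2 ^ (q + 1) / M * (|u| ^ (q + 1) + |s| ^ (q + 1)) := by
  set c := gaussianPDFReal 0 v M with hc
  have hc0 : 0 < c := gaussianPDFReal_pos 0 v M hv
  refine ⟨(2 * M) ^ (q - 2) / c ^ 2, by positivity, fun u s => ?_⟩
  by_cases h : |u| ≤ M ∧ |s| ≤ M
  · have h1 := mul_abs_sub_le_abs_cdf_sub hv h.2 h.1
    have h2 : |u - s| ≤ 2 * M := (abs_sub _ _).trans (by linarith [h.1, h.2])
    have h3 : |u - s| ^ 2 ≤ (cdf (gaussianReal 0 v) u - cdf (gaussianReal 0 v) s) ^ 2 / c ^ 2 := by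
      rw [le_div_iff₀ (by positivity), ← sq_abs (cdf _ _ - _), ← mul_pow, mul_comm]
      exact pow_le_pow_left₀ (by positivity) h1 2
    have h4 : |u - s| ^ q = |u - s| ^ (q - 2) * |u - s| ^ 2 := by
      rw [← pow_add]; congr 1; omega
    have h5 : |u - s| ^ (q - 2) ≤ (2 * M) ^ (q - 2) := pow_le_pow_left₀ (abs_nonneg _) h2 _
    have h6 : (0 : ℝ) ≤ 2 ^ (q + 1) / M * (|u| ^ (q + 1) + |s| ^ (q + 1)) := by positivity
    rw [h4]
    have h7 := mul_le_mul h5 h3 (by positivity) (by positivity)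
    calc _ ≤ _ := h7
      _ = (2 * M) ^ (q - 2) / c ^ 2 *
          (cdf (gaussianReal 0 v) u - cdf (gaussianReal 0 v) s) ^ 2 := by ring
      _ ≤ _ := by linarith
  · have h1 : M ≤ max |u| |s| := by
      by_contra! h'
      exact h ⟨(le_max_left _ _).trans h'.le, (le_max_right _ _).trans h'.le⟩
    set T := max |u| |s| with hT
    have hT0 : 0 ≤ T := hM.le.trans h1
    have h2 : |u - s| ≤ 2 * T :=
      (abs_sub _ _).trans (by linarith [le_max_left |u| |s|, le_max_right |u| |s|])
    have h3 : |u - s| ^ q ≤ 2 ^ q * T ^ q := by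
      rw [← mul_pow]; exact pow_le_pow_left₀ (abs_nonneg _) h2 q
    have h4 : T ^ q ≤ T ^ (q + 1) / M := by
      rw [le_div_iff₀ hM, pow_succ]
      exact mul_le_mul_of_nonneg_left h1 (by positivity)
    have h5 : T ^ (q + 1) ≤ |u| ^ (q + 1) + |s| ^ (q + 1) := by
      rcases max_choice |u| |s| with h' | h' <;> rw [hT, h']
      · linarith [pow_nonneg (abs_nonneg s) (q + 1)]
      · linarith [pow_nonneg (abs_nonneg u) (q + 1)]
    have h6 : 0 ≤ (2 * M) ^ (q - 2) / c ^ 2 *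
        (cdf (gaussianReal 0 v) u - cdf (gaussianReal 0 v) s) ^ 2 := by positivity
    calc |u - s| ^ q ≤ 2 ^ q * (T ^ (q + 1) / M) :=
          h3.trans (mul_le_mul_of_nonneg_left h4 (by positivity))
      _ ≤ 2 ^ (q + 1) * ((|u| ^ (q + 1) + |s| ^ (q + 1)) / M) := by
          gcongr
          · norm_num
          · omega
      _ = 2 ^ (q + 1) / M * (|u| ^ (q + 1) + |s| ^ (q + 1)) := by ring
      _ ≤ _ := by linarith

section

variable {Ω : ℕ → Type*} [∀ n, MeasurableSpace (Ω n)] {μ : ∀ n, Measure (Ω n)}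
  [∀ n, IsProbabilityMeasure (μ n)]

/-- Convergence of Gaussian distribution functions in mean square gives convergence in all moments,
when the moments are bounded. -/
lemma tendsto_integral_abs_sub_pow {v : ℝ≥0} (hv : v ≠ 0) {U H : ∀ n, Ω n → ℝ} {C D : ℕ → ℝ}
    (hU : ∀ n, HasMoments (μ n) (U n) C) (hH : ∀ n, HasMoments (μ n) (H n) D)
    (h : Tendsto (fun n => ∫ ω, (cdf (gaussianReal 0 v) (U n ω) -
      cdf (gaussianReal 0 v) (H n ω)) ^ 2 ∂(μ n)) atTop (𝓝 0)) {q : ℕ} (hq : 2 ≤ q) :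
    Tendsto (fun n => ∫ ω, |U n ω - H n ω| ^ q ∂(μ n)) atTop (𝓝 0) := by
  have hB0 : 0 ≤ C (q + 1) + D (q + 1) := add_nonneg ((hU 0).nonneg _) ((hH 0).nonneg _)
  set B := C (q + 1) + D (q + 1) with hB
  have hΦ : Measurable (cdf (gaussianReal 0 v)) := (monotone_cdf _).measurable
  rw [Metric.tendsto_atTop]
  intro ε hε
  obtain ⟨A, hA0, hA⟩ := exists_abs_sub_pow_le hv hq
    (M := 2 ^ (q + 1) * (B + 1) / (ε / 2)) (by positivity)
  have hev := (h.const_mul A).eventually (gt_mem_nhds (show A * 0 < ε / 2 by simpa using half_pos hε))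
  obtain ⟨N, hN⟩ := eventually_atTop.1 hev
  refine ⟨N, fun n hn => ?_⟩
  rw [Real.dist_eq, sub_zero, abs_of_nonneg (integral_nonneg fun ω => by positivity)]
  have i1 : Integrable (fun ω => A * (cdf (gaussianReal 0 v) (U n ω) -
      cdf (gaussianReal 0 v) (H n ω)) ^ 2) (μ n) := by
    refine Integrable.const_mul ?_ A
    refine (integrable_const (1 : ℝ)).mono' (((hΦ.comp (hU n).meas).sub
      (hΦ.comp (hH n).meas)).pow_const 2).aestronglyMeasurable (ae_of_all _ fun ω => ?_)
    rw [norm_pow]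
    refine pow_le_one₀ (norm_nonneg _) ?_
    rw [Real.norm_eq_abs, abs_le]
    constructor <;>
      linarith [cdf_nonneg (gaussianReal 0 v) (U n ω), cdf_nonneg (gaussianReal 0 v) (H n ω),
        cdf_le_one (gaussianReal 0 v) (U n ω), cdf_le_one (gaussianReal 0 v) (H n ω)]
  set κ : ℝ := 2 ^ (q + 1) / (2 ^ (q + 1) * (B + 1) / (ε / 2)) with hκ
  have hκ' : κ = ε / 2 / (B + 1) := by rw [hκ]; field_simp
  have i2 : Integrable (fun ω => κ * (|U n ω| ^ (q + 1) + |H n ω| ^ (q + 1))) (μ n) :=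
    (((hU n).int _).add ((hH n).int _)).const_mul κ
  have h1 : ∫ ω, |U n ω - H n ω| ^ q ∂(μ n) ≤
      A * ∫ ω, (cdf (gaussianReal 0 v) (U n ω) - cdf (gaussianReal 0 v) (H n ω)) ^ 2 ∂(μ n) +
        κ * B := by
    refine (integral_mono (((hU n).sub (hH n)).int q) (i1.add i2) fun ω => hA _ _).trans ?_
    simp only [Pi.add_apply]
    rw [integral_add i1 i2, integral_const_mul, integral_const_mul,
      integral_add ((hU n).int _) ((hH n).int _)]
    refine add_le_add le_rfl (mul_le_mul_of_nonneg_left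
      (add_le_add ((hU n).bound _) ((hH n).bound _)) ?_)
    rw [hκ']; positivity
  have h2 : κ * B ≤ ε / 2 := by
    rw [hκ', div_mul_eq_mul_div, div_le_iff₀ (by linarith)]
    nlinarith
  linarith [hN n hn]

lemma HasMoments.abs_rpow_le {p η : ℝ} (hp : 0 < p) (hη : 0 < η) {q : ℕ} (hpq : p ≤ q) (x : ℝ) :
    |x| ^ p ≤ η ^ p + η ^ (p - q) * |x| ^ q := by
  have h0 : 0 ≤ η ^ p := Real.rpow_nonneg hη.le _
  have h1 : 0 ≤ η ^ (p - q) * |x| ^ q := mul_nonneg (Real.rpow_nonneg hη.le _) (by positivity)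
  rcases le_total |x| η with h | h
  · have := Real.rpow_le_rpow (abs_nonneg x) h hp.le
    linarith
  · have hx : 0 < |x| := hη.trans_le h
    have h2 : |x| ^ p = |x| ^ (p - q) * |x| ^ q := by
      rw [← Real.rpow_natCast |x| q, ← Real.rpow_add hx]
      congr 1
      ring
    have h3 : |x| ^ (p - q) ≤ η ^ (p - q) := Real.rpow_le_rpow_of_nonpos hη h (by linarith)
    rw [h2]
    have := mul_le_mul_of_nonneg_right h3 (show 0 ≤ |x| ^ q by positivity)
    linarith

lemma HasMoments.integrable_rpow {Ω : Type*} [MeasurableSpace Ω] {μ : Measure Ω}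
    [IsProbabilityMeasure μ] {X : Ω → ℝ} {C : ℕ → ℝ} (hX : HasMoments μ X C) {p : ℝ} (hp : 0 < p) :
    Integrable (fun ω => |X ω| ^ p) μ := by
  refine Integrable.mono' (g := fun ω => (1 : ℝ) ^ p + 1 ^ (p - ⌈p⌉₊) * |X ω| ^ ⌈p⌉₊)
    ((integrable_const _).add ((hX.int _).const_mul _))
    (hX.meas.abs.pow_const p).aestronglyMeasurable (ae_of_all _ fun ω => ?_)
  rw [Real.norm_of_nonneg (Real.rpow_nonneg (abs_nonneg _) _)]
  exact abs_rpow_le hp one_pos (Nat.le_ceil p) _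

lemma tendsto_integral_abs_rpow {X : ∀ n, Ω n → ℝ} (hX : ∀ n, ∃ C, HasMoments (μ n) (X n) C)
    (h : ∀ q : ℕ, 2 ≤ q → Tendsto (fun n => ∫ ω, |X n ω| ^ q ∂(μ n)) atTop (𝓝 0)) {p : ℝ}
    (hp : 0 < p) : Tendsto (fun n => ∫ ω, |X n ω| ^ p ∂(μ n)) atTop (𝓝 0) := by
  set q := ⌈p⌉₊ + 2 with hq
  have hpq : p ≤ q := (Nat.le_ceil p).trans (by rw [hq]; push_cast; linarith)
  rw [Metric.tendsto_atTop]
  intro ε hε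
  set η : ℝ := (ε / 2) ^ (1 / p) with hη
  have hη0 : 0 < η := Real.rpow_pos_of_pos (by positivity) _
  have hηp : η ^ p = ε / 2 := by
    rw [hη, ← Real.rpow_mul (by positivity), one_div_mul_cancel hp.ne', Real.rpow_one]
  have hev := ((h q (by omega)).const_mul (η ^ (p - q))).eventually
    (gt_mem_nhds (show η ^ (p - q) * 0 < ε / 2 by simpa using half_pos hε))
  obtain ⟨N, hN⟩ := eventually_atTop.1 hev
  refine ⟨N, fun n hn => ?_⟩
  obtain ⟨C, hC⟩ := hX n
  have hnn : 0 ≤ ∫ ω, |X n ω| ^ p ∂(μ n) :=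
    integral_nonneg fun ω => Real.rpow_nonneg (abs_nonneg _) _
  rw [Real.dist_eq, sub_zero, abs_of_nonneg hnn]
  have i1 := (hC.int q).const_mul (η ^ (p - q))
  have h1 : ∫ ω, |X n ω| ^ p ∂(μ n) ≤ η ^ p + η ^ (p - q) * ∫ ω, |X n ω| ^ q ∂(μ n) := by
    refine (integral_mono (hC.integrable_rpow hp) ((integrable_const (η ^ p)).add i1)
      fun ω => HasMoments.abs_rpow_le hp hη0 hpq _).trans_eq ?_
    simp only [Pi.add_apply]
    rw [integral_add (integrable_const _) i1, integral_const_mul]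
    simp
  linarith [hN n hn]

end

end MsgCSP

namespace MsgCSP

namespace Instance

/-! ### Asymptotic independence of a message and its resampled version -/

section

variable {r : ℕ} {V E : Type*} {I : Instance r V E} {f : (Fin r → ℤˣ) → ℝ}
  [Fintype V] [Fintype E] {δ K : ℝ} {L d m : ℕ} {F : V → E → (ℓ : ℕ) → (Fin ℓ → ℝ) → ℝ}

/-- The initial values that the messages out of `i` use at iteration `m + 1` and not before. -/
def freshSphere (I : Instance r V E) (m : ℕ) (i : V) : Set V :=
  {v | ∃ b, I.Inc i b ∧ v ∈ I.clauseSphere m i b}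

/-- The increment `u^{m+1}` of the message from `i` to `b`, plus a vanishing multiple of the initial
value at `v`, which makes its law continuous. -/
def noisyMsg (I : Instance r V E) (f : (Fin r → ℤˣ) → ℝ) (d : ℕ)
    (F : V → E → (ℓ : ℕ) → (Fin ℓ → ℝ) → ℝ) (m : ℕ) (i : V) (b : E) (v : V) (x : V → ℝ) : ℝ :=
  I.uMsg f d F x (m + 1) i b + (1 / √((d : ℝ) - 1)) * x v

/-- The contribution of a clause is orthogonal to its resampled version, which uses other fresh
initial values. -/
lemma Admissible.integral_clauseVar_mul_resample (hf : ∀ x, f x = 0 ∨ f x = 1)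
    (h : I.Admissible f δ K L d F) (hm : m < L) {C : ℕ → ℝ} {i : V}
    (hB : I.MessageBound f δ d F (Sum.inl : V → V ⊕ V) m C)
    (hB' : I.MessageBound f δ d F (resampleIndex (I.freshSphere m i)) m C) (b : E) :
    ∫ y, I.clauseVar f d F (Sum.inl : V → V ⊕ V) m i b y *
      I.clauseVar f d F (resampleIndex (I.freshSphere m i)) m i b y ∂(gaussPi δ (V ⊕ V)) = 0 := by
  by_cases hi : I.Inc i b
  · have h1 := h.condZero_clauseStep Sum.inl_injective hm.le hB hi
    have h2 := h.hasMoments_clauseStep hf hB' hi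
    rw [clauseVar_of_inc hi, clauseVar_of_inc hi]
    refine h1 _ _ h2 ((dependsOn_clauseStep h.girth.1 hi).mono ?_)
    rintro _ ⟨v, -, rfl⟩ ⟨w, hw, hvw⟩
    by_cases hv : v ∈ I.freshSphere m i
    · simp [resampleIndex, hv] at hvw
    · simp only [resampleIndex, hv, if_false, Sum.inl.injEq] at hvw
      exact hv (hvw ▸ ⟨b, hi, hw⟩)
  · rw [clauseVar_of_not_inc hi]
    simp

open Classical in
lemma Admissible.iIndepFun_resample (hf : ∀ x, f x = 0 ∨ f x = 1)
    (h : I.Admissible f δ K L d F) (hm : m < L) {C : ℕ → ℝ} {i : V} {A : Set V}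
    (hB : I.MessageBound f δ d F (Sum.inl : V → V ⊕ V) m C)
    (hB' : I.MessageBound f δ d F (resampleIndex A) m C) (s t : ℝ) :
    iIndepFun (fun b y => s * I.clauseVar f d F (Sum.inl : V → V ⊕ V) m i b y +
      t * I.clauseVar f d F (resampleIndex A) m i b y) (gaussPi δ (V ⊕ V)) := by
  refine iIndepFun_of_dependsOn
    (S := fun b => (if I.Inc i b then Sum.inl '' I.clauseBranch m i b else ∅) ∪
      (if I.Inc i b then resampleIndex A '' I.clauseBranch m i b else ∅)) (fun b => ?_)
    (fun b => ?_) ?_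
  · exact ((h.hasMoments_clauseVar hf hB i b).meas.const_mul s).add
      ((h.hasMoments_clauseVar hf hB' i b).meas.const_mul t)
  · intro x y hxy
    have h1 := dependsOn_clauseVar (ι := (Sum.inl : V → V ⊕ V)) (f := f) (d := d) (F := F) (m := m)
      h.girth.1 i b (fun w hw => hxy w (Or.inl hw))
    have h2 := dependsOn_clauseVar (ι := resampleIndex A) (f := f) (d := d) (F := F) (m := m)
      h.girth.1 i b (fun w hw => hxy w (Or.inr hw))
    simp only [h1, h2]
  · intro b b' hbb'
    by_cases hb : I.Inc i b
    · by_cases hb' : I.Inc i b'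
      · simp only [hb, hb', if_true]
        have hd := Set.disjoint_left.1 (h.disjoint_clauseBranch hm hb hb' hbb')
        rw [Set.disjoint_left]
        rintro w (⟨v, hv, rfl⟩ | ⟨v, hv, rfl⟩) (⟨v', hv', hvv'⟩ | ⟨v', hv', hvv'⟩)
        · exact hd hv (Sum.inl_injective hvv' ▸ hv')
        · by_cases hA : v' ∈ A
          · simp [resampleIndex, hA] at hvv'
          · simp only [resampleIndex, hA, if_false, Sum.inl.injEq] at hvv'
            exact hd hv (hvv' ▸ hv')
        · by_cases hA : v ∈ A
          · simp [resampleIndex, hA] at hvv'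
          · simp only [resampleIndex, hA, if_false, Sum.inl.injEq] at hvv'
            exact hd hv (hvv' ▸ hv')
        · exact hd hv (resampleIndex_injective hvv' ▸ hv')
      · simp [hb']
    · simp [hb]

end

/-- The joint characteristic function of a message and its resampled version is, up to `O(1/√d)`,
that of independent Gaussians. -/
lemma exists_charFun_resample_bound {r : ℕ} {f : (Fin r → ℤˣ) → ℝ}
    (hf : ∀ x, f x = 0 ∨ f x = 1) (hlin : fourierWeight f 1 = 0)
    (δ K : ℝ) (m : ℕ) (s t : ℝ) : ∃ C : ℝ, ∀ {V E : Type*} [Fintype V] [Fintype E]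
      (I : Instance r V E) (L d : ℕ) (F : V → E → (ℓ : ℕ) → (Fin ℓ → ℝ) → ℝ),
      I.Admissible f δ K L d F → m < L → ∀ i b, I.Inc i b → ∀ v,
      ‖∫ y : V ⊕ V → ℝ, Complex.exp ((s * I.noisyMsg f d F m i b v (y ∘ Sum.inl) +
          t * I.noisyMsg f d F m i b v (y ∘ resampleIndex (I.freshSphere m i)) : ℝ) * Complex.I)
          ∂(gaussPi δ (V ⊕ V)) -
        (Real.exp (-((s ^ 2 * ∫ y : V ⊕ V → ℝ, I.uMsg f d F (y ∘ Sum.inl) (m + 1) i b ^ 2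
            ∂(gaussPi δ (V ⊕ V)) +
          t ^ 2 * ∫ y : V ⊕ V → ℝ,
            I.uMsg f d F (y ∘ resampleIndex (I.freshSphere m i)) (m + 1) i b ^ 2
              ∂(gaussPi δ (V ⊕ V))) / 2)) : ℂ)‖ ≤ C * (1 / √((d : ℝ) - 1)) := by
  obtain ⟨C₀, hC₀⟩ := exists_messageBound.{_, _, _} hf hlin δ K m
  set B : ℕ → ℝ := HasMoments.addBound (fun p => |s| ^ p * clauseBound r C₀ p)
    (fun p => |t| ^ p * clauseBound r C₀ p) with hBdef
  set g : ℕ → ℝ := fun p => ∫ u, |u| ^ p ∂(gaussianReal 0 δ.toNNReal) with hg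
  set G : ℕ → ℝ := HasMoments.addBound (fun p => |s| ^ p * g p) (fun p => |t| ^ p * g p) with hG
  refine ⟨G 1 + (4 * B 3 + B 2 ^ 2), ?_⟩
  intro V E _ _ I L d F h hm i b hi v
  set A := I.freshSphere m i with hA
  set ι' : V → V ⊕ V := resampleIndex A with hι'
  have hinj : Function.Injective ι' := resampleIndex_injective
  have hB := hC₀ I L d F (Sum.inl : V → V ⊕ V) h Sum.inl_injective hm.le
  have hB' := hC₀ I L d F ι' h hinj hm.le
  set Z : E → (V ⊕ V → ℝ) → ℝ := fun c y => s * I.clauseVar f d F (Sum.inl : V → V ⊕ V) m i c y +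
    t * I.clauseVar f d F ι' m i c y with hZ
  have hX := h.hasMoments_clauseVar hf hB i
  have hX' := h.hasMoments_clauseVar hf hB' i
  have hZm : ∀ c, HasMoments (gaussPi δ (V ⊕ V)) (Z c) B := fun c =>
    ((hX c).const_mul s).add ((hX' c).const_mul t)
  have hZ0 : ∀ c, ∫ y, Z c y ∂(gaussPi δ (V ⊕ V)) = 0 := by
    intro c
    simp only [hZ]
    rw [integral_add ((hX c).integrable.const_mul s) ((hX' c).integrable.const_mul t),
      integral_const_mul, integral_const_mul, h.integral_clauseVar Sum.inl_injective hm.le hB,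
      h.integral_clauseVar hinj hm.le hB']
    ring
  have hZ2 : ∀ c, ∫ y, Z c y ^ 2 ∂(gaussPi δ (V ⊕ V)) =
      s ^ 2 * ∫ y, I.clauseVar f d F (Sum.inl : V → V ⊕ V) m i c y ^ 2 ∂(gaussPi δ (V ⊕ V)) +
      t ^ 2 * ∫ y, I.clauseVar f d F ι' m i c y ^ 2 ∂(gaussPi δ (V ⊕ V)) := by
    intro c
    have e1 : ∀ y, Z c y ^ 2 =
        (s ^ 2 * I.clauseVar f d F (Sum.inl : V → V ⊕ V) m i c y ^ 2 +
        t ^ 2 * I.clauseVar f d F ι' m i c y ^ 2) +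
        (2 * s * t) * (I.clauseVar f d F (Sum.inl : V → V ⊕ V) m i c y *
          I.clauseVar f d F ι' m i c y) := fun y => by simp only [hZ]; ring
    have j1 := ((hX c).integrable_pow 2).const_mul (s ^ 2)
    have j2 := ((hX' c).integrable_pow 2).const_mul (t ^ 2)
    have j3 := ((hX c).integrable_mul (hX' c)).const_mul (2 * s * t)
    simp_rw [e1]
    have j12 : Integrable (fun y => s ^ 2 * I.clauseVar f d F (Sum.inl : V → V ⊕ V) m i c y ^ 2 +
        t ^ 2 * I.clauseVar f d F ι' m i c y ^ 2) (gaussPi δ (V ⊕ V)) := j1.add j2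
    rw [integral_add j12 j3, integral_add j1 j2, integral_const_mul, integral_const_mul,
      integral_const_mul, h.integral_clauseVar_mul_resample hf hm hB hB', mul_zero, add_zero]
  have hcard := h.cast_card_starErase hi
  have hd : (1 : ℝ) ≤ (d : ℝ) - 1 := by
    have : (2 : ℝ) ≤ d := by exact_mod_cast h.two_le
    linarith
  have hne : (I.starErase i b).Nonempty := by
    rw [← Finset.card_pos, h.card_starErase hi]
    have := h.two_le
    omega
  -- A linear combination of the message and its resampled version is a normalized sum of the
  -- independent variables `Z c`, plus a vanishing noise.
  have hsum : ∀ y : V ⊕ V → ℝ, s * I.noisyMsg f d F m i b v (y ∘ Sum.inl) +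
      t * I.noisyMsg f d F m i b v (y ∘ ι') =
      (1 / √((I.starErase i b).card : ℝ)) * ∑ c ∈ I.starErase i b, Z c y +
        (1 / √((d : ℝ) - 1)) * (s * y (Sum.inl v) + t * y (ι' v)) := by
    intro y
    simp only [noisyMsg, hZ]
    rw [h.uMsg_eq hlin hi, h.uMsg_eq hlin hi, hcard, Finset.sum_add_distrib, ← Finset.mul_sum,
      ← Finset.mul_sum]
    simp only [Function.comp]
    ring
  have hvar : (1 / ((I.starErase i b).card : ℝ)) *
      (∑ c ∈ I.starErase i b, ∫ y, Z c y ^ 2 ∂(gaussPi δ (V ⊕ V))) =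
      s ^ 2 * ∫ y : V ⊕ V → ℝ, I.uMsg f d F (y ∘ Sum.inl) (m + 1) i b ^ 2 ∂(gaussPi δ (V ⊕ V)) +
      t ^ 2 * ∫ y : V ⊕ V → ℝ, I.uMsg f d F (y ∘ ι') (m + 1) i b ^ 2 ∂(gaussPi δ (V ⊕ V)) := by
    rw [h.integral_uMsg_sq hf hlin Sum.inl_injective hm hB hi,
      h.integral_uMsg_sq hf hlin hinj hm hB' hi, hcard]
    simp_rw [hZ2]
    rw [Finset.sum_add_distrib, ← Finset.mul_sum, ← Finset.mul_sum]
    ring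
  have hY : HasMoments (gaussPi δ (V ⊕ V)) (fun y => (1 / √((d : ℝ) - 1)) *
      (s * y (Sum.inl v) + t * y (ι' v))) (fun p => |1 / √((d : ℝ) - 1)| ^ p * G p) :=
    (((hasMoments_gaussian _).const_mul s).add ((hasMoments_gaussian _).const_mul t)).const_mul _
  have hS : Measurable fun y => (1 / √((I.starErase i b).card : ℝ)) *
      ∑ c ∈ I.starErase i b, Z c y :=
    (Finset.measurable_fun_sum _ fun c _ => (hZm c).meas).const_mul _
  have k1 := norm_integral_cexp_add_sub_le hS hY
  have k2 := norm_charFun_normalized_sum_sub_le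
    (h.iIndepFun_resample hf hm hB hB' s t) hZm hZ0 _ hne
  have k3 := hY.bound 1
  rw [hvar, hcard] at k2
  rw [hcard] at k1
  simp only [pow_one] at k3
  rw [abs_of_nonneg (show 0 ≤ 1 / √((d : ℝ) - 1) by positivity)] at k3
  simp_rw [hsum]
  rw [hcard]
  refine (norm_sub_le_norm_sub_add_norm_sub _ _ _).trans ((add_le_add (k1.trans k3) k2).trans_eq ?_)
  ring

end Instance

end MsgCSP

namespace MsgCSP

/-! ### The coupling of a message with a Gaussian variable -/

section

variable {V : Type*} [Fintype V] {P : Measure ℝ} [IsProbabilityMeasure P] {A : Set V}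

/-- A variable to which an independent atomless one is added has no atoms. -/
lemma nullSingletonClass_resampleLaw_add [NullSingletonClass P] {R : (V → ℝ) → ℝ}
    (hR : Measurable R) {v : V} (hv : v ∈ A) (hRv : DependsOn R {v}ᶜ) {c : ℝ} (hc : c ≠ 0)
    (x : V → ℝ) : NullSingletonClass (resampleLaw P A (fun x => R x + c * x v) x) := by
  have hH : Measurable fun x : V → ℝ => R x + c * x v :=
    hR.add ((show Measurable fun x : V → ℝ => x v from measurable_pi_apply v).const_mul c)
  set Rx : (V → ℝ) → ℝ := fun x' => R (merge A x x') with hRx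
  have hRxm : Measurable Rx := measurable_comp_merge hR x
  have hind : IndepFun Rx (fun x' : V → ℝ => x' v) (Measure.pi fun _ : V => P) := by
    refine indepFun_of_dependsOn (S := {v}ᶜ) (T := {v}) hRxm (measurable_pi_apply v) ?_
      (fun x y hxy => hxy v rfl) disjoint_compl_left
    intro y y' hyy'
    refine hRv fun w hw => ?_
    by_cases hwA : w ∈ A
    · rw [merge_apply_of_mem hwA, merge_apply_of_mem hwA, hyy' w hw]
    · rw [merge_apply_of_notMem hwA, merge_apply_of_notMem hwA]
  have hmap := (indepFun_iff_map_prod_eq_prod_map_map hRxm.aemeasurable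
    (measurable_pi_apply v).aemeasurable).1 hind
  have hev := (measurePreserving_eval (fun _ : V => P) v).map_eq
  refine ⟨fun t => ?_⟩
  have hs : MeasurableSet {p : ℝ × ℝ | p.1 + c * p.2 = t} :=
    measurableSet_eq_fun (measurable_fst.add (measurable_snd.const_mul c)) measurable_const
  rw [resampleLaw, Measure.map_apply (measurable_comp_merge hH x) (measurableSet_singleton t)]
  have h1 : (fun x' => R (merge A x x') + c * merge A x x' v) ⁻¹' {t} =
      (fun x' => (Rx x', x' v)) ⁻¹' {p : ℝ × ℝ | p.1 + c * p.2 = t} := by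
    ext x'
    simp [hRx, merge_apply_of_mem hv]
  rw [h1, ← Measure.map_apply (hRxm.prodMk (measurable_pi_apply v)) hs, hmap]
  have hp : (Measure.pi fun _ : V => P).map (fun x' : V → ℝ => x' v) = P := hev
  rw [hp]
  have := Measure.isProbabilityMeasure_map (μ := Measure.pi fun _ : V => P) hRxm.aemeasurable
  rw [Measure.measure_prod_null hs]
  refine ae_of_all _ fun a => ?_
  have h2 : Prod.mk a ⁻¹' {p : ℝ × ℝ | p.1 + c * p.2 = t} = {(t - a) / c} := by
    ext y
    simp only [Set.mem_preimage, Set.mem_ofPred_eq, Set.mem_singleton_iff]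
    rw [eq_div_iff hc]
    constructor <;> intro h <;> linarith
  show P (Prod.mk a ⁻¹' {p : ℝ × ℝ | p.1 + c * p.2 = t}) = 0
  rw [h2, measure_singleton]

end

namespace Instance

section

variable {r : ℕ} {V E : Type*} {I : Instance r V E} {f : (Fin r → ℤˣ) → ℝ}
  [Fintype V] [Fintype E] {δ K : ℝ} {L d m : ℕ} {F : V → E → (ℓ : ℕ) → (Fin ℓ → ℝ) → ℝ}
  {i : V} {a b : E} {v : V}

lemma Admissible.one_le_sub (h : I.Admissible f δ K L d F) : (1 : ℝ) ≤ (d : ℝ) - 1 := by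
  have : (2 : ℝ) ≤ d := by exact_mod_cast h.two_le
  linarith

lemma Admissible.measurable_uMsg (h : I.Admissible f δ K L d F) (hm : m < L) (i : V) (a : E) :
    Measurable fun x => I.uMsg f d F x (m + 1) i a :=
  Instance.measurable_uMsg h.meas (by omega) i a

lemma Admissible.measurable_noisyMsg (h : I.Admissible f δ K L d F) (hm : m < L) (i : V) (b : E)
    (v : V) : Measurable (I.noisyMsg f d F m i b v) :=
  (h.measurable_uMsg hm i b).add ((measurable_pi_apply v).const_mul _)

lemma clauseSphere_subset_freshSphere (hb : I.Inc i b) :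
    I.clauseSphere m i b ⊆ I.freshSphere m i := fun _ hv => ⟨b, hb, hv⟩

lemma Admissible.clauseSphere_nonempty (h : I.Admissible f δ K L d F) (hr : 2 ≤ r)
    (hb : I.Inc i b) : (I.clauseSphere m i b).Nonempty := by
  classical
  have h1 : ∀ j b, I.Inc j b → ∃ c, I.Inc j c ∧ c ≠ b := by
    intro j b hj
    have hpos : 0 < (I.starErase j b).card := by
      rw [h.card_starErase hj]
      have := h.two_le
      omega
    obtain ⟨c, hc⟩ := Finset.card_pos.1 hpos
    exact ⟨c, (mem_starErase.1 hc).2, (mem_starErase.1 hc).1⟩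
  have h2 : ∀ j c, I.Inc j c → ∃ k, I.Inc k c ∧ k ≠ j := by
    rintro _ c ⟨κ, rfl⟩
    have : Nontrivial (Fin r) := Fin.nontrivial_iff_two_le.2 hr
    obtain ⟨κ', hκ⟩ := exists_ne κ
    exact ⟨_, ⟨κ', rfl⟩, fun heq => hκ (h.girth.1 c heq)⟩
  obtain ⟨j, hj, hji⟩ := h2 i b hb
  obtain ⟨v, hv⟩ := msgSphere_nonempty h1 h2 m hj
  exact ⟨v, j, hj, hji, hv⟩

lemma Admissible.notMem_ball_of_mem_freshSphere (h : I.Admissible f δ K L d F) (hm : m < L)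
    (hv : v ∈ I.freshSphere m i) : v ∉ I.ball i m := by
  obtain ⟨b, hb, j, hj, hji, hv⟩ := hv
  exact not_mem_ball_of_mem_msgSphere h.girth (by omega) hb hj hji hv

lemma Admissible.nullSingletonClass_noisyMsg (h : I.Admissible f δ K L d F) (hδ : 0 < δ)
    (hm : m < L) (hb : I.Inc i b) (hv : v ∈ I.clauseSphere m i b) (x : V → ℝ) :
    NullSingletonClass (resampleLaw (gaussianReal 0 δ.toNNReal) (I.freshSphere m i)
      (I.noisyMsg f d F m i b v) x) := by
  have := nullSingletonClass_gaussianReal (μ := 0) (v := δ.toNNReal) (by simpa using hδ)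
  have hd := h.one_le_sub
  refine nullSingletonClass_resampleLaw_add (h.measurable_uMsg hm i b)
    (clauseSphere_subset_freshSphere hb hv) ?_ (by positivity) x
  intro y y' hyy'
  refine uMsg_congr h.girth.1 (m + 1) fun w hw => hyy' w ?_
  rintro rfl
  obtain ⟨k, hk, hwk⟩ := hw
  obtain ⟨j, hj, hji, hwj⟩ := hv
  exact hji (eq_of_mem_msgSphere_of_clause h.girth (by omega) hj hb hwj hwk).2

/-- Two messages out of the same variable differ only in the contributions of two clauses. -/
lemma Admissible.uMsg_sub_noisyMsg (hlin : fourierWeight f 1 = 0) (h : I.Admissible f δ K L d F)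
    (ha : I.Inc i a) (hb : I.Inc i b) (x : V → ℝ) :
    I.uMsg f d F x (m + 1) i a - I.noisyMsg f d F m i b v x = (1 / √((d : ℝ) - 1)) *
      ((I.clauseVar f d F id m i b x - I.clauseVar f d F id m i a x) - x v) := by
  classical
  have e1 : ∀ c, I.Inc i c → I.uMsg f d F x (m + 1) i c = (1 / √((d : ℝ) - 1)) *
      (∑ c' ∈ I.star i, I.clauseVar f d F id m i c' x - I.clauseVar f d F id m i c x) := by
    intro c hc
    have h1 := h.uMsg_eq (m := m) (ι := id) hlin hc x
    rw [h.cast_card_starErase hc] at h1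
    have h2 := Finset.sum_erase_eq_sub (f := fun c => I.clauseVar f d F id m i c x)
      (mem_star.2 hc)
    rw [← h2]
    exact h1
  rw [noisyMsg, e1 a ha, e1 b hb]
  ring

end

/-- Bounds for the moments of the messages, with or without the small noise, and for their
differences, uniform over all admissible instances. -/
lemma exists_noisyMsg_bound {r : ℕ} {f : (Fin r → ℤˣ) → ℝ} (hf : ∀ x, f x = 0 ∨ f x = 1)
    (hlin : fourierWeight f 1 = 0) (δ K : ℝ) (m : ℕ) : ∃ C D : ℕ → ℝ,
    ∀ {V E : Type*} [Fintype V] [Fintype E]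
      (I : Instance r V E) (L d : ℕ) (F : V → E → (ℓ : ℕ) → (Fin ℓ → ℝ) → ℝ),
      I.Admissible f δ K L d F → m < L → ∀ i b, I.Inc i b → ∀ v,
        HasMoments (gaussPi δ V) (I.noisyMsg f d F m i b v) C ∧
        ∀ a, I.Inc i a → HasMoments (gaussPi δ V) (fun x => I.uMsg f d F x (m + 1) i a -
          I.noisyMsg f d F m i b v x) fun p => |1 / √((d : ℝ) - 1)| ^ p * D p := by
  obtain ⟨C₀, hC₀⟩ := exists_messageBound.{_, _, _} hf hlin δ K m
  obtain ⟨C₁, hC₁⟩ := exists_uMsg_bound.{_, _, _} hf hlin δ K C₀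
  refine ⟨HasMoments.addBound C₁ fun p => ∫ t, |t| ^ p ∂(gaussianReal 0 δ.toNNReal),
    HasMoments.addBound (HasMoments.addBound (clauseBound r C₀) (clauseBound r C₀))
      fun p => ∫ t, |t| ^ p ∂(gaussianReal 0 δ.toNNReal), ?_⟩
  intro V E _ _ I L d F h hm i b hb v
  have hB := hC₀ I L d F (id : V → V) h Function.injective_id hm.le
  have hu := hC₁ I L d m F (id : V → V) h Function.injective_id hm hB i b hb
  have hd := h.one_le_sub
  refine ⟨?_, fun a ha => ?_⟩
  · refine HasMoments.add hu ((hasMoments_gaussian v).of_abs_le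
      ((measurable_pi_apply v).const_mul _) fun x => ?_)
    rw [abs_mul, abs_of_nonneg (by positivity)]
    refine mul_le_of_le_one_left (abs_nonneg _) ?_
    exact (div_le_one (by positivity)).2 (Real.one_le_sqrt.2 hd)
  · simp only [h.uMsg_sub_noisyMsg hlin ha hb]
    exact (((h.hasMoments_clauseVar hf hB i b).sub (h.hasMoments_clauseVar hf hB i a)).sub
      (hasMoments_gaussian v)).const_mul _

section

variable {r : ℕ} {f : (Fin r → ℤˣ) → ℝ} {δ K : ℝ} {L m : ℕ} {V E : ℕ → Type*}
  [∀ n, Fintype (V n)] [∀ n, Fintype (E n)] {I : ∀ n, Instance r (V n) (E n)} {d : ℕ → ℕ}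
  {F : ∀ n, V n → E n → (ℓ : ℕ) → (Fin ℓ → ℝ) → ℝ} {i : ∀ n, V n} {b : ∀ n, E n} {v : ∀ n, V n}

lemma tendsto_one_div_sqrt_sub_one (hd : Tendsto d atTop atTop) :
    Tendsto (fun n => 1 / √((d n : ℝ) - 1)) atTop (𝓝 0) := by
  refine tendsto_const_nhds.div_atTop (Real.tendsto_sqrt_atTop.comp ?_)
  exact tendsto_atTop_add_const_right _ (-1) (tendsto_natCast_atTop_atTop.comp hd)

/-- A message and its resampled version converge jointly to a pair of independent Gaussians. -/
lemma tendsto_integral_noisyMsg_merge (hf : ∀ x, f x = 0 ∨ f x = 1)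
    (hlin : fourierWeight f 1 = 0) (hδ : 0 < δ) (hnu : ∀ m, 0 < nu f δ (m + 1))
    (hd : Tendsto d atTop atTop) (h : ∀ n, (I n).Admissible f δ K L (d n) (F n)) (hm : m < L)
    (hb : ∀ n, (I n).Inc (i n) (b n)) (g : BoundedContinuousFunction (ℝ × ℝ) ℝ) :
    Tendsto (fun n => ∫ p : (V n → ℝ) × (V n → ℝ),
      g ((I n).noisyMsg f (d n) (F n) m (i n) (b n) (v n) p.1,
        (I n).noisyMsg f (d n) (F n) m (i n) (b n) (v n)
          (merge ((I n).freshSphere m (i n)) p.1 p.2))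
        ∂((gaussPi δ (V n)).prod (gaussPi δ (V n)))) atTop
      (𝓝 (∫ p, g p ∂((gaussianReal 0 (nu f δ (m + 1)).toNNReal).prod
        (gaussianReal 0 (nu f δ (m + 1)).toNNReal)))) := by
  have hH := fun n => (h n).measurable_noisyMsg hm (i n) (b n) (v n)
  have hvar : ∀ (ι : ∀ n, V n → V n ⊕ V n), (∀ n, Function.Injective (ι n)) →
      Tendsto (fun n => ∫ y : V n ⊕ V n → ℝ,
        (I n).uMsg f (d n) (F n) (y ∘ ι n) (m + 1) (i n) (b n) ^ 2 ∂(gaussPi δ (V n ⊕ V n))) atTop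
        (𝓝 (nu f δ (m + 1))) := by
    intro ι hι
    rw [Metric.tendsto_atTop]
    intro ε hε
    obtain ⟨D, hD⟩ := exists_uMsg_sq_sub_nu_le.{_, _, _} hf hlin hδ K hnu m (half_pos hε)
    obtain ⟨N, hN⟩ := eventually_atTop.1 (hd.eventually_ge_atTop D)
    refine ⟨N, fun n hn => ?_⟩
    rw [Real.dist_eq]
    exact (hD (I n) L (d n) (F n) (ι n) (h n) (hι n) hm (hN n hn) _ _ (hb n)).trans_lt
      (half_lt_self hε)
  have key := tendsto_integral_pair (μ := fun n => gaussPi δ (V n ⊕ V n))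
    (X := fun n y => (I n).noisyMsg f (d n) (F n) m (i n) (b n) (v n) (y ∘ Sum.inl))
    (Y := fun n y => (I n).noisyMsg f (d n) (F n) m (i n) (b n) (v n)
      (y ∘ resampleIndex ((I n).freshSphere m (i n))))
    (fun n => (hH n).comp (measurable_comp_right _))
    (fun n => (hH n).comp (measurable_comp_right _)) (hnu m).le ?_ g
  · refine key.congr fun n => ?_
    have hmp := measurePreserving_sumPiEquivProdPi_symm
      (fun _ : V n ⊕ V n => gaussianReal 0 δ.toNNReal)
    rw [← hmp.integral_comp']
    congr 1
    ext p
    rw [merge_eq_comp]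
    rfl
  · intro s t
    obtain ⟨C, hC⟩ := exists_charFun_resample_bound.{_, _} hf hlin δ K m s t
    have h1 := hvar (fun n => Sum.inl) fun n => Sum.inl_injective
    have h2 := hvar (fun n => resampleIndex ((I n).freshSphere m (i n)))
      fun n => resampleIndex_injective
    have h3 := ((h1.const_mul (s ^ 2)).add (h2.const_mul (t ^ 2))).div_const 2 |>.neg
    have h4 := (Complex.continuous_ofReal.tendsto _).comp ((Real.continuous_exp.tendsto _).comp h3)
    rw [← add_mul] at h4
    have h5 : Tendsto (fun n => C * (1 / √((d n : ℝ) - 1))) atTop (𝓝 0) := by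
      simpa using (tendsto_one_div_sqrt_sub_one hd).const_mul C
    have h6 := squeeze_zero_norm
      (fun n => hC (I n) L (d n) (F n) (h n) hm (i n) (b n) (hb n) (v n)) h5
    have h7 := h6.add h4
    rw [zero_add] at h7
    refine h7.congr fun n => ?_
    simp only [Function.comp]
    ring

/-- The message is close, in all moments, to the coupled Gaussian variable. -/
lemma tendsto_integral_uMsg_sub_couple (hf : ∀ x, f x = 0 ∨ f x = 1)
    (hlin : fourierWeight f 1 = 0) (hδ : 0 < δ) (hnu : ∀ m, 0 < nu f δ (m + 1))
    (hd : Tendsto d atTop atTop) (h : ∀ n, (I n).Admissible f δ K L (d n) (F n)) (hm : m < L)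
    (hb : ∀ n, (I n).Inc (i n) (b n)) (hv : ∀ n, v n ∈ (I n).clauseSphere m (i n) (b n))
    {a : ∀ n, E n} (ha : ∀ n, (I n).Inc (i n) (a n)) :
    (∀ n, ∃ C, HasMoments (gaussPi δ (V n))
      (fun x => (I n).uMsg f (d n) (F n) x (m + 1) (i n) (a n) -
        couple (gaussianReal 0 δ.toNNReal) (gaussianReal 0 (nu f δ (m + 1)).toNNReal)
          ((I n).freshSphere m (i n)) ((I n).noisyMsg f (d n) (F n) m (i n) (b n) (v n)) x) C) ∧
    ∀ q : ℕ, 2 ≤ q → Tendsto (fun n =>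
      ∫ x, |(I n).uMsg f (d n) (F n) x (m + 1) (i n) (a n) -
        couple (gaussianReal 0 δ.toNNReal) (gaussianReal 0 (nu f δ (m + 1)).toNNReal)
          ((I n).freshSphere m (i n)) ((I n).noisyMsg f (d n) (F n) m (i n) (b n) (v n)) x| ^ q
        ∂(gaussPi δ (V n))) atTop (𝓝 0) := by
  set w := (nu f δ (m + 1)).toNNReal with hw
  have hw0 : w ≠ 0 := by simpa [hw] using hnu m
  have := nullSingletonClass_gaussianReal (μ := 0) hw0
  obtain ⟨C, D, hCD⟩ := exists_noisyMsg_bound.{_, _} hf hlin δ K m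
  have hCD' := fun n => hCD (I n) L (d n) (F n) (h n) hm (i n) (b n) (hb n) (v n)
  have hat := fun n => (h n).nullSingletonClass_noisyMsg hδ hm (hb n) (hv n)
  set H := fun n => (I n).noisyMsg f (d n) (F n) m (i n) (b n) (v n) with hH
  set A := fun n => (I n).freshSphere m (i n) with hA
  have hHm : ∀ n, Measurable (H n) := fun n => (h n).measurable_noisyMsg hm (i n) (b n) (v n)
  set U := fun n => couple (gaussianReal 0 δ.toNNReal) (gaussianReal 0 w) (A n) (H n) with hU
  have hUmom : ∀ n, HasMoments (gaussPi δ (V n)) (U n)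
      (fun p => ∫ t, |t| ^ p ∂(gaussianReal 0 w)) := by
    intro n
    have h0 : HasMoments (gaussianReal 0 w) (fun t => t)
        (fun p => ∫ t, |t| ^ p ∂(gaussianReal 0 w)) := by
      refine ⟨measurable_id, fun p => ?_, fun p => le_rfl⟩
      have := (memLp_id_gaussianReal (μ := 0) (v := w) p).integrable_norm_pow' (p := p)
      simpa using this
    exact h0.comp (g := U n) ⟨measurable_couple (hHm n), map_couple (hHm n) (hat n)⟩
  -- The variable `U` is close to `H`, and `H` is close to the message, even to that into another
  -- clause.
  have hclose := fun (q : ℕ) (hq : 2 ≤ q) => tendsto_integral_abs_sub_pow hw0 hUmom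
    (fun n => (hCD' n).1) (tendsto_integral_cdf_couple_sub_sq hHm hat
      (tendsto_integral_noisyMsg_merge hf hlin hδ hnu hd h hm hb)) hq
  have hmom : ∀ n, ∃ B, HasMoments (gaussPi δ (V n))
      (fun x => (I n).uMsg f (d n) (F n) x (m + 1) (i n) (a n) - U n x) B := by
    intro n
    have := ((hCD' n).2 (a n) (ha n)).sub ((hUmom n).sub (hCD' n).1)
    refine ⟨_, this.of_abs_le (((h n).measurable_uMsg hm (i n) (a n)).sub (hUmom n).meas)
      fun x => le_of_eq ?_⟩
    congr 1
    ring
  refine ⟨hmom, fun q hq => ?_⟩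
  have hle : ∀ n, ∫ x, |(I n).uMsg f (d n) (F n) x (m + 1) (i n) (a n) - U n x| ^ q
      ∂(gaussPi δ (V n)) ≤ 2 ^ q * (|1 / √((d n : ℝ) - 1)| ^ q * D q +
        ∫ x, |U n x - H n x| ^ q ∂(gaussPi δ (V n))) := by
    intro n
    have h1 := (hCD' n).2 (a n) (ha n)
    have h2 := (hUmom n).sub (hCD' n).1
    obtain ⟨B, hB⟩ := hmom n
    refine (integral_mono (hB.int q) (((h1.int q).add (h2.int q)).const_mul (2 ^ q))
      fun x => ?_).trans ?_
    · have h3 := HasMoments.abs_add_pow_le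
        ((I n).uMsg f (d n) (F n) x (m + 1) (i n) (a n) - H n x) (-(U n x - H n x)) q
      rw [abs_neg] at h3
      have h4 : (I n).uMsg f (d n) (F n) x (m + 1) (i n) (a n) - H n x + -(U n x - H n x) =
          (I n).uMsg f (d n) (F n) x (m + 1) (i n) (a n) - U n x := by ring
      rw [h4] at h3
      exact h3
    · simp only [Pi.add_apply]
      rw [integral_const_mul, integral_add (h1.int q) (h2.int q)]
      exact mul_le_mul_of_nonneg_left (add_le_add (h1.bound q) le_rfl) (by positivity)
  have hlim : Tendsto (fun n => 2 ^ q * (|1 / √((d n : ℝ) - 1)| ^ q * D q +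
        ∫ x, |U n x - H n x| ^ q ∂(gaussPi δ (V n)))) atTop (𝓝 0) := by
    have h1 := (((tendsto_one_div_sqrt_sub_one hd).abs.pow q).mul_const (D q)).add (hclose q hq)
    have h2 := h1.const_mul (2 ^ q)
    simpa [show q ≠ 0 by omega] using h2
  exact squeeze_zero (fun n => integral_nonneg fun x => by positivity) hle hlim

end

end Instance

end MsgCSP

namespace MsgCSP

/-! ### Degenerate and nondegenerate predicates -/

section

variable {r : ℕ} {f : (Fin r → ℤˣ) → ℝ} {δ : ℝ}

lemma eval_derivative_xi (s : ℝ) : (xi f).derivative.eval s =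
    ∑ j ∈ Finset.Icc 1 r, fourierWeight f j * ((j : ℝ) * s ^ (j - 1)) := by
  simp [xi, Polynomial.eval_finsetSum, Polynomial.derivative_X_pow]

lemma two_le_card_of_fourierCoeff_ne_zero (hlin : fourierWeight f 1 = 0) {S : Finset (Fin r)}
    (hS : S.Nonempty) (hfS : fourierCoeff f S ≠ 0) : 2 ≤ S.card := by
  have h1 : S.card ≠ 1 := by
    intro h
    obtain ⟨κ, rfl⟩ := Finset.card_eq_one.1 h
    exact hfS (fourierCoeff_singleton_eq_zero hlin κ)
  have := hS.card_pos
  omega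

lemma nu_pos (hδ : 0 < δ) {S : Finset (Fin r)} (hS : 2 ≤ S.card) (hfS : fourierCoeff f S ≠ 0)
    (m : ℕ) : 0 < nu f δ (m + 1) := by
  have hSr : S.card ≤ r := by simpa using Finset.card_le_univ S
  have hr : (0 : ℝ) < r := by exact_mod_cast (by omega : 0 < r)
  rw [nu]
  refine div_pos ?_ hr
  have e1 : (((m + 1 : ℕ) : ℝ) - 1) * δ = (m : ℝ) * δ := by push_cast; ring
  rw [e1, eval_derivative_xi, eval_derivative_xi, ← Finset.sum_sub_distrib]
  have hlt : (m : ℝ) * δ < ((m + 1 : ℕ) : ℝ) * δ := by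
    push_cast
    nlinarith
  have h0 : 0 ≤ (m : ℝ) * δ := by positivity
  have hw : ∀ j, 0 ≤ fourierWeight f j := fun j => Finset.sum_nonneg fun S _ => sq_nonneg _
  refine Finset.sum_pos' (fun j _ => ?_) ⟨S.card, Finset.mem_Icc.2 ⟨by omega, hSr⟩, ?_⟩
  · rw [← mul_sub, ← mul_sub]
    refine mul_nonneg (hw j) (mul_nonneg (by positivity) (sub_nonneg.2 ?_))
    exact pow_le_pow_left₀ h0 hlt.le _
  · rw [← mul_sub, ← mul_sub]
    refine mul_pos ?_ (mul_pos (by exact_mod_cast (by omega : 0 < S.card)) (sub_pos.2 ?_))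
    · refine Finset.sum_pos' (fun S _ => sq_nonneg _) ⟨S, by simp, by positivity⟩
    · exact pow_lt_pow_left₀ hlt h0 (by omega)

lemma nu_eq_zero (h : ∀ S : Finset (Fin r), S.Nonempty → fourierCoeff f S = 0) (ℓ : ℕ) :
    nu f δ ℓ = 0 := by
  have hw : ∀ j ∈ Finset.Icc 1 r, fourierWeight f j = 0 := by
    intro j hj
    refine Finset.sum_eq_zero fun S hS => ?_
    have hc := (Finset.mem_powersetCard.1 hS).2
    rw [h S (Finset.card_pos.1 (by have := (Finset.mem_Icc.1 hj).1; omega))]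
    simp
  have hxi : ∀ s, (xi f).derivative.eval s = 0 := by
    intro s
    rw [eval_derivative_xi]
    exact Finset.sum_eq_zero fun j hj => by rw [hw j hj, zero_mul]
  rw [nu, hxi, hxi]
  simp

/-- If the predicate is constant, then all increments of the messages vanish. -/
lemma Instance.uMsg_eq_zero {V E : Type*} [Fintype E] {I : Instance r V E} {d : ℕ}
    {F : V → E → (ℓ : ℕ) → (Fin ℓ → ℝ) → ℝ} (hI : ∀ b, Function.Injective (I.bdry b))
    (hlin : fourierWeight f 1 = 0)
    (h : ∀ S : Finset (Fin r), S.Nonempty → fourierCoeff f S = 0) (z₀ : V → ℝ) (m : ℕ) (i : V)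
    (a : E) : I.uMsg f d F z₀ (m + 1) i a = 0 := by
  rw [Instance.uMsg_succ z₀ hlin hI, Finset.sum_eq_zero, mul_zero]
  intro b hb
  obtain ⟨κ, rfl⟩ := (Instance.mem_starErase.1 hb).2
  have h1 : ∀ x, I.partialD f (I.bdry b κ) b x = 0 := by
    intro x
    rw [Instance.partialD_eq f (hI b)]
    refine Finset.sum_eq_zero fun S hS => ?_
    rw [Instance.fourierCoeff_clauseFun, h S ⟨κ, (Finset.mem_filter.1 hS).2⟩]
    ring
  rw [Instance.clauseStep, h1, h1, sub_zero]

end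

/-! ### Transfer from the canonical space -/

section

variable {V Ω : Type*} [Fintype V] [MeasurableSpace Ω] {μ : Measure Ω} [IsProbabilityMeasure μ]
  {P γ : Measure ℝ} [IsProbabilityMeasure P] [IsProbabilityMeasure γ] {z : V → Ω → ℝ}

/-- The initial values, as a random vector, have the product law. -/
lemma measurePreserving_of_iIndepFun (hz : ∀ v, Measurable (z v)) (hlaw : ∀ v, μ.map (z v) = P)
    (hind : iIndepFun z μ) : MeasurePreserving (fun ω v => z v ω) μ (Measure.pi fun _ : V => P) := by
  refine ⟨measurable_pi_lambda _ hz, ?_⟩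
  rw [(iIndepFun_iff_map_fun_eq_pi_map fun v => (hz v).aemeasurable).1 hind]
  simp only [hlaw]

/-- The coupled variable is independent of the initial values in a ball that avoids the resampled
coordinates. -/
lemma Instance.indep_couple_sigmaBall {r : ℕ} {E : Type*} {I : Instance r V E}
    [NullSingletonClass γ]
    (hmp : MeasurePreserving (fun ω v => z v ω) μ (Measure.pi fun _ : V => P))
    {A : Set V} {H : (V → ℝ) → ℝ} (hH : Measurable H)
    (hat : ∀ x, NullSingletonClass (resampleLaw P A H x)) {i : V} {ℓ : ℕ}
    (hA : ∀ v ∈ A, v ∉ I.ball i ℓ) :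
    Indep (MeasurableSpace.comap (fun ω => couple P γ A H fun v => z v ω) inferInstance)
      (I.sigmaBall z i ℓ) μ := by
  have hle : I.sigmaBall z i ℓ ≤
      MeasurableSpace.comap (fun ω (v : ↥Aᶜ) => z v ω) MeasurableSpace.pi := by
    refine iSup₂_le fun j hj => ?_
    have hjA : j ∈ Aᶜ := fun h => hA j h hj
    have h1 : z j = (fun y : ↥Aᶜ → ℝ => y ⟨j, hjA⟩) ∘ fun ω (v : ↥Aᶜ) => z v ω := rfl
    rw [h1, ← MeasurableSpace.comap_comp]
    exact MeasurableSpace.comap_mono (measurable_pi_apply (⟨j, hjA⟩ : ↥Aᶜ)).comap_le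
  have hU := measurable_couple (P := P) (γ := γ) (A := A) hH
  rw [Indep_iff]
  rintro _ t ⟨B, hB, rfl⟩ ht
  obtain ⟨D, hD, rfl⟩ := hle t ht
  set C : Set (V → ℝ) := (fun x (v : ↥Aᶜ) => x v) ⁻¹' D with hC
  have hCm : MeasurableSet C := (measurable_pi_lambda _ fun v => measurable_pi_apply _) hD
  have hCA : ∀ x x', merge A x x' ∈ C ↔ x ∈ C := by
    intro x x'
    have : (fun v : ↥Aᶜ => merge A x x' v) = fun v : ↥Aᶜ => x v := by
      ext v
      exact merge_apply_of_notMem v.2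
    simp only [hC, Set.mem_preimage, this]
  have e1 : μ ((fun ω => couple P γ A H fun v => z v ω) ⁻¹' B) = γ B := by
    have h1 := Measure.map_apply (μ := Measure.pi fun _ : V => P) hU hB
    rw [map_couple hH hat, ← hmp.measure_preimage (hU hB).nullMeasurableSet] at h1
    exact h1.symm
  have e2 : μ ((fun ω (v : ↥Aᶜ) => z v ω) ⁻¹' D) = (Measure.pi fun _ : V => P) C := by
    rw [← hmp.measure_preimage hCm.nullMeasurableSet]
    rfl
  rw [e1, e2, ← measure_couple_inter hH hat hB hCm hCA,
    ← hmp.measure_preimage ((hU hB).inter hCm).nullMeasurableSet]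
  rfl

end

/-- Convergence in mean implies convergence in probability of conditional expectations. -/
lemma tendsto_measure_condExp {Ω : ℕ → Type*} [m0 : ∀ n, MeasurableSpace (Ω n)]
    {μ : ∀ n, Measure (Ω n)} [∀ n, IsProbabilityMeasure (μ n)] (𝒢 : ∀ n, MeasurableSpace (Ω n))
    {X : ∀ n, Ω n → ℝ} (h : Tendsto (fun n => ∫ ω, |X n ω| ∂(μ n)) atTop (𝓝 0)) {ε : ℝ}
    (hε : 0 < ε) :
    Tendsto (fun n => μ n {ω | ε ≤ |condExp (𝒢 n) (μ n) (X n) ω|}) atTop (𝓝 0) := by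
  have hle : ∀ n, μ n {ω | ε ≤ |condExp (𝒢 n) (μ n) (X n) ω|} ≤
      ENNReal.ofReal ((∫ ω, |X n ω| ∂(μ n)) / ε) := by
    intro n
    have h1 := mul_meas_ge_le_integral_of_nonneg (μ := μ n)
      (f := fun ω => |condExp (𝒢 n) (μ n) (X n) ω|) (ae_of_all _ fun ω => abs_nonneg _)
      integrable_condExp.abs ε
    have h2 := integral_abs_condExp_le (m := 𝒢 n) (μ := μ n) (X n)
    rw [← ofReal_measureReal (μ := μ n)]
    refine ENNReal.ofReal_le_ofReal ?_
    rw [le_div_iff₀ hε, mul_comm]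
    exact h1.trans h2
  have h2 : Tendsto (fun n => ENNReal.ofReal ((∫ ω, |X n ω| ∂(μ n)) / ε)) atTop (𝓝 0) := by
    have := (ENNReal.continuous_ofReal.tendsto _).comp (h.div_const ε)
    simpa [Function.comp_def] using this
  exact tendsto_of_tendsto_of_tendsto_of_le_of_le tendsto_const_nhds h2 (fun _ => zero_le) hle

end MsgCSP

end

theorem theoremC
    {r : ℕ} (f : (Fin r → ℤˣ) → ℝ) (hf : ∀ x, f x = 0 ∨ f x = 1)
    (hlin : MsgCSP.fourierWeight f 1 = 0)
    (δ : ℝ) (hδ : 0 < δ) (K : ℝ)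
    (d : ℕ → ℕ) (hd_pos : ∀ n, 0 < d n) (hd : Tendsto d atTop atTop)
    (V E Ω : ℕ → Type*) [∀ n, Fintype (V n)] [∀ n, Fintype (E n)]
    [∀ n, MeasurableSpace (Ω n)]
    (μ : ∀ n, Measure (Ω n)) [∀ n, IsProbabilityMeasure (μ n)]
    (I : ∀ n, MsgCSP.Instance r (V n) (E n))
    (hreg : ∀ n, (I n).IndexRegular (d n))
    (hgirth : ∀ n, (I n).GirthAtLeast (2 * ⌊1 / δ⌋₊ + 2))
    (z : ∀ n, V n → Ω n → ℝ) (hz_meas : ∀ n v, Measurable (z n v))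
    (hz_law : ∀ n v, (μ n).map (z n v) = gaussianReal 0 δ.toNNReal)
    (hz_indep : ∀ n, iIndepFun (z n) (μ n))
    (F : ∀ n, V n → E n → (ℓ : ℕ) → (Fin ℓ → ℝ) → ℝ)
    (Fnode : ∀ n, V n → (ℓ : ℕ) → (Fin ℓ → ℝ) → ℝ)
    (hF : ∀ n, MsgCSP.Instance.BoundedNonlinearities (F n) (Fnode n) ⌊1 / δ⌋₊ K)
    (hnorm : ∀ n, (I n).SecondMomentNormalized f (d n) (F n) (μ n) (z n) (Fnode n) δ ⌊1 / δ⌋₊)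
    (i : ∀ n, V n) (ℓ : ℕ) (hℓ : 1 ≤ ℓ) (hℓL : ℓ ≤ ⌊1 / δ⌋₊) :
    ∃ U : ∀ n, Ω n → ℝ,
      (∀ n, Measurable (U n) ∧
        (μ n).map (U n) = gaussianReal 0 (MsgCSP.nu f δ ℓ).toNNReal ∧
        Indep (MeasurableSpace.comap (U n) inferInstance)
          ((I n).sigmaBall (z n) (i n) (ℓ - 1)) (μ n)) ∧
      ∀ a : ∀ n, E n, (∀ n, a n ∈ (I n).star (i n)) → ∀ p : ℝ, 0 < p →
        (∀ n, Integrable (fun ω =>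
          |(I n).uMsg f (d n) (F n) (fun v => z n v ω) ℓ (i n) (a n) - U n ω| ^ p) (μ n)) ∧
        ∀ ε : ℝ, 0 < ε → Tendsto (fun n => μ n {ω | ε ≤
          |condExp ((I n).sigmaBall (z n) (i n) (ℓ - 1)) (μ n) (fun ω' =>
              |(I n).uMsg f (d n) (F n) (fun v => z n v ω') ℓ (i n) (a n) - U n ω'| ^ p) ω|})
          atTop (𝓝 0) := by
  obtain ⟨m, rfl⟩ : ∃ m, ℓ = m + 1 := ⟨ℓ - 1, by omega⟩
  simp only [Nat.add_sub_cancel]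
  have hm : m < ⌊1 / δ⌋₊ := hℓL
  by_cases hconst : ∀ S : Finset (Fin r), S.Nonempty → MsgCSP.fourierCoeff f S = 0
  · -- A constant predicate: all messages vanish, and so does the variance.
    have hu : ∀ n x i a, (I n).uMsg f (d n) (F n) x (m + 1) i a = 0 := fun n x i a =>
      MsgCSP.Instance.uMsg_eq_zero (hgirth n).1 hlin hconst x m i a
    refine ⟨fun n _ => 0, fun n => ⟨measurable_const, ?_, ?_⟩, fun a _ p hp => ⟨fun n => ?_, ?_⟩⟩
    · rw [MsgCSP.nu_eq_zero hconst, Real.toNNReal_zero, gaussianReal_zero_var, Measure.map_const]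
      simp
    · rw [MeasurableSpace.comap_const]
      exact indep_bot_left _
    · simp only [hu, sub_zero, abs_zero, Real.zero_rpow hp.ne']
      exact integrable_const 0
    · intro ε hε
      simp only [hu, sub_zero, abs_zero, Real.zero_rpow hp.ne']
      exact MsgCSP.tendsto_measure_condExp (X := fun _ _ => 0)
        (fun n => (I n).sigmaBall (z n) (i n) m) (by simp) hε
  · push Not at hconst
    obtain ⟨S, hS, hfS⟩ := hconst
    have hS2 := MsgCSP.two_le_card_of_fourierCoeff_ne_zero hlin hS hfS
    have hr : 2 ≤ r := hS2.trans (by simpa using Finset.card_le_univ S)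
    have hnu := MsgCSP.nu_pos (f := f) hδ hS2 hfS
    have hmp : ∀ n, MeasurePreserving (fun ω v => z n v ω) (μ n)
        (MsgCSP.Instance.gaussPi δ (V n)) := fun n =>
      MsgCSP.measurePreserving_of_iIndepFun (hz_meas n) (hz_law n) (hz_indep n)
    have hadm : ∀ n, (I n).Admissible f δ K ⌊1 / δ⌋₊ (d n) (F n) := by
      intro n
      have hFm : ∀ s < ⌊1 / δ⌋₊, ∀ i a, Measurable (F n i a s) := fun s hs i a =>
        ((hF n s hs i).2 a).1
      refine ⟨?_, hreg n, hgirth n, hFm, fun s hs i a x => ?_, fun s hs j a hja => ?_⟩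
      · -- The degree is a positive multiple of `r`.
        have hdvd : r ∣ d n := ⟨_, ((hreg n (i n)).2 ⟨0, by omega⟩).symm⟩
        exact hr.trans (Nat.le_of_dvd (hd_pos n) hdvd)
      · exact abs_le.2 (((hF n s hs i).2 a).2 x)
      · rw [← (hnorm n s hs j a (MsgCSP.Instance.mem_star.2 hja)).2, ← (hmp n).map_eq,
          integral_map (hmp n).measurable.aemeasurable]
        exact ((MsgCSP.Instance.measurable_AMsg hFm hs j a).pow_const 2).aestronglyMeasurable
    have hex : ∀ n, ∃ b, (I n).Inc (i n) b := by
      intro n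
      obtain ⟨b, hb⟩ := Finset.card_pos.1
        (((hadm n).card_star (i n)).symm ▸ hd_pos n : 0 < ((I n).star (i n)).card)
      exact ⟨b, MsgCSP.Instance.mem_star.1 hb⟩
    -- The variable `U` is coupled with the message into an arbitrary clause `b n`; the messages into
    -- the other clauses are close to this one.
    choose b hb using hex
    choose v hv using fun n => (hadm n).clauseSphere_nonempty (m := m) hr (hb n)
    set w := (MsgCSP.nu f δ (m + 1)).toNNReal with hw
    have hw0 : w ≠ 0 := by simpa [hw] using hnu m
    have := nullSingletonClass_gaussianReal (μ := 0) hw0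
    set H := fun n => (I n).noisyMsg f (d n) (F n) m (i n) (b n) (v n) with hH
    set A := fun n => (I n).freshSphere m (i n) with hA
    have hHm : ∀ n, Measurable (H n) := fun n => (hadm n).measurable_noisyMsg hm _ _ _
    have hat := fun n => (hadm n).nullSingletonClass_noisyMsg hδ hm (hb n) (hv n)
    set U := fun n => MsgCSP.couple (gaussianReal 0 δ.toNNReal) (gaussianReal 0 w) (A n) (H n)
      with hU
    have hUm : ∀ n, Measurable (U n) := fun n => MsgCSP.measurable_couple (hHm n)
    refine ⟨fun n ω => U n fun v => z n v ω, fun n => ⟨(hUm n).comp (hmp n).measurable, ?_, ?_⟩,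
      fun a ha p hp => ?_⟩
    · have h1 := Measure.map_map (μ := μ n) (hUm n) (hmp n).measurable
      rw [(hmp n).map_eq, MsgCSP.map_couple (hHm n) (hat n)] at h1
      exact h1.symm
    · exact MsgCSP.Instance.indep_couple_sigmaBall (hmp n) (hHm n) (hat n)
        fun v hvA => (hadm n).notMem_ball_of_mem_freshSphere hm hvA
    · obtain ⟨h1, h2⟩ := MsgCSP.Instance.tendsto_integral_uMsg_sub_couple hf hlin hδ hnu hd hadm hm
        hb hv fun n => MsgCSP.Instance.mem_star.1 (ha n)
      have h3 := MsgCSP.tendsto_integral_abs_rpow h1 h2 hp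
      have hint : ∀ n, Integrable (fun x => |(I n).uMsg f (d n) (F n) x (m + 1) (i n) (a n) -
          U n x| ^ p) (MsgCSP.Instance.gaussPi δ (V n)) := fun n => by
        obtain ⟨C, hC⟩ := h1 n
        exact hC.integrable_rpow hp
      refine ⟨fun n => (hmp n).integrable_comp_of_integrable (hint n), fun ε hε => ?_⟩
      refine MsgCSP.tendsto_measure_condExp (fun n => (I n).sigmaBall (z n) (i n) m)
        (h3.congr fun n => ?_) hε
      rw [← (hmp n).map_eq, integral_map (hmp n).measurable.aemeasurable]
      · congr 1
        ext ω
        rw [abs_of_nonneg (Real.rpow_nonneg (abs_nonneg _) _)]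
      · rw [(hmp n).map_eq]
        exact (hint n).aestronglyMeasurable
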